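/- **Bicollections.** A bicollection is a family $P=(P(m,n))_{m,n\ge 0}$ of complex vector spaces; a morphism is a family of linear maps. The vertical tensor product is $(P\boxtimes Q)(m,n)=\bigoplus_{k\ge 0}P(m,k)\otimes Q(k,n)$, and its unit $\mathbb{C}_{\boxtimes}$ has $\mathbb{C}_{\boxtimes}(n,n)=\mathbb{C}1_n$ and $\mathbb{C}_{\boxtimes}(m,n)=0$ for $m\ne n$. They make bicollections a monoidal category. **Levelled forests.** A levelled forest $f=(\varphi,\lambda)$ is a word $\varphi$ of planar binary trees together with a bijection $\lambda$ from its set of internal vertices to $\{1,\dots,\|f\|\}$, where $\|f\|$ is the number of internal vertices, that increases along every path leaving a root. Reading the labels of the internal vertices from left to right (the $i$-th letter of a tree is the label of the vertex between its leaves $i-1$ and $i$) identifies $f$ with a pair $(\sigma,c)$, where $\sigma\in\mathfrak{S}_{\|f\|}$ and $c$ records the numbers of internal vertices of the successive trees. Permutations act by $s\cdot(\sigma,c)=(s\circ\sigma,c)$. If $f$ has as many leaves as $g$ has trees, $f\# g$ is obtained by placing the roots of $g$ on the leaves of $f$ and translating the labels of $g$ by $\|f\|$. For $0\le p\le\|f\|$,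 the horizontal cut of $f$ at level $p$ consists of the subforest $f^p_-$ of the vertices with label $\le p$ and of the forest $f^p_+$ that remains above it, with labels translated by $-p$. Let $\mathcal{LF}(m,n)$ be the complex vector space spanned by the levelled forests with $m$ trees and $n$ leaves (so $\mathcal{LF}(0,0)=\mathbb{C}$, spanned by the empty forest). **Structure maps.** Let $\mathrm{Sh}(p,q)\subset\mathfrak{S}_{p+q}$ be the set of permutations that increase on $\{1,\dots,p\}$ and on $\{p+1,\dots,p+q\}$, and let $\tau_{p,q}\in\mathrm{Sh}(p,q)$ be the one with $\tau_{p,q}(i)=q+i$ for $i\le p$ and $\tau_{p,q}(p+j)=j$ for $j\le q$. Define bicollection morphisms by $$\nabla(f\boxtimes g)=\sum_{s\in \mathrm{Sh}(\|f\|,\|g\|)}s\cdot(f\# g),\qquad \eta(1_n)=\bullet^n,\qquad \Delta(f)=\sum_{p=0}^{\|f\|}f^p_-\boxtimes f^p_+,$$ $\varepsilon(\bullet^n)=1_n$ and $\varepsilon(f)=0$ if $\|f\|>0$, where $\bullet^n$ is the forest of $n$ trees without internal vertices; let $$\mathsf{K}(f\boxtimes g)=h^{\|g\|}_-\boxtimes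 h^{\|g\|}_+,\quad h=\tau_{\|f\|,\|g\|}\cdot(f\# g),$$ and let $S:\mathcal{LF}\to\mathcal{LF}$ be the linear map with $S(f)=(-1)^{\|f\|}f^\star$, where $f^\star=c_{\|f\|}\cdot f$ and $c_n(i)=n+1-i$. **Theorem.** $(\mathcal{LF},\nabla,\eta,\Delta,\varepsilon)$ is a conilpotent Hopf monoid, with antipode $S$, in the category of bicollections with the vertical tensor product. In detail: 1. $(\mathcal{LF},\nabla,\eta)$ is a monoid and $(\mathcal{LF},\Delta,\varepsilon)$ is a comonoid. 2. $\mathsf{K}$ is a local symmetry of $\mathcal{LF}$: $\mathsf{K}\circ\mathsf{K}=\mathrm{id}$, $\mathsf{K}$ satisfies the braid equation on $\mathcal{LF}^{\boxtimes 3}$, and $\nabla,\eta,\Delta,\varepsilon$ are natural with respect to $\mathsf{K}$ in both arguments (for instance $\mathsf{K}\circ(\nabla\boxtimes\mathrm{id})=(\mathrm{id}\boxtimes\nabla)\circ(\mathsf{K}\boxtimes\mathrm{id})\circ(\mathrm{id}\boxtimes\mathsf{K})$). 3. $\mathcal{LF}\boxtimes\mathcal{LF}$ is a monoid with product $(\nabla\boxtimes\nabla)\circ(\mathrm{id}\boxtimes\mathsf{K}\boxtimes\mathrm{id})$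 and unit $\eta\boxtimes\eta$, and $\Delta$ and $\varepsilon$ are morphisms of monoids; in particular $\Delta\circ\nabla=(\nabla\boxtimes\nabla)\circ(\mathrm{id}\boxtimes\mathsf{K}\boxtimes\mathrm{id})\circ(\Delta\boxtimes\Delta)$. 4. $\nabla\circ(S\boxtimes\mathrm{id})\circ\Delta=\nabla\circ(\mathrm{id}\boxtimes S)\circ\Delta=\eta\circ\varepsilon$. 5. Let $\bar\Delta(x)=\Delta(x)-1\boxtimes x-x\boxtimes 1$ be the reduced coproduct, where $1\boxtimes x=\eta(1_m)\boxtimes x$ and $x\boxtimes 1=x\boxtimes\eta(1_n)$ for $x\in\mathcal{LF}(m,n)$. Each $x\in\mathcal{LF}(m,n)$ with $\varepsilon(x)=0$ is annihilated by all but finitely many of the iterates $\bar\Delta^{(0)}=\mathrm{id}$, $\bar\Delta^{(j+1)}=(\mathrm{id}\boxtimes\bar\Delta^{(j)})\circ\bar\Delta$. -/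

import Mathlib

open CategoryTheory MonoidalCategory
open scoped DirectSum TensorProduct

namespace LevelledForests

/-! ### Levelled planar binary forests -/

/-- The labels of the internal vertices of a planar binary tree, read from left to right: the
`i`-th letter is the label of the vertex lying between the leaves `i - 1` and `i`. -/
def inorder : BinaryTree ℕ → List ℕ
  | .nil => []
  | .node x a b => inorder a ++ x :: inorder b

/-- The labels of a planar binary tree increase strictly along every path leaving the root. -/
def Increasing : BinaryTree ℕ → Prop
  | .nil => True
  | .node x a b => (∀ y ∈ inorder a, x < y) ∧ (∀ y ∈ inorder b, x < y) ∧ Increasing a ∧ Increasing b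

/-- The word of a planar forest: the concatenation of the words of its trees. -/
def word (ts : List (BinaryTree ℕ)) : List ℕ := ts.flatMap inorder

/-- A levelled planar binary forest with `m` trees and `n` leaves: a word of `m` planar binary trees
with `n` leaves in total, together with an increasing bijection from the set of internal
vertices to `{0, …, N - 1}`, where `N` is the number of internal vertices. The levels are
numbered from `0` instead of `1`; the level of a vertex is stored at that vertex. -/
@[ext]
structure LevelledForest (m n : ℕ) where
  trees : List (BinaryTree ℕ)
  numTrees : trees.length = m
  numLeaves : (trees.map BinaryTree.numLeaves).sum = n
  increasing : ∀ t ∈ trees, Increasing t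
  bijective : (word trees).Perm (List.range (word trees).length)

/-- The number `‖f‖` of internal vertices (equivalently, of generations) of a forest. -/
def LevelledForest.norm {m n : ℕ} (f : LevelledForest m n) : ℕ := (word f.trees).length

theorem inorder_map (s : ℕ → ℕ) (t : BinaryTree ℕ) : inorder (t.map s) = (inorder t).map s := by
  induction t with
  | nil => rfl
  | node x a b iha ihb => simp [inorder, BinaryTree.map, iha, ihb]

theorem increasing_map {s : ℕ → ℕ} {t : BinaryTree ℕ}
    (hs : ∀ x ∈ inorder t, ∀ y ∈ inorder t, x < y → s x < s y) (h : Increasing t) :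
    Increasing (t.map s) := by
  induction t with
  | nil => trivial
  | node x a b iha ihb =>
    obtain ⟨h1, h2, h3, h4⟩ := h
    simp only [inorder, List.mem_append, List.mem_cons] at hs
    refine ⟨?_, ?_, iha (fun u hu v hv => hs u (.inl hu) v (.inl hv)) h3,
      ihb (fun u hu v hv => hs u (.inr (.inr hu)) v (.inr (.inr hv))) h4⟩ <;>
    · simp only [inorder_map, List.mem_map]
      rintro _ ⟨y, hy, rfl⟩
      first
      | exact hs x (.inr (.inl rfl)) y (.inl hy) (h1 y hy)
      | exact hs x (.inr (.inl rfl)) y (.inr (.inr hy)) (h2 y hy)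

theorem numLeaves_map (s : ℕ → ℕ) (t : BinaryTree ℕ) : (t.map s).numLeaves = t.numLeaves := by
  induction t with
  | nil => rfl
  | node x a b iha ihb => simp [BinaryTree.map, iha, ihb]

theorem length_inorder (t : BinaryTree ℕ) : (inorder t).length + 1 = t.numLeaves := by
  induction t with
  | nil => rfl
  | node x a b iha ihb => simp [inorder, ← iha, ← ihb]; omega

theorem perm_range_iff {w : List ℕ} :
    w.Perm (List.range w.length) ↔ w.Nodup ∧ ∀ x ∈ w, x < w.length := by
  constructor
  · intro h
    exact ⟨h.nodup_iff.2 List.nodup_range, fun x hx => List.mem_range.1 (h.mem_iff.1 hx)⟩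
  · rintro ⟨h1, h2⟩
    exact (h1.subperm fun x hx => List.mem_range.2 (h2 x hx)).perm_of_length_le (by simp)

/-! ### Action of permutations on the generations -/

/-- Adds the letter `x` at the beginning of the word of an increasing tree: the result is the
increasing tree whose word is `x :: inorder t`. -/
def push (x : ℕ) : BinaryTree ℕ → BinaryTree ℕ
  | .nil => .node x .nil .nil
  | .node y a b => if x < y then .node x .nil (.node y a b) else .node y (push x a) b

/-- The levelled tree associated with a word without repetition: the increasing planar binary
tree whose labels, read from left to right, form that word. -/
def ofWord (w : List ℕ) : BinaryTree ℕ := w.foldr push .nil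

theorem inorder_push (x : ℕ) (t : BinaryTree ℕ) : inorder (push x t) = x :: inorder t := by
  induction t with
  | nil => rfl
  | node y a b iha _ =>
    unfold push
    split_ifs <;> simp [inorder, iha]

theorem inorder_ofWord (w : List ℕ) : inorder (ofWord w) = w := by
  induction w with
  | nil => rfl
  | cons x w ih => exact (inorder_push x _).trans (congrArg _ ih)

theorem increasing_push {x : ℕ} {t : BinaryTree ℕ} (hx : x ∉ inorder t) (h : Increasing t) :
    Increasing (push x t) := by
  induction t with
  | nil => simp [push, Increasing, inorder]
  | node y a b iha _ =>
    simp only [inorder, List.mem_append, List.mem_cons, not_or] at hx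
    have h' := h
    obtain ⟨h1, h2, h3, h4⟩ := h
    unfold push
    split_ifs with hlt
    · refine ⟨by simp [inorder], ?_, trivial, h'⟩
      simp only [inorder, List.mem_append, List.mem_cons]
      rintro z (hz | rfl | hz)
      · exact hlt.trans (h1 z hz)
      · exact hlt
      · exact hlt.trans (h2 z hz)
    · refine ⟨?_, h2, iha hx.1 h3, h4⟩
      rw [inorder_push]
      simp only [List.mem_cons]
      rintro z (rfl | hz)
      · have := hx.2.1; omega
      · exact h1 z hz

theorem increasing_ofWord {w : List ℕ} (h : w.Nodup) : Increasing (ofWord w) := by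
  induction w with
  | nil => trivial
  | cons x w ih =>
    rw [List.nodup_cons] at h
    exact increasing_push (t := ofWord w) (by rw [inorder_ofWord]; exact h.1) (ih h.2)

theorem numLeaves_ofWord (t : BinaryTree ℕ) (s : ℕ → ℕ) :
    (ofWord ((inorder t).map s)).numLeaves = t.numLeaves := by
  rw [← length_inorder, ← length_inorder, inorder_ofWord, List.length_map]

/-- The permutation of `ℕ` that extends a permutation of `{0, …, N - 1}` by the identity. -/
def extendPerm {N : ℕ} (s : Equiv.Perm (Fin N)) : Equiv.Perm ℕ := s.extendDomain Fin.equivSubtype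

theorem extendPerm_lt {N : ℕ} (s : Equiv.Perm (Fin N)) {x : ℕ} (hx : x < N) :
    extendPerm s x = s ⟨x, hx⟩ :=
  Equiv.Perm.extendDomain_apply_subtype s Fin.equivSubtype hx

theorem word_ofWord_map (ts : List (BinaryTree ℕ)) (s : ℕ → ℕ) :
    word (ts.map fun t => ofWord ((inorder t).map s)) = (word ts).map s := by
  induction ts with
  | nil => rfl
  | cons t ts ih =>
    simp only [word, List.map_cons, List.flatMap_cons, List.map_append, inorder_ofWord] at ih ⊢
    rw [ih]

namespace LevelledForest

variable {m k n : ℕ}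

theorem nodup (f : LevelledForest m n) : (word f.trees).Nodup :=
  (perm_range_iff.1 f.bijective).1

theorem lt_norm (f : LevelledForest m n) {x : ℕ} (hx : x ∈ word f.trees) : x < f.norm :=
  (perm_range_iff.1 f.bijective).2 x hx

theorem nodup_inorder (f : LevelledForest m n) {t : BinaryTree ℕ} (ht : t ∈ f.trees) :
    (inorder t).Nodup :=
  (List.nodup_flatMap.1 f.nodup).1 t ht

/-- The left action of a permutation of the generations: if `f` is the split permutation `(σ, c)`,
that is `σ` is the word of `f` and `c` records the lengths of the words of its trees, then
`s · f` is the split permutation `(s ∘ σ, c)`. -/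
def act {N : ℕ} (s : Equiv.Perm (Fin N)) (f : LevelledForest m n) (hN : f.norm = N) :
    LevelledForest m n where
  trees := f.trees.map fun t => ofWord ((inorder t).map (extendPerm s))
  numTrees := by rw [List.length_map, f.numTrees]
  numLeaves := by
    rw [List.map_map]
    exact (congrArg List.sum (List.map_congr_left fun t _ => numLeaves_ofWord t _)).trans f.numLeaves
  increasing := by
    simp only [List.mem_map]
    rintro _ ⟨t, ht, rfl⟩
    exact increasing_ofWord ((f.nodup_inorder ht).map (extendPerm s).injective)
  bijective := by
    rw [word_ofWord_map, perm_range_iff]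
    refine ⟨f.nodup.map (extendPerm s).injective, ?_⟩
    simp only [List.mem_map, List.length_map]
    rintro _ ⟨x, hx, rfl⟩
    have hx' : x < N := hN ▸ f.lt_norm hx
    rw [extendPerm_lt s hx']
    exact (s ⟨x, hx'⟩).2.trans_eq hN.symm

theorem norm_act {N : ℕ} (s : Equiv.Perm (Fin N)) (f : LevelledForest m n) (hN : f.norm = N) :
    (f.act s hN).norm = N := by
  simp [norm, act, word_ofWord_map, ← hN]

end LevelledForest

/-! ### Horizontal gluing -/

/-- Grafts the trees of a list, from left to right, on the leaves of a tree. -/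
def graft : BinaryTree ℕ → List (BinaryTree ℕ) → BinaryTree ℕ
  | .nil, us => us.headD .nil
  | .node x a b, us => .node x (graft a (us.take a.numLeaves)) (graft b (us.drop a.numLeaves))

/-- Grafts the trees of the second forest, from left to right, on the leaves of the first. -/
def graftForest : List (BinaryTree ℕ) → List (BinaryTree ℕ) → List (BinaryTree ℕ)
  | [], _ => []
  | t :: ts, us => graft t (us.take t.numLeaves) :: graftForest ts (us.drop t.numLeaves)

theorem length_graftForest (ts us : List (BinaryTree ℕ)) :
    (graftForest ts us).length = ts.length := by
  induction ts generalizing us with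
  | nil => rfl
  | cons t ts ih => simp [graftForest, ih]

theorem numLeaves_graft (t : BinaryTree ℕ) (us : List (BinaryTree ℕ))
    (h : us.length = t.numLeaves) :
    (graft t us).numLeaves = (us.map BinaryTree.numLeaves).sum := by
  induction t generalizing us with
  | nil =>
    obtain ⟨u, rfl⟩ := List.length_eq_one_iff.1 h
    simp [graft]
  | node x a b iha ihb =>
    simp only [BinaryTree.numLeaves] at h
    rw [graft, BinaryTree.numLeaves, iha _ (by rw [List.length_take]; omega),
      ihb _ (by rw [List.length_drop]; omega), ← List.sum_append, ← List.map_append,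
      List.take_append_drop]

theorem numLeaves_graftForest (ts us : List (BinaryTree ℕ))
    (h : us.length = (ts.map BinaryTree.numLeaves).sum) :
    ((graftForest ts us).map BinaryTree.numLeaves).sum = (us.map BinaryTree.numLeaves).sum := by
  induction ts generalizing us with
  | nil => simp only [List.map_nil, List.sum_nil, List.length_eq_zero_iff] at h; simp [h, graftForest]
  | cons t ts ih =>
    simp only [List.map_cons, List.sum_cons] at h
    rw [graftForest, List.map_cons, List.sum_cons,
      numLeaves_graft _ _ (by rw [List.length_take]; omega),
      ih _ (by rw [List.length_drop]; omega), ← List.sum_append, ← List.map_append,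
      List.take_append_drop]

theorem inorder_graft_perm (t : BinaryTree ℕ) (us : List (BinaryTree ℕ))
    (h : us.length = t.numLeaves) :
    (inorder (graft t us)).Perm (inorder t ++ word us) := by
  induction t generalizing us with
  | nil =>
    obtain ⟨u, rfl⟩ := List.length_eq_one_iff.1 h
    simp [graft, inorder, word]
  | node x a b iha ihb =>
    simp only [BinaryTree.numLeaves] at h
    have ha := iha (us.take a.numLeaves) (by rw [List.length_take]; omega)
    have hb := ihb (us.drop a.numLeaves) (by rw [List.length_drop]; omega)
    have hw : word us = word (us.take a.numLeaves) ++ word (us.drop a.numLeaves) := by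
      rw [word, word, word, ← List.flatMap_append, List.take_append_drop]
    rw [hw]
    simp only [graft, inorder]
    rw [List.perm_iff_count] at *
    intro z
    have h1 := ha z
    have h2 := hb z
    simp only [List.count_append, List.count_cons] at *
    omega

theorem word_graftForest_perm (ts us : List (BinaryTree ℕ))
    (h : us.length = (ts.map BinaryTree.numLeaves).sum) :
    (word (graftForest ts us)).Perm (word ts ++ word us) := by
  induction ts generalizing us with
  | nil => simp only [List.map_nil, List.sum_nil, List.length_eq_zero_iff] at h; simp [h, graftForest, word]
  | cons t ts ih =>
    simp only [List.map_cons, List.sum_cons] at h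
    have ha := inorder_graft_perm t (us.take t.numLeaves) (by rw [List.length_take]; omega)
    have hb := ih (us.drop t.numLeaves) (by rw [List.length_drop]; omega)
    have hw : word us = word (us.take t.numLeaves) ++ word (us.drop t.numLeaves) := by
      rw [word, word, word, ← List.flatMap_append, List.take_append_drop]
    rw [hw]
    simp only [graftForest]
    rw [List.perm_iff_count] at *
    intro z
    have h1 := ha z
    have h2 := hb z
    simp only [word, List.flatMap_cons, List.count_append] at *
    omega

theorem increasing_graft {N : ℕ} (t : BinaryTree ℕ) (us : List (BinaryTree ℕ))
    (h : us.length = t.numLeaves) (ht : Increasing t) (hlt : ∀ x ∈ inorder t, x < N)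
    (hus : ∀ u ∈ us, Increasing u) (hge : ∀ x ∈ word us, N ≤ x) :
    Increasing (graft t us) := by
  induction t generalizing us with
  | nil =>
    obtain ⟨u, rfl⟩ := List.length_eq_one_iff.1 h
    simpa [graft] using hus u (by simp)
  | node x a b iha ihb =>
    simp only [BinaryTree.numLeaves] at h
    obtain ⟨h1, h2, h3, h4⟩ := ht
    simp only [inorder, List.mem_append, List.mem_cons] at hlt
    have hw : word us = word (us.take a.numLeaves) ++ word (us.drop a.numLeaves) := by
      rw [word, word, word, ← List.flatMap_append, List.take_append_drop]
    rw [hw] at hge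
    simp only [List.mem_append] at hge
    have hxN := hlt x (.inr (.inl rfl))
    refine ⟨fun y hy => ?_, fun y hy => ?_,
      iha _ (by rw [List.length_take]; omega) h3 (fun y hy => hlt y (.inl hy))
        (fun u hu => hus u (List.mem_of_mem_take hu)) (fun y hy => hge y (.inl hy)),
      ihb _ (by rw [List.length_drop]; omega) h4 (fun y hy => hlt y (.inr (.inr hy)))
        (fun u hu => hus u (List.mem_of_mem_drop hu)) (fun y hy => hge y (.inr hy))⟩
    · rw [(inorder_graft_perm a _ (by rw [List.length_take]; omega)).mem_iff, List.mem_append] at hy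
      rcases hy with hy | hy
      · exact h1 y hy
      · exact hxN.trans_le (hge y (.inl hy))
    · rw [(inorder_graft_perm b _ (by rw [List.length_drop]; omega)).mem_iff, List.mem_append] at hy
      rcases hy with hy | hy
      · exact h2 y hy
      · exact hxN.trans_le (hge y (.inr hy))

theorem increasing_graftForest {N : ℕ} (ts us : List (BinaryTree ℕ))
    (h : us.length = (ts.map BinaryTree.numLeaves).sum) (hts : ∀ t ∈ ts, Increasing t)
    (hlt : ∀ x ∈ word ts, x < N)
    (hus : ∀ u ∈ us, Increasing u) (hge : ∀ x ∈ word us, N ≤ x) :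
    ∀ t ∈ graftForest ts us, Increasing t := by
  induction ts generalizing us with
  | nil => simp [graftForest]
  | cons t ts ih =>
    simp only [List.map_cons, List.sum_cons] at h
    have hw : word us = word (us.take t.numLeaves) ++ word (us.drop t.numLeaves) := by
      rw [word, word, word, ← List.flatMap_append, List.take_append_drop]
    rw [hw] at hge
    simp only [List.mem_append] at hge
    simp only [word, List.flatMap_cons, List.mem_append] at hlt
    simp only [graftForest, List.mem_cons]
    rintro v (rfl | hv)
    · exact increasing_graft t _ (by rw [List.length_take]; omega) (hts t (by simp))
        (fun x hx => hlt x (.inl hx)) (fun u hu => hus u (List.mem_of_mem_take hu))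
        (fun y hy => hge y (.inl hy))
    · exact ih _ (by rw [List.length_drop]; omega) (fun t ht => hts t (by simp [ht]))
        (fun x hx => hlt x (.inr hx)) (fun u hu => hus u (List.mem_of_mem_drop hu))
        (fun y hy => hge y (.inr hy)) v hv

theorem word_map_map (s : ℕ → ℕ) (ts : List (BinaryTree ℕ)) :
    word (ts.map (BinaryTree.map s)) = (word ts).map s := by
  induction ts with
  | nil => rfl
  | cons t ts ih =>
    simp only [word, List.map_cons, List.flatMap_cons, List.map_append, inorder_map] at ih ⊢
    rw [ih]

namespace LevelledForest

variable {m k n : ℕ}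

/-- The trees of `f # g`. -/
def glueTrees (f : LevelledForest m k) (g : LevelledForest k n) : List (BinaryTree ℕ) :=
  graftForest f.trees (g.trees.map (BinaryTree.map (· + f.norm)))

theorem glue_length (f : LevelledForest m k) (g : LevelledForest k n) :
    (g.trees.map (BinaryTree.map (· + f.norm))).length =
      (f.trees.map BinaryTree.numLeaves).sum := by
  rw [List.length_map, g.numTrees, f.numLeaves]

theorem word_glueTrees_perm (f : LevelledForest m k) (g : LevelledForest k n) :
    (word (glueTrees f g)).Perm (word f.trees ++ (word g.trees).map (· + f.norm)) := by
  have := word_graftForest_perm _ _ (glue_length f g)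
  rwa [word_map_map] at this

/-- The horizontal gluing `f # g`: the roots of the trees of `g` are superimposed, from left to
right, on the leaves of `f`, and the levels of `g` are translated by `‖f‖`. -/
def glue (f : LevelledForest m k) (g : LevelledForest k n) : LevelledForest m n where
  trees := glueTrees f g
  numTrees := by rw [glueTrees, length_graftForest, f.numTrees]
  numLeaves := by
    rw [glueTrees, numLeaves_graftForest _ _ (glue_length f g), List.map_map]
    exact (congrArg List.sum (List.map_congr_left fun t _ => numLeaves_map _ t)).trans g.numLeaves
  increasing := by
    refine increasing_graftForest (N := f.norm) _ _ (glue_length f g) f.increasing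
      (fun x hx => f.lt_norm hx) ?_ ?_
    · simp only [List.mem_map]
      rintro _ ⟨t, ht, rfl⟩
      exact increasing_map (fun x _ y _ hxy => by omega) (g.increasing t ht)
    · rw [word_map_map]
      simp
  bijective := by
    rw [perm_range_iff, (word_glueTrees_perm f g).nodup_iff, (word_glueTrees_perm f g).length_eq,
      List.nodup_append, List.length_append, List.length_map]
    refine ⟨⟨f.nodup, g.nodup.map (add_left_injective _), ?_⟩, fun x hx => ?_⟩
    · simp only [List.mem_map]
      rintro x hx _ ⟨y, _, rfl⟩
      have := f.lt_norm hx
      omega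
    · rw [(word_glueTrees_perm f g).mem_iff, List.mem_append, List.mem_map] at hx
      rcases hx with hx | ⟨y, hy, rfl⟩
      · exact Nat.lt_add_right _ (f.lt_norm hx)
      · have := g.lt_norm hy
        simp only [norm] at *
        omega

theorem norm_glue (f : LevelledForest m k) (g : LevelledForest k n) :
    (f.glue g).norm = f.norm + g.norm := by
  rw [norm, glue, (word_glueTrees_perm f g).length_eq, List.length_append, List.length_map]
  rfl

end LevelledForest

/-! ### Horizontal cuts -/

/-- The part of a tree made of the vertices of level less than `p`. -/
def lowerTree (p : ℕ) : BinaryTree ℕ → BinaryTree ℕ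
  | .nil => .nil
  | .node x a b => if x < p then .node x (lowerTree p a) (lowerTree p b) else .nil

/-- The forest left above a tree when its vertices of level less than `p` are removed, with levels
translated by `-p`. -/
def upperTrees (p : ℕ) : BinaryTree ℕ → List (BinaryTree ℕ)
  | .nil => [.nil]
  | .node x a b =>
    if x < p then upperTrees p a ++ upperTrees p b else [(BinaryTree.node x a b).map (· - p)]

theorem inorder_lowerTree (p : ℕ) {t : BinaryTree ℕ} (h : Increasing t) :
    inorder (lowerTree p t) = (inorder t).filter (· < p) := by
  induction t with
  | nil => rfl
  | node x a b iha ihb =>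
    obtain ⟨h1, h2, h3, h4⟩ := h
    unfold lowerTree
    split_ifs with hx
    · simp [inorder, iha h3, ihb h4, hx]
    · symm
      simp only [inorder, List.filter_eq_nil_iff, List.mem_append, List.mem_cons,
        decide_eq_true_eq, not_lt] at hx ⊢
      rintro y (hy | rfl | hy)
      · exact hx.trans (h1 y hy).le
      · exact hx
      · exact hx.trans (h2 y hy).le

theorem word_upperTrees (p : ℕ) {t : BinaryTree ℕ} (h : Increasing t) :
    word (upperTrees p t) = ((inorder t).filter (p ≤ ·)).map (· - p) := by
  induction t with
  | nil => rfl
  | node x a b iha ihb =>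
    obtain ⟨h1, h2, h3, h4⟩ := h
    unfold upperTrees
    split_ifs with hx
    · have e : word (upperTrees p a ++ upperTrees p b) =
        word (upperTrees p a) ++ word (upperTrees p b) := by simp [word]
      simp [e, inorder, iha h3, ihb h4, hx]
    · have e : (inorder (.node x a b)).filter (p ≤ ·) = inorder (.node x a b) := by
        rw [List.filter_eq_self]
        simp only [inorder, List.mem_append, List.mem_cons, decide_eq_true_eq, not_lt] at hx ⊢
        rintro y (hy | rfl | hy)
        · exact hx.trans (h1 y hy).le
        · exact hx
        · exact hx.trans (h2 y hy).le
      rw [e, ← inorder_map]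
      simp [word]

theorem increasing_lowerTree (p : ℕ) {t : BinaryTree ℕ} (h : Increasing t) :
    Increasing (lowerTree p t) := by
  induction t with
  | nil => trivial
  | node x a b iha ihb =>
    obtain ⟨h1, h2, h3, h4⟩ := h
    unfold lowerTree
    split_ifs with hx
    · refine ⟨fun y hy => ?_, fun y hy => ?_, iha h3, ihb h4⟩
      · rw [inorder_lowerTree p h3] at hy
        exact h1 y (List.mem_of_mem_filter hy)
      · rw [inorder_lowerTree p h4] at hy
        exact h2 y (List.mem_of_mem_filter hy)
    · trivial

theorem increasing_upperTrees (p : ℕ) {t : BinaryTree ℕ} (h : Increasing t) :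
    ∀ u ∈ upperTrees p t, Increasing u := by
  induction t with
  | nil => simp [upperTrees, Increasing]
  | node x a b iha ihb =>
    have h' := h
    obtain ⟨h1, h2, h3, h4⟩ := h
    unfold upperTrees
    split_ifs with hx
    · simp only [List.mem_append]
      rintro u (hu | hu)
      · exact iha h3 u hu
      · exact ihb h4 u hu
    · simp only [List.mem_singleton]
      rintro u rfl
      have hp : ∀ y ∈ inorder (.node x a b), p ≤ y := by
        simp only [inorder, List.mem_append, List.mem_cons, not_lt] at hx ⊢
        rintro y (hy | rfl | hy)
        · exact hx.trans (h1 y hy).le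
        · exact hx
        · exact hx.trans (h2 y hy).le
      refine increasing_map (fun y hy z hz hyz => ?_) h'
      have := hp y hy
      omega

theorem length_upperTrees (p : ℕ) (t : BinaryTree ℕ) :
    (upperTrees p t).length = (lowerTree p t).numLeaves := by
  induction t with
  | nil => rfl
  | node x a b iha ihb =>
    unfold upperTrees lowerTree
    split_ifs <;> simp [iha, ihb]

theorem numLeaves_upperTrees (p : ℕ) (t : BinaryTree ℕ) :
    ((upperTrees p t).map BinaryTree.numLeaves).sum = t.numLeaves := by
  induction t with
  | nil => rfl
  | node x a b iha ihb =>
    unfold upperTrees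
    split_ifs
    · simp [iha, ihb]
    · rw [List.map_singleton, List.sum_singleton, numLeaves_map]

theorem numLeaves_flatMap_upperTrees (p : ℕ) (ts : List (BinaryTree ℕ)) :
    ((ts.flatMap (upperTrees p)).map BinaryTree.numLeaves).sum =
      (ts.map BinaryTree.numLeaves).sum := by
  induction ts with
  | nil => rfl
  | cons t ts ih =>
    rw [List.flatMap_cons, List.map_append, List.sum_append, ih, numLeaves_upperTrees,
      List.map_cons, List.sum_cons]

theorem filter_lt_range (p N : ℕ) :
    (List.range N).filter (· < p) = List.range (min p N) := by
  induction N with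
  | zero => simp
  | succ N ih =>
    rw [List.range_succ, List.filter_append, ih]
    by_cases h : N < p
    · rw [min_eq_right (by omega), min_eq_right (by omega), List.range_succ]
      simp [h]
    · rw [min_eq_left (by omega), min_eq_left (by omega)]
      simp [h]

theorem map_filter_le_range (p N : ℕ) :
    ((List.range N).filter (p ≤ ·)).map (· - p) = List.range (N - p) := by
  induction N with
  | zero => simp
  | succ N ih =>
    rw [List.range_succ, List.filter_append, List.map_append, ih]
    by_cases h : p ≤ N
    · rw [Nat.succ_sub h, List.range_succ]
      simp [h]
    · rw [Nat.sub_eq_zero_of_le (by omega), Nat.sub_eq_zero_of_le (by omega)]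
      simp [h]

theorem word_map_lowerTree (p : ℕ) {ts : List (BinaryTree ℕ)} (h : ∀ t ∈ ts, Increasing t) :
    word (ts.map (lowerTree p)) = (word ts).filter (· < p) := by
  induction ts with
  | nil => rfl
  | cons t ts ih =>
    have := ih fun u hu => h u (by simp [hu])
    simp only [word, List.map_cons, List.flatMap_cons, List.filter_append] at this ⊢
    rw [this, inorder_lowerTree p (h t (by simp))]

theorem word_flatMap_upperTrees (p : ℕ) {ts : List (BinaryTree ℕ)} (h : ∀ t ∈ ts, Increasing t) :
    word (ts.flatMap (upperTrees p)) = ((word ts).filter (p ≤ ·)).map (· - p) := by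
  induction ts with
  | nil => rfl
  | cons t ts ih =>
    have h1 := ih fun u hu => h u (by simp [hu])
    have h2 := word_upperTrees p (h t (by simp))
    simp only [word, List.flatMap_cons, List.flatMap_append, List.filter_append,
      List.map_append] at h1 h2 ⊢
    rw [h1, h2]

namespace LevelledForest

variable {m k n : ℕ}

/-- The number of leaves of the lower component of the horizontal cut of `f` at level `p`. -/
def cutWidth (f : LevelledForest m n) (p : ℕ) : ℕ :=
  ((f.trees.map (lowerTree p)).map BinaryTree.numLeaves).sum

/-- The lower component `f₋ᵖ` of the horizontal cut of `f` at level `p`: the levelled subforest made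
of the `p` lowest generations of `f`. -/
def lower (f : LevelledForest m n) (p : ℕ) : LevelledForest m (f.cutWidth p) where
  trees := f.trees.map (lowerTree p)
  numTrees := by rw [List.length_map, f.numTrees]
  numLeaves := rfl
  increasing := by
    simp only [List.mem_map]
    rintro _ ⟨t, ht, rfl⟩
    exact increasing_lowerTree p (f.increasing t ht)
  bijective := by
    rw [word_map_lowerTree p f.increasing]
    have e := f.bijective.filter (· < p)
    rw [filter_lt_range] at e
    have := e.length_eq
    rw [List.length_range] at this
    rwa [this]

/-- The upper component `f ∖ f₋ᵖ` of the horizontal cut of `f` at level `p`. -/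
def upper (f : LevelledForest m n) (p : ℕ) : LevelledForest (f.cutWidth p) n where
  trees := f.trees.flatMap (upperTrees p)
  numTrees := by
    rw [List.length_flatMap, cutWidth, List.map_map]
    exact congrArg List.sum (List.map_congr_left fun t _ => length_upperTrees p t)
  numLeaves := by
    rw [numLeaves_flatMap_upperTrees, f.numLeaves]
  increasing := by
    simp only [List.mem_flatMap]
    rintro u ⟨t, ht, hu⟩
    exact increasing_upperTrees p (f.increasing t ht) u hu
  bijective := by
    rw [word_flatMap_upperTrees p f.increasing]
    have e := (f.bijective.filter (p ≤ ·)).map (· - p)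
    rw [map_filter_le_range] at e
    have := e.length_eq
    rw [List.length_range] at this
    rwa [this]

/-- The forest `• ⋯ •` of `m = n` trees without internal vertices. -/
def trivial (h : m = n) : LevelledForest m n where
  trees := List.replicate m .nil
  numTrees := List.length_replicate
  numLeaves := by simp [h]
  increasing := by
    intro t ht
    rw [List.eq_of_mem_replicate ht]
    exact True.intro
  bijective := by
    have : word (List.replicate m .nil) = [] := by simp [word, inorder]
    rw [this]
    exact List.Perm.refl _

end LevelledForest

noncomputable section

/-! ### Bicollections and the vertical tensor product -/

/-- A bicollection: a family of complex vector spaces `P(m, n)` indexed by `m, n ≥ 0`. -/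
structure Bicollection where
  obj : ℕ → ℕ → Type
  [addCommGroup : ∀ m n, AddCommGroup (obj m n)]
  [module : ∀ m n, Module ℂ (obj m n)]

attribute [instance] Bicollection.addCommGroup Bicollection.module

namespace Bicollection

/-- A morphism of bicollections: a family of linear maps. -/
@[ext]
structure Hom (P Q : Bicollection) where
  app : ∀ m n, P.obj m n →ₗ[ℂ] Q.obj m n

instance : Category Bicollection where
  Hom := Hom
  id P := ⟨fun _ _ => LinearMap.id⟩
  comp f g := ⟨fun m n => g.app m n ∘ₗ f.app m n⟩

@[ext]
theorem hom_ext {P Q : Bicollection} {f g : P ⟶ Q} (h : ∀ m n, f.app m n = g.app m n) : f = g :=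
  Hom.ext (funext fun m => funext fun n => h m n)

@[simp]
theorem id_app (P : Bicollection) (m n : ℕ) : Hom.app (𝟙 P) m n = LinearMap.id := rfl

@[simp]
theorem comp_app {P Q R : Bicollection} (f : P ⟶ Q) (g : Q ⟶ R) (m n : ℕ) :
    (f ≫ g).app m n = g.app m n ∘ₗ f.app m n := rfl

/-- The vertical tensor product `(P ⦶ Q)(m, n) = ⨁ₖ P(m, k) ⊗ Q(k, n)`. -/
def vtensor (P Q : Bicollection) : Bicollection where
  obj m n := ⨁ k : ℕ, P.obj m k ⊗[ℂ] Q.obj k n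

/-- The elementary tensor `x ⦶ y` of `x ∈ P(m, k)` and `y ∈ Q(k, n)`. -/
def tmul {P Q : Bicollection} {m k n : ℕ} (x : P.obj m k) (y : Q.obj k n) :
    (vtensor P Q).obj m n :=
  DirectSum.lof ℂ ℕ (fun k => P.obj m k ⊗[ℂ] Q.obj k n) k (x ⊗ₜ[ℂ] y)

/-- The linear map out of `(P ⦶ Q)(m, n)` given by a family of bilinear maps. -/
def vlift {P Q : Bicollection} {m n : ℕ} {M : Type} [AddCommGroup M] [Module ℂ M]
    (b : ∀ k, P.obj m k →ₗ[ℂ] Q.obj k n →ₗ[ℂ] M) : (vtensor P Q).obj m n →ₗ[ℂ] M :=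
  DirectSum.toModule ℂ ℕ M fun k => TensorProduct.lift (b k)

@[simp]
theorem vlift_tmul {P Q : Bicollection} {m k n : ℕ} {M : Type} [AddCommGroup M] [Module ℂ M]
    (b : ∀ k, P.obj m k →ₗ[ℂ] Q.obj k n →ₗ[ℂ] M) (x : P.obj m k) (y : Q.obj k n) :
    vlift b (tmul x y) = b k x y :=
  by
  refine Eq.trans (DirectSum.toModule_lof ℂ (N := M) (φ := fun k => TensorProduct.lift (b k)) k
    (x ⊗ₜ[ℂ] y)) ?_
  exact TensorProduct.lift.tmul x y

theorem vtensor_ext {P Q : Bicollection} {m n : ℕ} {M : Type} [AddCommGroup M] [Module ℂ M]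
    {f g : (vtensor P Q).obj m n →ₗ[ℂ] M}
    (h : ∀ k (x : P.obj m k) (y : Q.obj k n), f (tmul x y) = g (tmul x y)) : f = g :=
  DirectSum.linearMap_ext ℂ fun k => TensorProduct.ext' fun x y => h k x y

/-- `tmul` as a bilinear map. -/
def tmulₗ (P Q : Bicollection) (m k n : ℕ) :
    P.obj m k →ₗ[ℂ] Q.obj k n →ₗ[ℂ] (vtensor P Q).obj m n :=
  (TensorProduct.mk ℂ _ _).compr₂
    (DirectSum.lof ℂ ℕ (fun k => P.obj m k ⊗[ℂ] Q.obj k n) k)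

@[simp]
theorem tmulₗ_apply {P Q : Bicollection} {m k n : ℕ} (x : P.obj m k) (y : Q.obj k n) :
    tmulₗ P Q m k n x y = tmul x y := rfl

theorem add_tmul {P Q : Bicollection} {m k n : ℕ} (x x' : P.obj m k) (y : Q.obj k n) :
    tmul (x + x') y = tmul x y + tmul x' y := (tmulₗ P Q m k n).map_add₂ x x' y

theorem tmul_add {P Q : Bicollection} {m k n : ℕ} (x : P.obj m k) (y y' : Q.obj k n) :
    tmul x (y + y') = tmul x y + tmul x y' := (tmulₗ P Q m k n x).map_add y y'

theorem smul_tmul {P Q : Bicollection} {m k n : ℕ} (c : ℂ) (x : P.obj m k) (y : Q.obj k n) :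
    tmul (c • x) y = c • tmul x y := (tmulₗ P Q m k n).map_smul₂ c x y

theorem tmul_smul {P Q : Bicollection} {m k n : ℕ} (c : ℂ) (x : P.obj m k) (y : Q.obj k n) :
    tmul x (c • y) = c • tmul x y := (tmulₗ P Q m k n x).map_smul c y

/-- The vertical tensor product of two morphisms. -/
def vtensorHom {P P' Q Q' : Bicollection} (f : P ⟶ P') (g : Q ⟶ Q') :
    vtensor P Q ⟶ vtensor P' Q' where
  app m n := vlift fun k => (tmulₗ P' Q' m k n).compl₁₂ (f.app m k) (g.app k n)

@[simp]
theorem vtensorHom_tmul {P P' Q Q' : Bicollection} (f : P ⟶ P') (g : Q ⟶ Q') {m k n : ℕ}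
    (x : P.obj m k) (y : Q.obj k n) :
    (vtensorHom f g).app m n (tmul x y) = tmul (f.app m k x) (g.app k n y) := by
  simp [vtensorHom]

/-- The vertical unit: `ℂ` (spanned by `1ₙ`) at `(n, n)`, and zero at `(m, n)` for `m ≠ n`. -/
def vunit : Bicollection where
  obj m n := PLift (m = n) →₀ ℂ

/-- The generator `1ₙ` of the vertical unit. -/
def vone (n : ℕ) : vunit.obj n n := Finsupp.single ⟨rfl⟩ 1

/-- The linear map out of `vunit.obj m n` with a given value at the generator. -/
def vunitLift {m n : ℕ} {M : Type} [AddCommGroup M] [Module ℂ M] (v : m = n → M) :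
    vunit.obj m n →ₗ[ℂ] M :=
  Finsupp.linearCombination ℂ fun h : PLift (m = n) => v h.down

@[simp]
theorem vunitLift_vone {n : ℕ} {M : Type} [AddCommGroup M] [Module ℂ M] (v : n = n → M) :
    vunitLift v (vone n) = v rfl :=
  (Finsupp.linearCombination_single ℂ _ _).trans (one_smul ℂ _)

theorem vunit_ext {m n : ℕ} {M : Type} [AddCommGroup M] [Module ℂ M]
    {f g : vunit.obj m n →ₗ[ℂ] M}
    (h : ∀ e : m = n, f (e ▸ vone m) = g (e ▸ vone m)) : f = g :=
  Finsupp.lhom_ext' fun e => LinearMap.ext_ring (by obtain ⟨rfl⟩ := e; exact h rfl)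

theorem vtensor_ext₃ {P Q R : Bicollection} {m n : ℕ} {M : Type} [AddCommGroup M] [Module ℂ M]
    {f g : (vtensor (vtensor P Q) R).obj m n →ₗ[ℂ] M}
    (h : ∀ k l (x : P.obj m k) (y : Q.obj k l) (z : R.obj l n),
      f (tmul (tmul x y) z) = g (tmul (tmul x y) z)) : f = g := by
  refine vtensor_ext fun l u z => ?_
  exact LinearMap.congr_fun (f := f ∘ₗ (tmulₗ (vtensor P Q) R m l n).flip z)
    (g := g ∘ₗ (tmulₗ (vtensor P Q) R m l n).flip z) (vtensor_ext fun k x y => h k l x y z) u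

theorem vtensor_ext₄ {P Q R S : Bicollection} {m n : ℕ} {M : Type} [AddCommGroup M] [Module ℂ M]
    {f g : (vtensor (vtensor (vtensor P Q) R) S).obj m n →ₗ[ℂ] M}
    (h : ∀ k l j (x : P.obj m k) (y : Q.obj k l) (z : R.obj l j) (w : S.obj j n),
      f (tmul (tmul (tmul x y) z) w) = g (tmul (tmul (tmul x y) z) w)) : f = g := by
  refine vtensor_ext fun j u w => ?_
  exact LinearMap.congr_fun (f := f ∘ₗ (tmulₗ (vtensor (vtensor P Q) R) S m j n).flip w)
    (g := g ∘ₗ (tmulₗ (vtensor (vtensor P Q) R) S m j n).flip w)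
    (vtensor_ext₃ fun k l x y z => h k l j x y z w) u

theorem vtensor_ext₃' {P Q R : Bicollection} {m n : ℕ} {M : Type} [AddCommGroup M] [Module ℂ M]
    {f g : (vtensor P (vtensor Q R)).obj m n →ₗ[ℂ] M}
    (h : ∀ k l (x : P.obj m k) (y : Q.obj k l) (z : R.obj l n),
      f (tmul x (tmul y z)) = g (tmul x (tmul y z))) : f = g := by
  refine vtensor_ext fun k x u => ?_
  exact LinearMap.congr_fun (f := f ∘ₗ tmulₗ P (vtensor Q R) m k n x)
    (g := g ∘ₗ tmulₗ P (vtensor Q R) m k n x) (vtensor_ext fun l y z => h k l x y z) u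

theorem vunit_vtensor_ext {P : Bicollection} {m n : ℕ} {M : Type} [AddCommGroup M] [Module ℂ M]
    {f g : (vtensor vunit P).obj m n →ₗ[ℂ] M}
    (h : ∀ x : P.obj m n, f (tmul (vone m) x) = g (tmul (vone m) x)) : f = g := by
  refine vtensor_ext fun k u x => ?_
  refine LinearMap.congr_fun (f := f ∘ₗ (tmulₗ vunit P m k n).flip x)
    (g := g ∘ₗ (tmulₗ vunit P m k n).flip x) (vunit_ext fun e => ?_) u
  subst e
  exact h x

theorem vtensor_vunit_ext {P : Bicollection} {m n : ℕ} {M : Type} [AddCommGroup M] [Module ℂ M]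
    {f g : (vtensor P vunit).obj m n →ₗ[ℂ] M}
    (h : ∀ x : P.obj m n, f (tmul x (vone n)) = g (tmul x (vone n))) : f = g := by
  refine vtensor_ext fun k x u => ?_
  refine LinearMap.congr_fun (f := f ∘ₗ tmulₗ P vunit m k n x)
    (g := g ∘ₗ tmulₗ P vunit m k n x) (vunit_ext fun e => ?_) u
  subst e
  exact h x

/-- The associativity isomorphism `(x ⦶ y) ⦶ z ↦ x ⦶ (y ⦶ z)`. -/
def vassoc (P Q R : Bicollection) : vtensor (vtensor P Q) R ≅ vtensor P (vtensor Q R) where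
  hom := ⟨fun m n => vlift fun l => vlift fun k =>
    LinearMap.mk₂ ℂ (fun x y => (tmulₗ P (vtensor Q R) m k n x) ∘ₗ (tmulₗ Q R k l n y))
      (fun _ _ _ => LinearMap.ext fun _ => by simp)
      (fun _ _ _ => LinearMap.ext fun _ => by simp)
      (fun _ _ _ => LinearMap.ext fun _ => by simp [tmul_add])
      (fun _ _ _ => LinearMap.ext fun _ => by simp)⟩
  inv := ⟨fun m n => vlift fun k => LinearMap.flip <| vlift fun l =>
    LinearMap.mk₂ ℂ
      (fun y z => ((tmulₗ (vtensor P Q) R m l n).flip z) ∘ₗ ((tmulₗ P Q m k l).flip y))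
      (fun _ _ _ => LinearMap.ext fun _ => by simp)
      (fun _ _ _ => LinearMap.ext fun _ => by simp)
      (fun _ _ _ => LinearMap.ext fun _ => by simp)
      (fun _ _ _ => LinearMap.ext fun _ => by simp)⟩
  hom_inv_id := by
    refine hom_ext fun m n => vtensor_ext₃ fun k l x y z => ?_
    simp
  inv_hom_id := by
    refine hom_ext fun m n => vtensor_ext₃' fun k l x y z => ?_
    simp

@[simp]
theorem vassoc_hom_tmul {P Q R : Bicollection} {m k l n : ℕ}
    (x : P.obj m k) (y : Q.obj k l) (z : R.obj l n) :
    (vassoc P Q R).hom.app m n (tmul (tmul x y) z) = tmul x (tmul y z) := by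
  simp [vassoc]

@[simp]
theorem vassoc_inv_tmul {P Q R : Bicollection} {m k l n : ℕ}
    (x : P.obj m k) (y : Q.obj k l) (z : R.obj l n) :
    (vassoc P Q R).inv.app m n (tmul x (tmul y z)) = tmul (tmul x y) z := by
  simp [vassoc]

/-- The left unit isomorphism `1ₘ ⦶ x ↦ x`. -/
def vleftUnitor (P : Bicollection) : vtensor vunit P ≅ P where
  hom := ⟨fun m n => vlift fun k => vunitLift fun e : m = k => e ▸ LinearMap.id⟩
  inv := ⟨fun m n => tmulₗ vunit P m m n (vone m)⟩
  hom_inv_id := by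
    refine hom_ext fun m n => vunit_vtensor_ext fun x => ?_
    simp
  inv_hom_id := by
    refine hom_ext fun m n => ?_
    refine LinearMap.ext fun x => ?_
    simp

@[simp]
theorem vleftUnitor_hom_tmul {P : Bicollection} {m n : ℕ} (x : P.obj m n) :
    (vleftUnitor P).hom.app m n (tmul (vone m) x) = x := by
  simp [vleftUnitor]

@[simp]
theorem vleftUnitor_inv_apply {P : Bicollection} {m n : ℕ} (x : P.obj m n) :
    (vleftUnitor P).inv.app m n x = tmul (vone m) x := rfl

/-- The right unit isomorphism `x ⦶ 1ₙ ↦ x`. -/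
def vrightUnitor (P : Bicollection) : vtensor P vunit ≅ P where
  hom := ⟨fun m n => vlift fun k => LinearMap.flip <| vunitLift fun e : k = n => e ▸ LinearMap.id⟩
  inv := ⟨fun m n => (tmulₗ P vunit m n n).flip (vone n)⟩
  hom_inv_id := by
    refine hom_ext fun m n => vtensor_vunit_ext fun x => ?_
    simp
  inv_hom_id := by
    refine hom_ext fun m n => ?_
    refine LinearMap.ext fun x => ?_
    simp

@[simp]
theorem vrightUnitor_hom_tmul {P : Bicollection} {m n : ℕ} (x : P.obj m n) :
    (vrightUnitor P).hom.app m n (tmul x (vone n)) = x := by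
  simp [vrightUnitor]

@[simp]
theorem vrightUnitor_inv_apply {P : Bicollection} {m n : ℕ} (x : P.obj m n) :
    (vrightUnitor P).inv.app m n x = tmul x (vone n) := rfl

instance : MonoidalCategoryStruct Bicollection where
  tensorObj := vtensor
  whiskerLeft P _ _ f := vtensorHom (𝟙 P) f
  whiskerRight f P := vtensorHom f (𝟙 P)
  tensorHom := vtensorHom
  tensorUnit := vunit
  associator := vassoc
  leftUnitor := vleftUnitor
  rightUnitor := vrightUnitor

/-- The monoidal category of bicollections with the vertical tensor product. -/
instance : MonoidalCategory Bicollection :=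
  MonoidalCategory.ofTensorHom
    (id_tensorHom_id := fun P Q => by
      refine hom_ext fun m n => ?_
      refine vtensor_ext fun k x y => ?_
      exact vtensorHom_tmul _ _ x y)
    (id_tensorHom := fun _ _ _ _ => rfl)
    (tensorHom_id := fun _ _ => rfl)
    (tensorHom_comp_tensorHom := fun f₁ f₂ g₁ g₂ => by
      refine hom_ext fun m n => ?_
      refine vtensor_ext fun k x y => ?_
      change (vtensorHom g₁ g₂).app m n ((vtensorHom f₁ f₂).app m n (tmul x y)) =
        (vtensorHom (f₁ ≫ g₁) (f₂ ≫ g₂)).app m n (tmul x y)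
      simp)
    (associator_naturality := fun {P Q R P' Q' R'} f₁ f₂ f₃ => by
      refine hom_ext fun m n => ?_
      refine vtensor_ext₃ fun k l x y z => ?_
      change (vassoc P' Q' R').hom.app m n
          ((vtensorHom (vtensorHom f₁ f₂) f₃).app m n (tmul (tmul x y) z)) =
        (vtensorHom f₁ (vtensorHom f₂ f₃)).app m n
          ((vassoc P Q R).hom.app m n (tmul (tmul x y) z))
      simp)
    (leftUnitor_naturality := fun {P Q} f => by
      rw [← Iso.inv_comp_eq]
      refine hom_ext fun m n => ?_
      refine LinearMap.ext fun x => ?_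
      change (vleftUnitor Q).hom.app m n ((vtensorHom (𝟙 vunit) f).app m n
        ((vleftUnitor P).inv.app m n x)) = f.app m n x
      simp)
    (rightUnitor_naturality := fun {P Q} f => by
      rw [← Iso.inv_comp_eq]
      refine hom_ext fun m n => ?_
      refine LinearMap.ext fun x => ?_
      change (vrightUnitor Q).hom.app m n ((vtensorHom f (𝟙 vunit)).app m n
        ((vrightUnitor P).inv.app m n x)) = f.app m n x
      simp)
    (pentagon := fun P Q R S => by
      refine hom_ext fun m n => ?_
      refine vtensor_ext₄ fun k l j x y z w => ?_
      change (vtensorHom (𝟙 P) (vassoc Q R S).hom).app m n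
        ((vassoc P (vtensor Q R) S).hom.app m n
          ((vtensorHom (vassoc P Q R).hom (𝟙 S)).app m n (tmul (tmul (tmul x y) z) w))) =
        (vassoc P Q (vtensor R S)).hom.app m n
          ((vassoc (vtensor P Q) R S).hom.app m n (tmul (tmul (tmul x y) z) w))
      simp)
    (triangle := fun P Q => by
      refine hom_ext fun m n => ?_
      refine vtensor_ext fun l u y => ?_
      refine LinearMap.congr_fun
        (f := ((vtensorHom (𝟙 P) (vleftUnitor Q).hom).app m n ∘ₗ (vassoc P vunit Q).hom.app m n) ∘ₗ
          (tmulₗ (vtensor P vunit) Q m l n).flip y)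
        (g := (vtensorHom (vrightUnitor P).hom (𝟙 Q)).app m n ∘ₗ
          (tmulₗ (vtensor P vunit) Q m l n).flip y) (vtensor_vunit_ext fun x => ?_) u
      change (vtensorHom (𝟙 P) (vleftUnitor Q).hom).app m n
        ((vassoc P vunit Q).hom.app m n (tmul (tmul x (vone l)) y)) =
        (vtensorHom (vrightUnitor P).hom (𝟙 Q)).app m n (tmul (tmul x (vone l)) y)
      simp)

end Bicollection

end

noncomputable section

/-! ### Hopf monoids and conilpotency -/

section HopfMonoid

open scoped MonObj ComonObj

variable {C : Type*} [Category C] [MonoidalCategory C]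

/-- A local symmetry of an object `A` that carries a monoid and a comonoid structure, in a monoidal
category that need not be braided: an involutive solution `K : A ⊗ A ⟶ A ⊗ A` of the braid equation
with respect to which the product, the unit, the coproduct and the counit are natural. -/
structure IsLocalSymmetry (A : C) [MonObj A] [ComonObj A] (K : A ⊗ A ⟶ A ⊗ A) : Prop where
  symmetry : K ≫ K = 𝟙 (A ⊗ A)
  braid : K ▷ A ≫ (α_ A A A).hom ≫ A ◁ K ≫ (α_ A A A).inv ≫ K ▷ A ≫ (α_ A A A).hom =
    (α_ A A A).hom ≫ A ◁ K ≫ (α_ A A A).inv ≫ K ▷ A ≫ (α_ A A A).hom ≫ A ◁ K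
  mul_left : μ[A] ▷ A ≫ K =
    (α_ A A A).hom ≫ A ◁ K ≫ (α_ A A A).inv ≫ K ▷ A ≫ (α_ A A A).hom ≫ A ◁ μ[A]
  mul_right : A ◁ μ[A] ≫ K =
    (α_ A A A).inv ≫ K ▷ A ≫ (α_ A A A).hom ≫ A ◁ K ≫ (α_ A A A).inv ≫ μ[A] ▷ A
  one_left : η[A] ▷ A ≫ K = (λ_ A).hom ≫ (ρ_ A).inv ≫ A ◁ η[A]
  one_right : A ◁ η[A] ≫ K = (ρ_ A).hom ≫ (λ_ A).inv ≫ η[A] ▷ A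
  comul_left : K ≫ A ◁ Δ[A] =
    Δ[A] ▷ A ≫ (α_ A A A).hom ≫ A ◁ K ≫ (α_ A A A).inv ≫ K ▷ A ≫ (α_ A A A).hom
  comul_right : K ≫ Δ[A] ▷ A =
    A ◁ Δ[A] ≫ (α_ A A A).inv ≫ K ▷ A ≫ (α_ A A A).hom ≫ A ◁ K ≫ (α_ A A A).inv
  counit_left : K ≫ A ◁ ε[A] = ε[A] ▷ A ≫ (λ_ A).hom ≫ (ρ_ A).inv
  counit_right : K ≫ ε[A] ▷ A = A ◁ ε[A] ≫ (ρ_ A).hom ≫ (λ_ A).inv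

/-- The product `(μ ⊗ μ) ∘ (id ⊗ K ⊗ id)` on `A ⊗ A`. -/
def tensorMul (A : C) [MonObj A] (K : A ⊗ A ⟶ A ⊗ A) : (A ⊗ A) ⊗ (A ⊗ A) ⟶ A ⊗ A :=
  (α_ A A (A ⊗ A)).hom ≫ A ◁ (α_ A A A).inv ≫ A ◁ K ▷ A ≫ A ◁ (α_ A A A).hom ≫
    (α_ A A (A ⊗ A)).inv ≫ (μ[A] ⊗ₘ μ[A])

/-- The unit `η ⊗ η` on `A ⊗ A`. -/
def tensorOne (A : C) [MonObj A] : 𝟙_ C ⟶ A ⊗ A := (λ_ (𝟙_ C)).inv ≫ (η[A] ⊗ₘ η[A])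

/-- `A` is a Hopf monoid with respect to the local symmetry `K`, with antipode `S`: `A ⊗ A` is a
monoid for the product twisted by `K`, the coproduct and the counit are morphisms of monoids, and
`S` is inverse to the identity for the convolution product. -/
structure IsHopfMonoid (A : C) [MonObj A] [ComonObj A] (K : A ⊗ A ⟶ A ⊗ A) (S : A ⟶ A) :
    Prop where
  localSymmetry : IsLocalSymmetry A K
  tensorMon : ∃ M : MonObj (A ⊗ A), M.mul = tensorMul A K ∧ M.one = tensorOne A
  mul_comul : μ[A] ≫ Δ[A] = (Δ[A] ⊗ₘ Δ[A]) ≫ tensorMul A K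
  one_comul : η[A] ≫ Δ[A] = tensorOne A
  mul_counit : μ[A] ≫ ε[A] = (ε[A] ⊗ₘ ε[A]) ≫ (λ_ (𝟙_ C)).hom
  one_counit : η[A] ≫ ε[A] = 𝟙 (𝟙_ C)
  antipode_left : Δ[A] ≫ S ▷ A ≫ μ[A] = ε[A] ≫ η[A]
  antipode_right : Δ[A] ≫ A ◁ S ≫ μ[A] = ε[A] ≫ η[A]

end HopfMonoid

section Conilpotent

open scoped MonObj ComonObj

variable (A : Bicollection) [MonObj A] [ComonObj A]

/-- The reduced coproduct `x ↦ Δ x - 1 ⦶ x - x ⦶ 1`. -/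
def reducedComul : A ⟶ A ⊗ A :=
  ⟨fun m n => Δ[A].app m n - ((λ_ A).inv ≫ η[A] ▷ A).app m n - ((ρ_ A).inv ≫ A ◁ η[A]).app m n⟩

/-- The vertical tensor power with `j + 1` factors. -/
def tensorPow : ℕ → Bicollection
  | 0 => A
  | j + 1 => A ⊗ tensorPow j

/-- The iterated reduced coproduct with `j + 1` output factors. -/
def iteratedReducedComul : ∀ j : ℕ, A ⟶ tensorPow A j
  | 0 => 𝟙 A
  | j + 1 => reducedComul A ≫ A ◁ iteratedReducedComul j

/-- Conilpotency: each element of the kernel of the counit is annihilated by all but finitely many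
of the iterated reduced coproducts. -/
def IsConilpotent : Prop :=
  ∀ (m n : ℕ) (x : A.obj m n), ε[A].app m n x = 0 →
    ∃ k : ℕ, ∀ j ≥ k, (iteratedReducedComul A j).app m n x = 0

end Conilpotent

/-! ### The bicollection of levelled forests and its structure maps -/

open Bicollection

/-- The bicollection `𝓛𝓕`: `𝓛𝓕(m, n)` is spanned by the levelled forests with `m` trees and `n` leaves.
In particular `𝓛𝓕(0, 0) = ℂ` is spanned by the empty forest, and `𝓛𝓕(0, n) = 𝓛𝓕(n, 0) = 0` for
`n ≥ 1`. -/
def LF : Bicollection where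
  obj m n := LevelledForest m n →₀ ℂ

/-- A levelled forest as an element of `𝓛𝓕`. -/
def ofForest {m n : ℕ} (f : LevelledForest m n) : LF.obj m n := Finsupp.single f 1

/-- The linear map out of `𝓛𝓕(m, n)` with given values on forests. -/
def linearExtend {m n : ℕ} {M : Type} [AddCommGroup M] [Module ℂ M] (v : LevelledForest m n → M) :
    LF.obj m n →ₗ[ℂ] M :=
  Finsupp.linearCombination ℂ v

@[simp]
theorem linearExtend_ofForest {m n : ℕ} {M : Type} [AddCommGroup M] [Module ℂ M]
    (v : LevelledForest m n → M) (f : LevelledForest m n) :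
    linearExtend v (ofForest f) = v f :=
  (Finsupp.linearCombination_single ℂ _ _).trans (one_smul ℂ _)

/-- The `(p, q)`-shuffles: permutations increasing on the first `p` and on the last `q` letters. -/
def shuffles (p q : ℕ) : Finset (Equiv.Perm (Fin (p + q))) :=
  open Classical in
  Finset.univ.filter fun s =>
    StrictMono (fun i : Fin p => s (Fin.castAdd q i)) ∧
      StrictMono (fun j : Fin q => s (Fin.natAdd p j))

/-- The shuffle that exchanges the block of the first `p` and the block of the last `q` letters. -/
def blockFlip (p q : ℕ) : Equiv.Perm (Fin (p + q)) :=
  finAddFlip.trans (finCongr (Nat.add_comm q p))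

/-- The product `∇(f ⦶ g) = ∑ s ∈ Sh(‖f‖, ‖g‖), s · (f # g)`. -/
def nabla : LF ⊗ LF ⟶ LF :=
  ⟨fun _ _ => vlift fun _ => linearExtend fun f => linearExtend fun g =>
    ∑ s ∈ shuffles f.norm g.norm, ofForest ((f.glue g).act s (f.norm_glue g))⟩

/-- The unit `η(1ₙ) = • ⋯ •`. -/
def unitMap : 𝟙_ Bicollection ⟶ LF :=
  ⟨fun _ _ => vunitLift fun h => ofForest (LevelledForest.trivial h)⟩

/-- The coproduct: the sum over all horizontal cuts of `f` of the lower component `⦶` the upper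
component. -/
def delta : LF ⟶ LF ⊗ LF :=
  ⟨fun _ _ => linearExtend fun f =>
    ∑ p ∈ Finset.range (f.norm + 1), tmul (ofForest (f.lower p)) (ofForest (f.upper p))⟩

/-- The counit: `1ₙ` on the forest `• ⋯ •` with `n` trees, and `0` on all other forests. -/
def counitMap : LF ⟶ 𝟙_ Bicollection :=
  ⟨fun m n => linearExtend fun f =>
    if h : m = n ∧ f.trees = List.replicate m .nil then (h.1 ▸ vone m : vunit.obj m n) else 0⟩

/-- The braiding map: `f ⦶ g` is sent to the two components of the horizontal cut at level `‖g‖`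
of the forest obtained from `f # g` by moving the generations of `g` below those of `f`. -/
def braiding : LF ⊗ LF ⟶ LF ⊗ LF :=
  ⟨fun _ _ => vlift fun _ => linearExtend fun f => linearExtend fun g =>
    let h := (f.glue g).act (blockFlip f.norm g.norm) (f.norm_glue g)
    tmul (ofForest (h.lower g.norm)) (ofForest (h.upper g.norm))⟩

/-- The vertical mirror image `f^⋆`, obtained by reversing the order of the generations. -/
def LevelledForest.star {m n : ℕ} (f : LevelledForest m n) : LevelledForest m n :=
  f.act (Fin.revPerm : Equiv.Perm (Fin f.norm)) rfl

/-- The linear map with `S(f) = (-1)^‖f‖ f^⋆` for each levelled forest `f`. -/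
def antipode : LF ⟶ LF :=
  ⟨fun _ _ => linearExtend fun f => (-1 : ℂ) ^ f.norm • ofForest f.star⟩

end

end LevelledForests

open CategoryTheory MonoidalCategory LevelledForests

namespace LevelledForests

/-! ### Permutations of `ℕ` supported on an initial segment -/

/-! An increasing tree is determined by its left-to-right word, so a levelled forest is determined
by the list of words of its trees (`ext_words`). On words, a permutation acts letter by letter, the
lower part of a cut keeps the letters `< p`, and the upper part splits each word at those letters
(`words_lower`, `words_upper`). Gluing and cutting are mutually inverse (`words_lower_glue`,
`words_upper_glue`, `glue_lower_upper`). Hence a tensor `f ⊠ g` of two forests is the same datum as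
the single forest `h = f # g` with the level `‖f‖`, a tensor of three forests is one forest with two
levels, and so on; such cuts span the tensor powers (`cut_ext`, `cutLeft_ext`, `cutRight_ext`), and
the associators only change the bracketing.

On cuts, every structure map is expressed by permutations acting on `h`: the product forgets the
level and sums over shuffles, the braiding acts by the exchange of two blocks of generations, the
coproduct sums over all levels, and the antipode acts by order reversal with a sign. A permutation
of the lowest `p` generations touches only the lower factor of the cut at level `p`; a permutation
shifted by `p` touches only the upper factor. Each axiom thus reduces to an identity between
permutations, or sums of permutations, applied to one forest: associativity says that iterated
shuffles are the permutations increasing on three consecutive blocks (`sum_natShuffles_assoc`);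
coassociativity says that both sides list the pairs of levels; the axioms of the local symmetry are
the hexagon, naturality and braid relations for block exchanges (`swapBlocks_add_left`,
`swapBlocks_mul`, `swapBlocks_braid` and their mirror forms); compatibility of product and coproduct
says that cutting a `(p, q)`-shuffle at a level yields an `(i, j)`-shuffle below, a `(p - i, q -
j)`-shuffle above, and an exchange of the two middle blocks (`sum_natShuffles_cut`).

The antipode identities are a signed sum over permutations that first decrease and then increase.
The position of the minimum may be counted in either run, so the terms cancel in pairs
(`sum_valleys`). The monoid axioms for the twisted product on `LF ⊠ LF` follow from associativity,
naturality and the unit laws, because the braiding sends pairs of forests to pairs of forests.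
Conilpotency holds because the reduced coproduct cuts only at levels strictly between bottom and
top, so the norm of the upper part drops at each iteration, while all forests of `LF(m, n)` have
norm `n - m` (`norm_add`). -/

/-- The permutations of `ℕ` that fix all `x ≥ n`. -/
def fixAbove (n : ℕ) : Subgroup (Equiv.Perm ℕ) where
  carrier := {s | ∀ x, n ≤ x → s x = x}
  one_mem' := fun _ _ => rfl
  mul_mem' := fun {s t} hs ht x hx => by rw [Equiv.Perm.mul_apply, ht x hx, hs x hx]
  inv_mem' := fun {s} hs x hx => by rw [Equiv.Perm.inv_eq_iff_eq, hs x hx]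

theorem fixAbove_mono {n n' : ℕ} (h : n ≤ n') : fixAbove n ≤ fixAbove n' :=
  fun _ hs x hx => hs x (h.trans hx)

theorem lt_iff_of_mem_fixAbove {n : ℕ} {s : Equiv.Perm ℕ} (hs : s ∈ fixAbove n) (x : ℕ) :
    s x < n ↔ x < n := by
  constructor <;> intro h <;> by_contra hx <;> rw [not_lt] at hx
  · rw [hs x hx] at h
    omega
  · have := s.injective (hs (s x) hx)
    omega

/-- The permutation that acts as `t` on `p, p + 1, p + 2, …`. -/
def shift (p : ℕ) (t : Equiv.Perm ℕ) : Equiv.Perm ℕ where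
  toFun x := if x < p then x else p + t (x - p)
  invFun x := if x < p then x else p + t.symm (x - p)
  left_inv x := by
    dsimp only
    split_ifs <;> first | rfl | omega | (simp; omega)
  right_inv x := by
    dsimp only
    split_ifs <;> first | rfl | omega | (simp; omega)

theorem shift_apply_lt {p x : ℕ} (t : Equiv.Perm ℕ) (h : x < p) : shift p t x = x := if_pos h

theorem shift_apply_add (p x : ℕ) (t : Equiv.Perm ℕ) : shift p t (p + x) = p + t x := by
  simp [shift]

theorem shift_apply_ge {p x : ℕ} (t : Equiv.Perm ℕ) (h : p ≤ x) :
    shift p t x = p + t (x - p) := if_neg (by omega)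

theorem shift_mul (p : ℕ) (s t : Equiv.Perm ℕ) : shift p (s * t) = shift p s * shift p t := by
  ext x
  rcases lt_or_ge x p with h | h
  · simp [shift_apply_lt, h]
  · obtain ⟨y, rfl⟩ := Nat.exists_eq_add_of_le h
    simp [shift_apply_add]

theorem shift_one (p : ℕ) : shift p 1 = 1 := by
  ext x
  rcases lt_or_ge x p with h | h
  · simp [shift_apply_lt, h]
  · obtain ⟨y, rfl⟩ := Nat.exists_eq_add_of_le h
    simp [shift_apply_add]

theorem shift_mem {p q : ℕ} {t : Equiv.Perm ℕ} (h : t ∈ fixAbove q) :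
    shift p t ∈ fixAbove (p + q) := fun x hx => by
  rw [shift_apply_ge _ (by omega), h _ (by omega)]
  omega

theorem shift_lt_iff (p : ℕ) (t : Equiv.Perm ℕ) (x : ℕ) : shift p t x < p ↔ x < p := by
  rcases lt_or_ge x p with h | h
  · rw [shift_apply_lt _ h]
  · rw [shift_apply_ge _ h]
    omega

theorem extendPerm_mem {N : ℕ} (s : Equiv.Perm (Fin N)) : extendPerm s ∈ fixAbove N :=
  fun x hx => Equiv.Perm.extendDomain_apply_not_subtype _ _ (by omega)

/-- Permutations of `ℕ` can be multiplied without casts between `Fin (p + q + r)` and `Fin (p + (q +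
r))`. This is the way back to the permutations of `Fin N` used in the definitions. -/
theorem exists_extendPerm {N : ℕ} {s : Equiv.Perm ℕ} (hs : s ∈ fixAbove N) :
    ∃ t : Equiv.Perm (Fin N), extendPerm t = s := by
  refine ⟨⟨fun i => ⟨s i, (lt_iff_of_mem_fixAbove hs _).2 i.2⟩,
    fun i => ⟨s⁻¹ i, (lt_iff_of_mem_fixAbove (inv_mem hs) _).2 i.2⟩, fun i => by simp,
    fun i => by simp⟩, ?_⟩
  ext x
  rcases lt_or_ge x N with h | h
  · rw [extendPerm_lt _ h]
    rfl
  · rw [extendPerm_mem _ x h, hs x h]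

theorem extendPerm_injective {N : ℕ} :
    Function.Injective (extendPerm : Equiv.Perm (Fin N) → Equiv.Perm ℕ) := by
  intro s t h
  ext i
  rw [← extendPerm_lt s i.2, ← extendPerm_lt t i.2, h]

/-! ### Splitting words -/

section Split

variable {α β : Type*}

theorem splitOnP_map (f : α → β) (p : β → Bool) (l : List α) :
    (l.map f).splitOnP p = (l.splitOnP fun x => p (f x)).map (List.map f) := by
  induction l with
  | nil => simp
  | cons x l ih =>
    rw [List.map_cons, List.splitOnP_cons_eq_if_modifyHead, List.splitOnP_cons_eq_if_modifyHead, ih]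
    obtain ⟨a, as, h⟩ := List.exists_cons_of_ne_nil (List.splitOnP_ne_nil (fun x => p (f x)) l)
    rw [h]
    split_ifs <;> simp

theorem of_mem_splitOnP {p : α → Bool} {l u : List α} (hu : u ∈ l.splitOnP p) {x : α}
    (hx : x ∈ u) : p x = false := by
  induction l generalizing u with
  | nil =>
    simp only [List.splitOnP_nil, List.mem_singleton] at hu
    simp [hu] at hx
  | cons y l ih =>
    rw [List.splitOnP_cons_eq_if_modifyHead] at hu
    obtain ⟨a, as, h⟩ := List.exists_cons_of_ne_nil (List.splitOnP_ne_nil p l)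
    rw [h] at hu ih
    split_ifs at hu with hy
    · rcases List.mem_cons.1 hu with rfl | hu
      · simp at hx
      · exact ih hu hx
    · simp only [List.modifyHead_cons, List.mem_cons] at hu
      rcases hu with rfl | hu
      · rcases List.mem_cons.1 hx with rfl | hx
        · simpa using hy
        · exact ih (List.mem_cons_self ..) hx
      · exact ih (List.mem_cons_of_mem _ hu) hx

/-- A filter that keeps every separator cannot merge two pieces. -/
theorem splitOnP_filter {p r : α → Bool} (h : ∀ x, p x = true → r x = true) (l : List α) :
    (l.filter r).splitOnP p = (l.splitOnP p).map (List.filter r) := by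
  induction l with
  | nil => simp
  | cons x l ih =>
    rw [List.splitOnP_cons_eq_if_modifyHead]
    obtain ⟨a, as, ha⟩ := List.exists_cons_of_ne_nil (List.splitOnP_ne_nil p l)
    rw [ha] at ih ⊢
    by_cases hp : p x = true
    · rw [List.filter_cons_of_pos (h x hp), List.splitOnP_cons_eq_if_modifyHead, ih]
      simp [hp]
    · by_cases hr : r x = true
      · rw [List.filter_cons_of_pos hr, List.splitOnP_cons_eq_if_modifyHead, ih]
        simp [hp, hr]
      · rw [List.filter_cons_of_neg hr, ih]
        simp [hp, hr]

/-- The separators of the first split are also separators of the second, so the preliminary split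
loses nothing. Used for the successive cut levels `p` and `p + q`. -/
theorem flatMap_splitOnP {p q : α → Bool} (h : ∀ x, p x = true → q x = true) (l : List α) :
    (l.splitOnP p).flatMap (List.splitOnP q) = l.splitOnP q := by
  induction l with
  | nil => simp
  | cons x l ih =>
    rw [List.splitOnP_cons_eq_if_modifyHead, List.splitOnP_cons_eq_if_modifyHead]
    obtain ⟨a, as, ha⟩ := List.exists_cons_of_ne_nil (List.splitOnP_ne_nil p l)
    obtain ⟨b, bs, hb⟩ := List.exists_cons_of_ne_nil (List.splitOnP_ne_nil q a)
    rw [← ih, ha]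
    by_cases hp : p x = true
    · simp [hp, h x hp]
    · by_cases hq : q x = true <;>
        simp [hp, hq, List.splitOnP_cons_eq_if_modifyHead, hb]

end Split

/-- Cuts a word at its letters `< p`, and translates the remaining letters by `-p`. -/
def splitBelow (p : ℕ) (l : List ℕ) : List (List ℕ) :=
  (l.splitOnP fun x => decide (x < p)).map (List.map (· - p))

/-- `shift p t` fixes the letters `< p`, which are the separators, and acts as `t` on the remaining
letters once these are translated. In terms of forests, it acts on the upper part of a cut only. -/
theorem splitBelow_map_shift (p : ℕ) (t : Equiv.Perm ℕ) (l : List ℕ) :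
    splitBelow p (l.map (shift p t)) = (splitBelow p l).map (List.map t) := by
  simp only [splitBelow, splitOnP_map, shift_lt_iff, List.map_map]
  refine List.map_congr_left fun u hu => ?_
  simp only [Function.comp_apply, List.map_map]
  refine List.map_congr_left fun x hx => ?_
  have := of_mem_splitOnP hu hx
  simp only [decide_eq_false_iff_not, not_lt] at this
  simp [shift_apply_ge _ this]

/-- Here `s` only permutes the separators among themselves, and the splitting discards them. -/
theorem splitBelow_map_of_mem {p : ℕ} {s : Equiv.Perm ℕ} (hs : s ∈ fixAbove p) (l : List ℕ) :
    splitBelow p (l.map s) = splitBelow p l := by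
  simp only [splitBelow, splitOnP_map, lt_iff_of_mem_fixAbove hs, List.map_map]
  refine List.map_congr_left fun u hu => ?_
  simp only [Function.comp_apply, List.map_map]
  refine List.map_congr_left fun x hx => ?_
  have := of_mem_splitOnP hu hx
  simp only [decide_eq_false_iff_not, not_lt] at this
  simp [hs x this]

theorem flatMap_splitBelow (p q : ℕ) (l : List ℕ) :
    (splitBelow p l).flatMap (splitBelow q) = splitBelow (p + q) l := by
  unfold splitBelow
  rw [← flatMap_splitOnP (p := fun x => decide (x < p)) (q := fun x => decide (x < p + q))
    (by simp; omega), List.flatMap_map, List.map_flatMap]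
  refine List.flatMap_congr fun u hu => ?_
  rw [splitOnP_map, List.map_map]
  -- The letters of `u` survived the first split, so they are `≥ p`. This matters for the truncated
  -- subtraction: when `q = 0` the two predicates differ below `p`.
  have : u.splitOnP (fun x => decide (x - p < q)) = u.splitOnP (fun x => decide (x < p + q)) := by
    have h : ∀ x ∈ u, decide (x - p < q) = decide (x < p + q) := fun x hx => by
      have := of_mem_splitOnP hu hx
      simp only [decide_eq_false_iff_not, not_lt] at this
      rw [decide_eq_decide]
      omega
    clear hu
    induction u with
    | nil => simp
    | cons x u ih =>
      rw [List.splitOnP_cons_eq_if_modifyHead, List.splitOnP_cons_eq_if_modifyHead,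
        ih fun y hy => h y (List.mem_cons_of_mem _ hy), h x (List.mem_cons_self ..)]
  rw [this]
  refine List.map_congr_left fun v _ => ?_
  simp [Nat.sub_sub]

theorem splitBelow_filter (p q : ℕ) (l : List ℕ) :
    splitBelow p (l.filter fun x => decide (x < p + q)) =
      (splitBelow p l).map (List.filter fun x => decide (x < q)) := by
  unfold splitBelow
  rw [splitOnP_filter (by simp; omega), List.map_map, List.map_map]
  refine List.map_congr_left fun u hu => ?_
  simp only [Function.comp_apply, List.filter_map]
  congr 1
  refine List.filter_congr fun x hx => ?_
  have := of_mem_splitOnP hu hx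
  simp only [decide_eq_false_iff_not, not_lt] at this
  simp only [Function.comp_apply, decide_eq_decide]
  omega

theorem splitBelow_zero (l : List ℕ) : splitBelow 0 l = [l] := by
  simp [splitBelow, List.splitOnP_eq_singleton]

/-! ### Forests as lists of words -/

/-- The least letter becomes the root. Letters of `v` come to lie to its right, and each letter of
`u`, being larger, is pushed past it into the left subtree. -/
theorem ofWord_append {x : ℕ} {u v : List ℕ} (hu : ∀ y ∈ u, x < y) (hv : ∀ y ∈ v, x < y) :
    ofWord (u ++ x :: v) = .node x (ofWord u) (ofWord v) := by
  induction u with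
  | nil =>
    change push x (ofWord v) = .node x .nil (ofWord v)
    cases h : ofWord v with
    | nil => rfl
    | node y a b =>
      have : y ∈ v := by
        rw [← inorder_ofWord v, h]
        simp [inorder]
      exact if_pos (hv y this)
  | cons y u ih =>
    change push y (ofWord (u ++ x :: v)) = .node x (push y (ofWord u)) (ofWord v)
    rw [ih fun z hz => hu z (List.mem_cons_of_mem _ hz)]
    have := hu y (List.mem_cons_self ..)
    exact if_neg (by omega)

theorem ofWord_inorder {t : BinaryTree ℕ} (h : Increasing t) : ofWord (inorder t) = t := by
  induction t with
  | nil => rfl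
  | node x a b iha ihb =>
    obtain ⟨h1, h2, h3, h4⟩ := h
    rw [inorder, ofWord_append h1 h2, iha h3, ihb h4]

/-- The vertices of level `< p` form a subtree containing the root, unless there are none. In the
word they separate the subtrees hanging above them; an empty piece corresponds to a bare leaf. -/
theorem inorder_upperTrees (p : ℕ) {t : BinaryTree ℕ} (h : Increasing t) :
    (upperTrees p t).map inorder = splitBelow p (inorder t) := by
  induction t with
  | nil => simp [upperTrees, splitBelow, inorder]
  | node x a b iha ihb =>
    obtain ⟨h1, h2, h3, h4⟩ := h
    unfold upperTrees
    split_ifs with hx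
    · rw [List.map_append, iha h3, ihb h4, inorder, splitBelow, splitBelow, splitBelow,
        List.splitOnP_append_cons _ _ (by simpa using hx), List.map_append]
    -- The root carries the least label, so no letter is a separator and the word stays in one
    -- piece.
    · rw [splitBelow, List.splitOnP_eq_singleton, List.map_singleton, List.map_singleton, inorder_map]
      simp only [inorder, List.mem_append, List.mem_cons, not_lt, decide_eq_false_iff_not] at hx ⊢
      rintro y (hy | rfl | hy)
      · exact hx.trans (h1 y hy).le
      · exact hx
      · exact hx.trans (h2 y hy).le

/-- All labels of `t` lie below the cut and all labels of `us` above it, so the cut runs exactly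
through the leaves of `t`. -/
theorem lowerTree_graft {p : ℕ} (t : BinaryTree ℕ) (us : List (BinaryTree ℕ))
    (h : us.length = t.numLeaves) (hlt : ∀ x ∈ inorder t, x < p) (hge : ∀ x ∈ word us, p ≤ x) :
    lowerTree p (graft t us) = t := by
  induction t generalizing us with
  | nil =>
    obtain ⟨u, rfl⟩ := List.length_eq_one_iff.1 h
    cases u with
    | nil => rfl
    | node x a b => exact if_neg (not_lt.2 (hge x (by simp [word, inorder])))
  | node x a b iha ihb =>
    simp only [BinaryTree.numLeaves] at h
    simp only [inorder, List.mem_append, List.mem_cons] at hlt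
    rw [← List.take_append_drop a.numLeaves us, word, List.flatMap_append] at hge
    simp only [List.mem_append] at hge
    rw [graft, lowerTree, if_pos (hlt x (.inr (.inl rfl))),
      iha _ (by rw [List.length_take]; omega) (fun y hy => hlt y (.inl hy))
        (fun y hy => hge y (.inl hy)),
      ihb _ (by rw [List.length_drop]; omega) (fun y hy => hlt y (.inr (.inr hy)))
        (fun y hy => hge y (.inr hy))]

theorem upperTrees_graft {p : ℕ} (t : BinaryTree ℕ) (us : List (BinaryTree ℕ))
    (h : us.length = t.numLeaves) (hlt : ∀ x ∈ inorder t, x < p) (hge : ∀ x ∈ word us, p ≤ x) :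
    upperTrees p (graft t us) = us.map (BinaryTree.map (· - p)) := by
  induction t generalizing us with
  | nil =>
    obtain ⟨u, rfl⟩ := List.length_eq_one_iff.1 h
    cases u with
    | nil => rfl
    | node x a b => exact if_neg (not_lt.2 (hge x (by simp [word, inorder])))
  | node x a b iha ihb =>
    simp only [BinaryTree.numLeaves] at h
    simp only [inorder, List.mem_append, List.mem_cons] at hlt
    rw [← List.take_append_drop a.numLeaves us, word, List.flatMap_append] at hge
    simp only [List.mem_append] at hge
    rw [graft, upperTrees, if_pos (hlt x (.inr (.inl rfl))),
      iha _ (by rw [List.length_take]; omega) (fun y hy => hlt y (.inl hy))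
        (fun y hy => hge y (.inl hy)),
      ihb _ (by rw [List.length_drop]; omega) (fun y hy => hlt y (.inr (.inr hy)))
        (fun y hy => hge y (.inr hy)), ← List.map_append, List.take_append_drop]

theorem lowerTree_graftForest {p : ℕ} (ts us : List (BinaryTree ℕ))
    (h : us.length = (ts.map BinaryTree.numLeaves).sum) (hlt : ∀ x ∈ word ts, x < p)
    (hge : ∀ x ∈ word us, p ≤ x) : (graftForest ts us).map (lowerTree p) = ts := by
  induction ts generalizing us with
  | nil => rfl
  | cons t ts ih =>
    simp only [List.map_cons, List.sum_cons] at h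
    rw [← List.take_append_drop t.numLeaves us, word, List.flatMap_append] at hge
    simp only [word, List.flatMap_cons, List.mem_append] at hlt hge
    rw [graftForest, List.map_cons,
      lowerTree_graft _ _ (by rw [List.length_take]; omega) (fun y hy => hlt y (.inl hy))
        (fun y hy => hge y (.inl hy)),
      ih _ (by rw [List.length_drop]; omega) (fun y hy => hlt y (.inr hy))
        (fun y hy => hge y (.inr hy))]

theorem upperTrees_graftForest {p : ℕ} (ts us : List (BinaryTree ℕ))
    (h : us.length = (ts.map BinaryTree.numLeaves).sum) (hlt : ∀ x ∈ word ts, x < p)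
    (hge : ∀ x ∈ word us, p ≤ x) :
    (graftForest ts us).flatMap (upperTrees p) = us.map (BinaryTree.map (· - p)) := by
  induction ts generalizing us with
  | nil =>
    simp only [List.map_nil, List.sum_nil, List.length_eq_zero_iff] at h
    simp [h, graftForest]
  | cons t ts ih =>
    simp only [List.map_cons, List.sum_cons] at h
    rw [← List.take_append_drop t.numLeaves us, word, List.flatMap_append] at hge
    simp only [word, List.flatMap_cons, List.mem_append] at hlt hge
    rw [graftForest, List.flatMap_cons,
      upperTrees_graft _ _ (by rw [List.length_take]; omega) (fun y hy => hlt y (.inl hy))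
        (fun y hy => hge y (.inl hy)),
      ih _ (by rw [List.length_drop]; omega) (fun y hy => hlt y (.inr hy))
        (fun y hy => hge y (.inr hy)), ← List.map_append, List.take_append_drop]

theorem map_map_of_forall {f g : ℕ → ℕ} {t : BinaryTree ℕ} (h : ∀ x ∈ inorder t, g (f x) = x) :
    (t.map f).map g = t := by
  induction t with
  | nil => rfl
  | node x a b iha ihb =>
    simp only [inorder, List.mem_append, List.mem_cons] at h
    simp only [BinaryTree.map]
    rw [h x (.inr (.inl rfl)), iha fun y hy => h y (.inl hy), ihb fun y hy => h y (.inr (.inr hy))]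

/-- Each leaf of the lower part carries one tree of the upper part. Translating labels down and up
again is harmless because the labels in the upper part are at least `p`. -/
theorem graft_lowerTree_upperTrees (p : ℕ) {t : BinaryTree ℕ} (h : Increasing t) :
    graft (lowerTree p t) ((upperTrees p t).map (BinaryTree.map (· + p))) = t := by
  induction t with
  | nil => rfl
  | node x a b iha ihb =>
    have h' := h
    obtain ⟨h1, h2, h3, h4⟩ := h
    unfold lowerTree upperTrees
    split_ifs with hx
    · have e : (lowerTree p a).numLeaves =
          ((upperTrees p a).map (BinaryTree.map (· + p))).length := by
        rw [List.length_map, length_upperTrees]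
      rw [graft, List.map_append, e, List.take_left, List.drop_left, iha h3, ihb h4]
    · refine map_map_of_forall fun y hy => Nat.sub_add_cancel ?_
      simp only [inorder, List.mem_append, List.mem_cons, not_lt] at hy hx
      rcases hy with hy | rfl | hy
      · exact hx.trans (h1 y hy).le
      · exact hx
      · exact hx.trans (h2 y hy).le

theorem graftForest_lowerTree_upperTrees (p : ℕ) {ts : List (BinaryTree ℕ)}
    (h : ∀ t ∈ ts, Increasing t) :
    graftForest (ts.map (lowerTree p))
      ((ts.flatMap (upperTrees p)).map (BinaryTree.map (· + p))) = ts := by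
  induction ts with
  | nil => rfl
  | cons t ts ih =>
    have e : (lowerTree p t).numLeaves =
        ((upperTrees p t).map (BinaryTree.map (· + p))).length := by
      rw [List.length_map, length_upperTrees]
    rw [List.map_cons, List.flatMap_cons, List.map_append, graftForest, e, List.take_left,
      List.drop_left, graft_lowerTree_upperTrees p (h t (List.mem_cons_self ..)),
      ih fun u hu => h u (List.mem_cons_of_mem _ hu)]

/-! ### Forests through their words: norm, cuts and gluing -/

namespace LevelledForest

variable {m k n : ℕ}

/-- The words of the trees of a forest. -/
def words (f : LevelledForest m n) : List (List ℕ) := f.trees.map inorder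

/-- `ofWord` rebuilds an increasing tree from its word. Equalities of forests are checked through
this lemma, on lists of words. -/
theorem ext_words {f g : LevelledForest m n} (h : f.words = g.words) : f = g := by
  have key : ∀ f : LevelledForest m n, f.trees = f.words.map ofWord := fun f => by
    rw [words, List.map_map]
    conv_lhs => rw [← List.map_id f.trees]
    exact List.map_congr_left fun t ht => (ofWord_inorder (f.increasing t ht)).symm
  exact LevelledForest.ext (by rw [key f, key g, h])

/-- A binary tree has one more leaf than internal vertices. Consequently all forests with the same
`m` and `n` have the same norm, which settles most conditions on norms below and supplies the
conilpotency bound. -/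
theorem norm_add (f : LevelledForest m n) : m + f.norm = n := by
  suffices key : ∀ ts : List (BinaryTree ℕ),
      ts.length + (word ts).length = (ts.map BinaryTree.numLeaves).sum by
    have := key f.trees
    rwa [f.numTrees, f.numLeaves] at this
  intro ts
  induction ts with
  | nil => rfl
  | cons t ts ih =>
    rw [List.map_cons, List.sum_cons, ← ih, ← length_inorder, word, word, List.flatMap_cons,
      List.length_append, List.length_cons]
    omega

theorem word_eq_flatten (f : LevelledForest m n) : word f.trees = f.words.flatten := rfl

theorem length_words (f : LevelledForest m n) : f.words.length = m := by
  rw [words, List.length_map, f.numTrees]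

theorem words_lower (f : LevelledForest m n) (p : ℕ) :
    (f.lower p).words = f.words.map (List.filter fun x => decide (x < p)) := by
  simp only [words, lower, List.map_map]
  exact List.map_congr_left fun t ht => inorder_lowerTree p (f.increasing t ht)

theorem words_upper (f : LevelledForest m n) (p : ℕ) :
    (f.upper p).words = f.words.flatMap (splitBelow p) := by
  simp only [words, upper, List.map_flatMap, List.flatMap_map]
  exact List.flatMap_congr fun t ht => inorder_upperTrees p (f.increasing t ht)

theorem words_act {N : ℕ} (s : Equiv.Perm (Fin N)) (f : LevelledForest m n) (hN : f.norm = N) :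
    (f.act s hN).words = f.words.map (List.map (extendPerm s)) := by
  simp only [words, act, List.map_map]
  exact List.map_congr_left fun t _ => inorder_ofWord _

/-- Each of the labels `0, …, p - 1` occurs exactly once, so the lower part has `p` internal
vertices. -/
theorem cutWidth_eq (f : LevelledForest m n) {p : ℕ} (hp : p ≤ f.norm) : f.cutWidth p = m + p := by
  rw [← (f.lower p).norm_add, norm]
  congr 1
  change (word (f.trees.map (lowerTree p))).length = p
  rw [word_map_lowerTree p f.increasing, (f.bijective.filter (· < p)).length_eq, filter_lt_range,
    List.length_range]
  exact min_eq_left hp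

theorem norm_lower (f : LevelledForest m n) {p : ℕ} (hp : p ≤ f.norm) : (f.lower p).norm = p := by
  have := (f.lower p).norm_add
  have := f.cutWidth_eq hp
  omega

theorem norm_upper (f : LevelledForest m n) {p : ℕ} (hp : p ≤ f.norm) :
    (f.upper p).norm = f.norm - p := by
  have := (f.upper p).norm_add
  have := f.cutWidth_eq hp
  have := f.norm_add
  omega

theorem le_of_mem_word_map (f : LevelledForest m k) (g : LevelledForest k n) :
    ∀ x ∈ word (g.trees.map (BinaryTree.map (· + f.norm))), f.norm ≤ x := by
  rw [word_map_map]
  simp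

theorem words_lower_glue (f : LevelledForest m k) (g : LevelledForest k n) :
    ((f.glue g).lower f.norm).words = f.words :=
  congrArg (List.map inorder) (lowerTree_graftForest _ _ (glue_length f g)
    (fun _ hx => f.lt_norm hx) (le_of_mem_word_map f g))

theorem words_upper_glue (f : LevelledForest m k) (g : LevelledForest k n) :
    ((f.glue g).upper f.norm).words = g.words := by
  refine congrArg (List.map inorder) ((upperTrees_graftForest _ _ (glue_length f g)
    (fun _ hx => f.lt_norm hx) (le_of_mem_word_map f g)).trans ?_)
  rw [List.map_map]
  conv_rhs => rw [← List.map_id g.trees]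
  exact List.map_congr_left fun t _ => map_map_of_forall fun x _ => Nat.add_sub_cancel x _

/-- With the two preceding lemmas, this makes a pair of composable forests equivalent to one forest
with a level. -/
theorem glue_lower_upper (f : LevelledForest m n) {p : ℕ} (hp : p ≤ f.norm) :
    (f.lower p).glue (f.upper p) = f := by
  apply LevelledForest.ext
  change graftForest (f.trees.map (lowerTree p)) ((f.trees.flatMap (upperTrees p)).map
    (BinaryTree.map (· + (f.lower p).norm))) = f.trees
  rw [f.norm_lower hp]
  exact graftForest_lowerTree_upperTrees p f.increasing

/-! ### Permutations of `ℕ` acting on forests, and their effect on cuts -/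

/-- The action on a forest `f` of the permutations of `ℕ` supported on `{0, …, ‖f‖ - 1}`; other
permutations act trivially. -/
noncomputable instance : SMul (Equiv.Perm ℕ) (LevelledForest m n) where
  smul s f :=
    open Classical in
    if h : s ∈ fixAbove f.norm then f.act (exists_extendPerm h).choose rfl else f

theorem words_smul {s : Equiv.Perm ℕ} {f : LevelledForest m n} (h : s ∈ fixAbove f.norm) :
    (s • f).words = f.words.map (List.map s) := by
  have e : s • f = f.act (exists_extendPerm h).choose rfl := dif_pos h
  rw [e, words_act, (exists_extendPerm h).choose_spec]

theorem norm_smul (s : Equiv.Perm ℕ) (f : LevelledForest m n) : (s • f).norm = f.norm := by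
  have := f.norm_add
  have := (s • f).norm_add
  omega

theorem act_eq_smul {N : ℕ} (s : Equiv.Perm (Fin N)) (f : LevelledForest m n) (hN : f.norm = N) :
    f.act s hN = extendPerm s • f := by
  apply ext_words
  rw [words_act, words_smul (by rw [hN]; exact extendPerm_mem s)]

theorem smul_smul' {s t : Equiv.Perm ℕ} {f : LevelledForest m n} (hs : s ∈ fixAbove f.norm)
    (ht : t ∈ fixAbove f.norm) : s • t • f = (s * t) • f := by
  apply ext_words
  rw [words_smul (by rwa [norm_smul]), words_smul ht, words_smul (mul_mem hs ht), List.map_map]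
  refine List.map_congr_left fun u _ => ?_
  simp

theorem one_smul' (f : LevelledForest m n) : (1 : Equiv.Perm ℕ) • f = f := by
  apply ext_words
  rw [words_smul (one_mem _)]
  simp

/-- A permutation preserving the set of letters `< p` commutes with the filter. Equality is stated
on words because the two forests have different types: their numbers of leaves are the cut widths of
different forests. -/
theorem words_lower_smul {p : ℕ} {s : Equiv.Perm ℕ} {f : LevelledForest m n} (hp : p ≤ f.norm)
    (hs : s ∈ fixAbove p) : ((s • f).lower p).words = (s • f.lower p).words := by
  rw [words_lower, words_smul (fixAbove_mono hp hs), words_smul (by rwa [f.norm_lower hp]),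
    words_lower, List.map_map, List.map_map]
  refine List.map_congr_left fun u _ => ?_
  simp only [Function.comp_apply, List.filter_map]
  congr 1
  refine List.filter_congr fun x _ => ?_
  simp [lt_iff_of_mem_fixAbove hs]

theorem words_upper_smul {p : ℕ} {s : Equiv.Perm ℕ} {f : LevelledForest m n} (hp : p ≤ f.norm)
    (hs : s ∈ fixAbove p) : ((s • f).upper p).words = (f.upper p).words := by
  rw [words_upper, words_smul (fixAbove_mono hp hs), words_upper, List.flatMap_map]
  exact List.flatMap_congr fun u _ => splitBelow_map_of_mem hs u

/-- `shift p t` fixes the letters that the lower part keeps and leaves the others above the cut. -/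
theorem words_lower_shift_smul {p q : ℕ} {t : Equiv.Perm ℕ} {f : LevelledForest m n}
    (hq : p + q ≤ f.norm) (ht : t ∈ fixAbove q) :
    ((shift p t • f).lower p).words = (f.lower p).words := by
  rw [words_lower, words_smul (fixAbove_mono hq (shift_mem ht)), words_lower, List.map_map]
  refine List.map_congr_left fun u _ => ?_
  simp only [Function.comp_apply, List.filter_map]
  have e : List.filter ((fun x => decide (x < p)) ∘ shift p t) u =
      u.filter fun x => decide (x < p) :=
    List.filter_congr fun x _ => by simp [shift_lt_iff]
  rw [e]
  conv_rhs => rw [← List.map_id (u.filter _)]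
  refine List.map_congr_left fun x hx => ?_
  exact shift_apply_lt t (by simpa using (List.mem_filter.1 hx).2)

theorem words_upper_shift_smul {p q : ℕ} {t : Equiv.Perm ℕ} {f : LevelledForest m n}
    (hq : p + q ≤ f.norm) (ht : t ∈ fixAbove q) :
    ((shift p t • f).upper p).words = (t • f.upper p).words := by
  rw [words_upper, words_smul (fixAbove_mono hq (shift_mem ht)),
    words_smul (fixAbove_mono (by rw [f.norm_upper (by omega)]; omega) ht), words_upper,
    List.flatMap_map, List.map_flatMap]
  exact List.flatMap_congr fun u _ => splitBelow_map_shift p t u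

/-! ### Cutting twice, and cutting at the extreme levels -/

theorem words_lower_lower (f : LevelledForest m n) (p q : ℕ) :
    ((f.lower (p + q)).lower p).words = (f.lower p).words := by
  rw [words_lower, words_lower, words_lower, List.map_map]
  refine List.map_congr_left fun u _ => ?_
  rw [Function.comp_apply, List.filter_filter]
  refine List.filter_congr fun x _ => ?_
  rw [Bool.eq_iff_iff]
  simp
  omega

theorem words_upper_upper (f : LevelledForest m n) (p q : ℕ) :
    ((f.upper p).upper q).words = (f.upper (p + q)).words := by
  rw [words_upper, words_upper, words_upper, List.flatMap_assoc]
  exact List.flatMap_congr fun u _ => flatMap_splitBelow p q u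

/-- The slab of generations between `p` and `p + q` does not depend on which of its two boundaries
is cut first. -/
theorem words_upper_lower (f : LevelledForest m n) (p q : ℕ) :
    ((f.lower (p + q)).upper p).words = ((f.upper p).lower q).words := by
  rw [words_upper, words_lower, words_lower, words_upper, List.flatMap_map, List.map_flatMap]
  exact List.flatMap_congr fun u _ => splitBelow_filter p q u

theorem words_lower_norm (f : LevelledForest m n) : (f.lower f.norm).words = f.words := by
  rw [words_lower]
  conv_rhs => rw [← List.map_id f.words]
  refine List.map_congr_left fun u hu => List.filter_eq_self.2 fun x hx => ?_
  exact decide_eq_true (f.lt_norm (by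
    rw [word_eq_flatten]
    exact List.mem_flatten.2 ⟨u, hu, hx⟩))

theorem words_upper_zero (f : LevelledForest m n) : (f.upper 0).words = f.words := by
  rw [words_upper]
  exact (List.flatMap_congr fun u _ => splitBelow_zero u).trans (by simp)

theorem words_of_norm_eq_zero {f : LevelledForest m n} (h : f.norm = 0) :
    f.words = List.replicate m [] := by
  rw [norm, word_eq_flatten, List.length_eq_zero_iff, List.flatten_eq_nil_iff] at h
  exact List.eq_replicate_iff.2 ⟨f.length_words, h⟩

theorem norm_trivial (h : m = n) : (trivial h).norm = 0 := by
  have := (trivial h).norm_add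
  omega

theorem eq_trivial {f : LevelledForest m n} (h : f.norm = 0) :
    f = trivial (by have := f.norm_add; omega) :=
  ext_words (by rw [words_of_norm_eq_zero h, words_of_norm_eq_zero (norm_trivial _)])

end LevelledForest

/-! ### Block permutations -/

/-- The permutation that exchanges the blocks `{0, …, p - 1}` and `{p, …, p + q - 1}`. -/
def swapBlocks (p q : ℕ) : Equiv.Perm ℕ where
  toFun x := if x < p then x + q else if x < p + q then x - p else x
  invFun x := if x < q then x + p else if x < p + q then x - q else x
  left_inv x := by dsimp only; split_ifs <;> omega
  right_inv x := by dsimp only; split_ifs <;> omega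

theorem swapBlocks_apply (p q x : ℕ) :
    swapBlocks p q x = if x < p then x + q else if x < p + q then x - p else x := rfl

theorem swapBlocks_mem (p q : ℕ) : swapBlocks p q ∈ fixAbove (p + q) := fun x hx => by
  rw [swapBlocks_apply, if_neg (by omega), if_neg (by omega)]

theorem swapBlocks_mem' (p q : ℕ) : swapBlocks p q ∈ fixAbove (q + p) :=
  add_comm p q ▸ swapBlocks_mem p q

theorem extendPerm_blockFlip (p q : ℕ) : extendPerm (blockFlip p q) = swapBlocks p q := by
  ext x
  rcases lt_or_ge x (p + q) with h | h
  · rw [extendPerm_lt _ h, swapBlocks_apply]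
    split_ifs with h1
    · have : (⟨x, h⟩ : Fin (p + q)) = Fin.castAdd q ⟨x, h1⟩ := rfl
      rw [this, blockFlip, Equiv.trans_apply, finAddFlip_apply_castAdd]
      simp [add_comm]
    · obtain ⟨y, rfl⟩ := Nat.exists_eq_add_of_le (not_lt.1 h1)
      have : (⟨p + y, h⟩ : Fin (p + q)) = Fin.natAdd p ⟨y, by omega⟩ := rfl
      rw [this, blockFlip, Equiv.trans_apply, finAddFlip_apply_natAdd]
      simp
  · rw [extendPerm_mem _ x h, swapBlocks_mem p q x h]

theorem swapBlocks_mul_swapBlocks (p q : ℕ) : swapBlocks q p * swapBlocks p q = 1 := by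
  ext x
  rw [Equiv.Perm.mul_apply, swapBlocks_apply p q, swapBlocks_apply, Equiv.Perm.one_apply]
  split_ifs <;> omega

theorem swapBlocks_zero_left (q : ℕ) : swapBlocks 0 q = 1 := by
  ext x
  rw [swapBlocks_apply, Equiv.Perm.one_apply]
  split_ifs <;> omega

theorem swapBlocks_zero_right (p : ℕ) : swapBlocks p 0 = 1 := by
  ext x
  rw [swapBlocks_apply, Equiv.Perm.one_apply]
  split_ifs <;> omega

/-- Hexagon relation: the block of length `r` is crossed first by the block of length `q`, then by
the one of length `p`. -/
theorem swapBlocks_add_left (p q r : ℕ) :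
    swapBlocks (p + q) r = swapBlocks p r * shift p (swapBlocks q r) := by
  ext x
  rw [Equiv.Perm.mul_apply]
  rcases lt_or_ge x p with h | h
  · rw [shift_apply_lt _ h, swapBlocks_apply, swapBlocks_apply]
    split_ifs <;> omega
  · rw [shift_apply_ge _ h]
    simp only [swapBlocks_apply]
    split_ifs <;> omega

/-- The other hexagon: the block of length `p` crosses first `q`, then `r`. -/
theorem swapBlocks_add_right (p q r : ℕ) :
    swapBlocks p (q + r) = shift q (swapBlocks p r) * swapBlocks p q := by
  ext x
  rw [Equiv.Perm.mul_apply]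
  -- The cases concern the image of `x`, since the shifted exchange is applied last.
  rcases lt_or_ge (swapBlocks p q x) q with h | h
  · rw [shift_apply_lt _ h]
    simp only [swapBlocks_apply] at h ⊢
    split_ifs at h ⊢ <;> omega
  · rw [shift_apply_ge _ h]
    simp only [swapBlocks_apply] at h ⊢
    split_ifs at h ⊢ <;> omega

/-- Naturality of the exchange: the block on which `s` acts starts at `q` once the exchange is done.
-/
theorem swapBlocks_mul {p : ℕ} (q : ℕ) {s : Equiv.Perm ℕ} (hs : s ∈ fixAbove p) :
    swapBlocks p q * s = shift q s * swapBlocks p q := by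
  ext x
  rw [Equiv.Perm.mul_apply, Equiv.Perm.mul_apply]
  rcases lt_or_ge x p with h | h
  · have := (lt_iff_of_mem_fixAbove hs x).2 h
    rw [swapBlocks_apply, swapBlocks_apply, if_pos this, if_pos h, add_comm x, shift_apply_add,
      add_comm]
  · rw [hs x h]
    rcases lt_or_ge x (p + q) with h1 | h1
    · rw [shift_apply_lt]
      rw [swapBlocks_apply, if_neg (by omega), if_pos h1]
      omega
    · rw [swapBlocks_mem p q x h1, shift_mem (p := q) hs x (by omega)]

/-- The previous lemma conjugated by the inverse exchange `swapBlocks q p`. -/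
theorem swapBlocks_mul_shift (p : ℕ) {q : ℕ} {s : Equiv.Perm ℕ} (hs : s ∈ fixAbove q) :
    swapBlocks p q * shift p s = s * swapBlocks p q := by
  have h := swapBlocks_mul p hs
  have e := swapBlocks_mul_swapBlocks p q
  have e' := swapBlocks_mul_swapBlocks q p
  calc swapBlocks p q * shift p s
      = swapBlocks p q * (shift p s * swapBlocks q p) * swapBlocks p q := by
        rw [mul_assoc, mul_assoc, e, mul_one]
    _ = s * swapBlocks p q := by rw [← h, ← mul_assoc (swapBlocks p q), e', one_mul]


/-- The Yang-Baxter equation for block permutations. -/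
theorem swapBlocks_braid (p q r : ℕ) :
    swapBlocks q r * (shift q (swapBlocks p r) * swapBlocks p q) =
      shift r (swapBlocks p q) * (swapBlocks p r * shift p (swapBlocks q r)) := by
  -- The hexagon merges two crossings into one crossing of the block `q + r`; naturality carries the
  -- exchange of `q` and `r` across it; the hexagon for `r + q` unfolds it again.
  rw [← swapBlocks_add_right, ← swapBlocks_mul_shift p (swapBlocks_mem q r), add_comm q r,
    swapBlocks_add_right, mul_assoc]

/-! ### Order reversal -/

/-- The permutation that reverses `{0, …, n - 1}`. -/
def rev (n : ℕ) : Equiv.Perm ℕ where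
  toFun x := if x < n then n - 1 - x else x
  invFun x := if x < n then n - 1 - x else x
  left_inv x := by dsimp only; split_ifs <;> omega
  right_inv x := by dsimp only; split_ifs <;> omega

theorem rev_apply (n x : ℕ) : rev n x = if x < n then n - 1 - x else x := rfl

theorem rev_mem (n : ℕ) : rev n ∈ fixAbove n := fun _ hx => if_neg (by omega)

theorem rev_mul_rev (n : ℕ) : rev n * rev n = 1 := by
  ext x
  rw [Equiv.Perm.mul_apply, rev_apply, rev_apply, Equiv.Perm.one_apply]
  split_ifs <;> omega

theorem extendPerm_revPerm (n : ℕ) : extendPerm (Fin.revPerm : Equiv.Perm (Fin n)) = rev n := by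
  ext x
  rcases lt_or_ge x n with h | h
  · rw [extendPerm_lt _ h, rev_apply, if_pos h]
    simp
    omega
  · rw [extendPerm_mem _ x h, rev_mem n x h]

/-! ### Shuffles -/

/-- The `(p, q)`-shuffles, as permutations of `ℕ`. -/
noncomputable def natShuffles (p q : ℕ) : Finset (Equiv.Perm ℕ) :=
  (shuffles p q).map ⟨extendPerm, extendPerm_injective⟩

theorem mem_natShuffles {p q : ℕ} {s : Equiv.Perm ℕ} :
    s ∈ natShuffles p q ↔ s ∈ fixAbove (p + q) ∧ (∀ x y, x < y → y < p → s x < s y) ∧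
      ∀ x y, x < y → y < q → s (p + x) < s (p + y) := by
  have key : ∀ t : Equiv.Perm (Fin (p + q)), t ∈ shuffles p q ↔
      (∀ x y, x < y → y < p → extendPerm t x < extendPerm t y) ∧
      ∀ x y, x < y → y < q → extendPerm t (p + x) < extendPerm t (p + y) := fun t => by
    simp only [shuffles, Finset.mem_filter, Finset.mem_univ, true_and]
    refine and_congr ⟨fun h x y hxy hy => ?_, fun h x y hxy => ?_⟩
      ⟨fun h x y hxy hy => ?_, fun h x y hxy => ?_⟩
    · rw [extendPerm_lt _ (show x < p + q by omega), extendPerm_lt _ (show y < p + q by omega)]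
      exact h (a := ⟨x, by omega⟩) (b := ⟨y, hy⟩) hxy
    · have := h x y hxy y.2
      rwa [extendPerm_lt _ (show (x : ℕ) < p + q by omega),
        extendPerm_lt _ (show (y : ℕ) < p + q by omega)] at this
    · rw [extendPerm_lt _ (show p + x < p + q by omega),
        extendPerm_lt _ (show p + y < p + q by omega)]
      exact h (a := ⟨x, by omega⟩) (b := ⟨y, hy⟩) hxy
    · have := h x y hxy y.2
      rwa [extendPerm_lt _ (show p + (x : ℕ) < p + q by omega),
        extendPerm_lt _ (show p + (y : ℕ) < p + q by omega)] at this
  simp only [natShuffles, Finset.mem_map, Function.Embedding.coeFn_mk]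
  constructor
  · rintro ⟨t, ht, rfl⟩
    exact ⟨extendPerm_mem t, (key t).1 ht⟩
  · rintro ⟨h, h'⟩
    obtain ⟨t, rfl⟩ := exists_extendPerm h
    exact ⟨t, (key t).2 h', rfl⟩

theorem mem_fixAbove_of_mem_natShuffles {p q : ℕ} {s : Equiv.Perm ℕ} (h : s ∈ natShuffles p q) :
    s ∈ fixAbove (p + q) := (mem_natShuffles.1 h).1

/-- `s` and its inverse are strictly increasing on all of `ℕ`, and a strictly increasing self-map of
`ℕ` dominates the identity. -/
theorem eq_one_of_increasing {n : ℕ} {s : Equiv.Perm ℕ} (hs : s ∈ fixAbove n)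
    (h : ∀ x y, x < y → y < n → s x < s y) : s = 1 := by
  have hm : StrictMono s := fun x y hxy => by
    rcases lt_or_ge y n with hy | hy
    · exact h x y hxy hy
    · rw [hs y hy]
      rcases lt_or_ge x n with hx | hx
      · exact ((lt_iff_of_mem_fixAbove hs x).2 hx).trans_le hy
      · rwa [hs x hx]
  have hi : StrictMono ⇑s⁻¹ := fun x y hxy => by
    by_contra hn
    have := hm.monotone (not_lt.1 hn)
    simp at this
    omega
  ext x
  have h1 := hm.id_le x
  have h2 := hi.id_le (s x)
  simp only [id_eq, ← Equiv.Perm.mul_apply, inv_mul_cancel] at h1 h2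
  exact le_antisymm h2 h1

theorem natShuffles_zero_left (q : ℕ) : natShuffles 0 q = {1} := by
  ext s
  rw [mem_natShuffles, Finset.mem_singleton]
  constructor
  · rintro ⟨h1, _, h3⟩
    simp only [zero_add] at h1 h3
    exact eq_one_of_increasing h1 h3
  · rintro rfl
    refine ⟨one_mem _, ?_, ?_⟩ <;> intros <;> simp only [Equiv.Perm.one_apply] <;> omega

theorem natShuffles_zero_right (p : ℕ) : natShuffles p 0 = {1} := by
  ext s
  rw [mem_natShuffles, Finset.mem_singleton]
  constructor
  · rintro ⟨h1, h2, _⟩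
    exact eq_one_of_increasing h1 h2
  · rintro rfl
    refine ⟨one_mem _, ?_, ?_⟩ <;> intros <;> simp only [Equiv.Perm.one_apply] <;> omega

/-! ### Sorting on a block, and iterated shuffles -/

theorem lt_of_increasing {u : ℕ → ℕ} {n : ℕ} (h : ∀ x y, x < y → y < n → u x < u y) {x y : ℕ}
    (hx : x < n) (huv : u x < u y) : x < y := by
  by_contra hn
  rcases (not_lt.1 hn).eq_or_lt with rfl | h'
  · omega
  · have := h y x h' hx
    omega

/-- Any permutation can be sorted on the block `{p, …, p + n - 1}`. -/
theorem exists_sort (u : Equiv.Perm ℕ) (p n : ℕ) : ∃ t ∈ fixAbove n,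
    (∀ x y, x < y → y < n → (u * shift p t⁻¹) (p + x) < (u * shift p t⁻¹) (p + y)) ∧
    ∀ x y, x < n → y < n → u (p + x) < u (p + y) → t x < t y := by
  let f : Fin n → ℕ := fun i => u (p + i)
  -- `r` lists the positions of the block by increasing value of `u`. The witness is `r⁻¹`, which
  -- sends a position to the rank of its value (the standardization of `u` on the block); hence it
  -- preserves the comparisons between values of `u`.
  let r := extendPerm (Tuple.sort f)
  have hr : r ∈ fixAbove n := extendPerm_mem _
  have hm : ∀ x y, x < y → y < n → u (p + r x) < u (p + r y) := fun x y hxy hy => by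
    have h1 : f (Tuple.sort f ⟨x, by omega⟩) ≤ f (Tuple.sort f ⟨y, hy⟩) :=
      Tuple.monotone_sort f (show (⟨x, by omega⟩ : Fin n) ≤ ⟨y, hy⟩ from hxy.le)
    simp only [f, ← extendPerm_lt] at h1
    refine lt_of_le_of_ne h1 fun h => ?_
    have := r.injective (Nat.add_left_cancel (u.injective h))
    omega
  refine ⟨r⁻¹, inv_mem hr, fun x y hxy hy => ?_, fun x y hx hy hxy => ?_⟩
  · simpa [shift_apply_add] using hm x y hxy hy
  · refine lt_of_increasing (u := fun x => u (p + r x)) hm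
      ((lt_iff_of_mem_fixAbove (inv_mem hr) x).2 hx) ?_
    simpa using hxy

/-- Uniqueness of the sorted form: `s` and `s'` increase on the block, hence so does `t' * t⁻¹`,
which is therefore the identity. -/
theorem eq_of_mul_shift_eq {s s' t t' : Equiv.Perm ℕ} {p n : ℕ} (ht : t ∈ fixAbove n)
    (ht' : t' ∈ fixAbove n) (hs : ∀ x y, x < y → y < n → s (p + x) < s (p + y))
    (hs' : ∀ x y, x < y → y < n → s' (p + x) < s' (p + y))
    (h : s * shift p t = s' * shift p t') : s = s' ∧ t = t' := by
  have hw : t' * t⁻¹ = 1 := by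
    refine eq_one_of_increasing (mul_mem ht' (inv_mem ht)) fun x y hxy hy => ?_
    have e : s = s' * shift p (t' * t⁻¹) := by
      rw [shift_mul, ← mul_assoc, ← h, mul_assoc, ← shift_mul, mul_inv_cancel, shift_one, mul_one]
    have := hs x y hxy hy
    rw [e, Equiv.Perm.mul_apply, Equiv.Perm.mul_apply, shift_apply_add, shift_apply_add] at this
    exact lt_of_increasing (u := fun x => s' (p + x)) hs'
      ((lt_iff_of_mem_fixAbove (mul_mem ht' (inv_mem ht)) x).2 (by omega)) this
  have e : t = t' := (mul_inv_eq_one.1 hw).symm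
  subst e
  exact ⟨mul_right_cancel h, rfl⟩

theorem shift_zero (t : Equiv.Perm ℕ) : shift 0 t = t := by
  ext x
  simp [shift]

/-- The right-hand side, monotonicity on three consecutive blocks, does not see the bracketing and
recurs in `mem_natShuffles_mul_shift_iff`. Given `u`, the factor `t` standardizes `u` on the first
two blocks and inherits their increasing runs. -/
theorem mem_natShuffles_mul_iff {p q r : ℕ} {u : Equiv.Perm ℕ} :
    (∃ s ∈ natShuffles (p + q) r, ∃ t ∈ natShuffles p q, s * t = u) ↔
      u ∈ fixAbove (p + q + r) ∧ (∀ x y, x < y → y < p → u x < u y) ∧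
      (∀ x y, x < y → y < q → u (p + x) < u (p + y)) ∧
      ∀ x y, x < y → y < r → u (p + q + x) < u (p + q + y) := by
  simp only [mem_natShuffles]
  constructor
  · rintro ⟨s, ⟨hs, hs1, hs2⟩, t, ⟨ht, ht1, ht2⟩, rfl⟩
    simp only [Equiv.Perm.mul_apply]
    refine ⟨mul_mem hs (fixAbove_mono (by omega) ht),
      fun x y hxy hy => hs1 _ _ (ht1 x y hxy hy) ((lt_iff_of_mem_fixAbove ht _).2 (by omega)),
      fun x y hxy hy => hs1 _ _ (ht2 x y hxy hy) ((lt_iff_of_mem_fixAbove ht _).2 (by omega)),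
      fun x y hxy hy => ?_⟩
    rw [ht _ (by omega), ht _ (by omega)]
    exact hs2 x y hxy hy
  · rintro ⟨hu, h1, h2, h3⟩
    obtain ⟨t, ht, hs, hm⟩ := exists_sort u 0 (p + q)
    simp only [zero_add, shift_zero] at hs hm
    refine ⟨u * t⁻¹, ⟨mul_mem hu (fixAbove_mono (by omega) (inv_mem ht)), hs,
      fun x y hxy hy => ?_⟩, t, ⟨ht, fun x y hxy hy => ?_, fun x y hxy hy => ?_⟩, by simp⟩
    · rw [Equiv.Perm.mul_apply, Equiv.Perm.mul_apply, inv_mem ht _ (by omega),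
        inv_mem ht _ (by omega)]
      exact h3 x y hxy hy
    · exact hm x y (by omega) (by omega) (h1 x y hxy hy)
    · exact hm _ _ (by omega) (by omega) (h2 x y hxy hy)

theorem mem_natShuffles_mul_shift_iff {p q r : ℕ} {u : Equiv.Perm ℕ} :
    (∃ s ∈ natShuffles p (q + r), ∃ t ∈ natShuffles q r, s * shift p t = u) ↔
      u ∈ fixAbove (p + q + r) ∧ (∀ x y, x < y → y < p → u x < u y) ∧
      (∀ x y, x < y → y < q → u (p + x) < u (p + y)) ∧
      ∀ x y, x < y → y < r → u (p + q + x) < u (p + q + y) := by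
  simp only [mem_natShuffles]
  constructor
  · rintro ⟨s, ⟨hs, hs1, hs2⟩, t, ⟨ht, ht1, ht2⟩, rfl⟩
    simp only [Equiv.Perm.mul_apply, add_assoc, shift_apply_add] at *
    refine ⟨mul_mem hs (shift_mem ht), fun x y hxy hy => ?_,
      fun x y hxy hy => hs2 _ _ (ht1 x y hxy hy) ((lt_iff_of_mem_fixAbove ht _).2 (by omega)),
      fun x y hxy hy => hs2 _ _ (ht2 x y hxy hy) ((lt_iff_of_mem_fixAbove ht _).2 (by omega))⟩
    rw [shift_apply_lt _ hy, shift_apply_lt _ (by omega)]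
    exact hs1 x y hxy hy
  · rintro ⟨hu, h1, h2, h3⟩
    obtain ⟨t, ht, hs, hm⟩ := exists_sort u p (q + r)
    rw [add_assoc] at hu
    refine ⟨u * shift p t⁻¹, ⟨mul_mem hu (shift_mem (inv_mem ht)), fun x y hxy hy => ?_, hs⟩,
      t, ⟨ht, fun x y hxy hy => ?_, fun x y hxy hy => ?_⟩, ?_⟩
    · rw [Equiv.Perm.mul_apply, Equiv.Perm.mul_apply, shift_apply_lt _ hy,
        shift_apply_lt _ (by omega)]
      exact h1 x y hxy hy
    · exact hm x y (by omega) (by omega) (h2 x y hxy hy)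
    · exact hm _ _ (by omega) (by omega) (by simpa only [add_assoc] using h3 x y hxy hy)
    · rw [mul_assoc, ← shift_mul, inv_mul_cancel, shift_one, mul_one]

section Sums

variable {M : Type*} [AddCommGroup M]

/-- Both products run, once each, over the permutations increasing on three consecutive blocks of
lengths `p`, `q`, `r`; the sums become sums over equal images. -/
theorem sum_natShuffles_assoc (p q r : ℕ) (v : Equiv.Perm ℕ → M) :
    ∑ s ∈ natShuffles (p + q) r, ∑ t ∈ natShuffles p q, v (s * t) =
      ∑ s ∈ natShuffles p (q + r), ∑ t ∈ natShuffles q r, v (s * shift p t) := by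
  classical
  rw [← Finset.sum_product', ← Finset.sum_product',
    ← Finset.sum_image (g := fun x : Equiv.Perm ℕ × Equiv.Perm ℕ => x.1 * x.2),
    ← Finset.sum_image (g := fun x : Equiv.Perm ℕ × Equiv.Perm ℕ => x.1 * shift p x.2)]
  · refine Finset.sum_congr ?_ fun _ _ => rfl
    ext u
    simp only [Finset.mem_image, Finset.mem_product, Prod.exists]
    refine Iff.trans ?_ (((mem_natShuffles_mul_iff (p := p) (q := q) (r := r) (u := u)).trans
      mem_natShuffles_mul_shift_iff.symm).trans ?_)
    · exact ⟨fun ⟨s, t, ⟨hs, ht⟩, e⟩ => ⟨s, hs, t, ht, e⟩,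
        fun ⟨s, hs, t, ht, e⟩ => ⟨s, t, ⟨hs, ht⟩, e⟩⟩
    · exact ⟨fun ⟨s, hs, t, ht, e⟩ => ⟨s, t, ⟨hs, ht⟩, e⟩,
        fun ⟨s, t, ⟨hs, ht⟩, e⟩ => ⟨s, hs, t, ht, e⟩⟩
  · rintro ⟨s, t⟩ h ⟨s', t'⟩ h' e
    simp only [Finset.coe_product, Set.mem_prod, SetLike.mem_coe, mem_natShuffles] at h h' e
    obtain ⟨e1, e2⟩ := eq_of_mul_shift_eq h.2.1 h'.2.1 h.1.2.2 h'.1.2.2 e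
    rw [e1, e2]
  · rintro ⟨s, t⟩ h ⟨s', t'⟩ h' e
    simp only [Finset.coe_product, Set.mem_prod, SetLike.mem_coe, mem_natShuffles] at h h' e
    -- The sorted block is the initial one of length `p + q`, so the shift is by `0`, which is no
    -- shift.
    obtain ⟨e1, e2⟩ := eq_of_mul_shift_eq (p := 0) (n := p + q) (s := s) (s' := s') h.2.1 h'.2.1
      (by simpa using h.1.2.1) (by simpa using h'.1.2.1) (by simpa only [shift_zero] using e)
    rw [e1, e2]

end Sums

/-! ### Cutting shuffles -/

/-- The values below `a` of an increasing function occupy an initial segment of its domain; `i` is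
the length of that segment. -/
theorem exists_cut {u : ℕ → ℕ} (p a : ℕ) (h : ∀ x y, x < y → y < p → u x < u y) :
    ∃ i ≤ p, ∀ x < p, u x < a ↔ x < i := by
  induction p with
  | zero => exact ⟨0, le_rfl, fun x hx => by omega⟩
  | succ p ih =>
    by_cases hp : u p < a
    · refine ⟨p + 1, le_rfl, fun x hx => iff_of_true ?_ hx⟩
      rcases Nat.lt_succ_iff_lt_or_eq.1 hx with hx | rfl
      · exact (h x p hx (by omega)).trans hp
      · exact hp
    · obtain ⟨i, hi, h'⟩ := ih fun x y hxy hy => h x y hxy (by omega)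
      refine ⟨i, by omega, fun x hx => ?_⟩
      rcases Nat.lt_succ_iff_lt_or_eq.1 hx with hx | rfl
      · exact h' x hx
      · exact iff_of_false hp (by omega)

/-- `r` maps an initial segment of cardinality `b` onto one of cardinality `a`. -/
theorem eq_of_apply_lt_iff {r : Equiv.Perm ℕ} {a b : ℕ} (h : ∀ x, r x < a ↔ x < b) : a = b := by
  have e : (Finset.range b).map r.toEmbedding = Finset.range a := by
    ext y
    simp only [Finset.mem_map_equiv, Finset.mem_range]
    rw [← h, Equiv.apply_symm_apply]
  have := congrArg Finset.card e
  simpa using this.symm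

/-- A permutation preserving `{0, …, a - 1}` also preserves the complement; `s` and `t` are its two
restrictions, the second translated. -/
theorem exists_mul_shift {r : Equiv.Perm ℕ} {a b : ℕ} (hr : r ∈ fixAbove (a + b))
    (h : ∀ x, r x < a ↔ x < a) :
    ∃ s ∈ fixAbove a, ∃ t ∈ fixAbove b, s * shift a t = r := by
  have h' : ∀ x, r.symm x < a ↔ x < a := fun x => by rw [← h, Equiv.apply_symm_apply]
  let s : Equiv.Perm ℕ :=
    { toFun := fun x => if x < a then r x else x
      invFun := fun x => if x < a then r.symm x else x
      left_inv := fun x => by by_cases hx : x < a <;> simp [hx, h]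
      right_inv := fun x => by by_cases hx : x < a <;> simp [hx, h'] }
  have hge : ∀ x, a ≤ r (a + x) := fun x => by
    have := (h (a + x)).not
    omega
  have hge' : ∀ x, a ≤ r.symm (a + x) := fun x => by
    have := (h' (a + x)).not
    omega
  let t : Equiv.Perm ℕ :=
    { toFun := fun x => r (a + x) - a
      invFun := fun x => r.symm (a + x) - a
      left_inv := fun x => by
        dsimp only
        rw [Nat.add_sub_cancel' (hge x), Equiv.symm_apply_apply, Nat.add_sub_cancel_left]
      right_inv := fun x => by
        dsimp only
        rw [Nat.add_sub_cancel' (hge' x), Equiv.apply_symm_apply, Nat.add_sub_cancel_left] }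
  have hs : s ∈ fixAbove a := fun x hx => if_neg (by omega)
  refine ⟨s, hs, t, fun x hx => ?_, ?_⟩
  · change r (a + x) - a = x
    rw [hr _ (by omega), Nat.add_sub_cancel_left]
  · ext x
    rw [Equiv.Perm.mul_apply]
    rcases lt_or_ge x a with hx | hx
    · rw [shift_apply_lt _ hx]
      exact if_pos hx
    · obtain ⟨y, rfl⟩ := Nat.exists_eq_add_of_le hx
      rw [shift_apply_add, hs _ (by omega)]
      exact Nat.add_sub_cancel' (hge y)

theorem mul_shift_injective {s s' t t' : Equiv.Perm ℕ} {a : ℕ} (hs : s ∈ fixAbove a)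
    (hs' : s' ∈ fixAbove a) (h : s * shift a t = s' * shift a t') : s = s' ∧ t = t' := by
  constructor
  · ext x
    rcases lt_or_ge x a with hx | hx
    · have := DFunLike.congr_fun h x
      rwa [Equiv.Perm.mul_apply, Equiv.Perm.mul_apply, shift_apply_lt _ hx,
        shift_apply_lt _ hx] at this
    · rw [hs x hx, hs' x hx]
  · ext x
    have := DFunLike.congr_fun h (a + x)
    rw [Equiv.Perm.mul_apply, Equiv.Perm.mul_apply, shift_apply_add, shift_apply_add,
      hs _ (by omega), hs' _ (by omega)] at this
    omega

theorem shift_swapBlocks_apply {p i : ℕ} (hi : i ≤ p) (j x : ℕ) :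
    shift i (swapBlocks (p - i) j) x =
      if x < i then x else if x < p then x + j else if x < p + j then x - p + i else x := by
  rcases lt_or_ge x i with h | h
  · rw [shift_apply_lt _ h, if_pos h]
  · rw [shift_apply_ge _ h, swapBlocks_apply]
    split_ifs <;> omega

/-- The exchange gathers the first `i` positions of the first block and the first `j` of the second.
Then `s` places these at the values below `i + j`, and `t` places all others above. -/
theorem cut_apply {p i j : ℕ} (hi : i ≤ p) {s : Equiv.Perm ℕ} (hs : s ∈ fixAbove (i + j))
    (t : Equiv.Perm ℕ) (x : ℕ) :
    (s * shift (i + j) t * shift i (swapBlocks (p - i) j)) x =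
      if x < i then s x else if x < p then i + j + t (x - i) else
        if x < p + j then s (x - p + i) else i + j + t (x - (i + j)) := by
  rw [Equiv.Perm.mul_apply, Equiv.Perm.mul_apply, shift_swapBlocks_apply hi]
  split_ifs with h1 h2 h3
  · rw [shift_apply_lt _ (by omega)]
  · rw [shift_apply_ge _ (by omega), hs _ (by omega), show x + j - (i + j) = x - i by omega]
  · rw [shift_apply_lt _ (by omega)]
  · rw [shift_apply_ge _ (by omega), hs _ (by omega)]

theorem cut_apply_lt_iff {p i j : ℕ} (hi : i ≤ p) {s : Equiv.Perm ℕ} (hs : s ∈ fixAbove (i + j))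
    (t : Equiv.Perm ℕ) (x : ℕ) (hx : x < p) :
    (s * shift (i + j) t * shift i (swapBlocks (p - i) j)) x < i + j ↔ x < i := by
  rw [cut_apply hi hs]
  have := (lt_iff_of_mem_fixAbove hs x).2
  split_ifs with h1
  · exact iff_of_true (this (by omega)) h1
  · omega

theorem cut_mem {p q i j : ℕ} (hi : i ≤ p) (hj : j ≤ q) {s t : Equiv.Perm ℕ}
    (hs : s ∈ natShuffles i j) (ht : t ∈ natShuffles (p - i) (q - j)) :
    s * shift (i + j) t * shift i (swapBlocks (p - i) j) ∈ natShuffles p q := by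
  rw [mem_natShuffles] at *
  obtain ⟨hs, hs1, hs2⟩ := hs
  obtain ⟨ht, ht1, ht2⟩ := ht
  refine ⟨mul_mem (mul_mem (fixAbove_mono (by omega) hs) (fixAbove_mono (by omega) (shift_mem ht)))
    (fixAbove_mono (by omega) (shift_mem (swapBlocks_mem _ _))), fun x y hxy hy => ?_,
    fun x y hxy hy => ?_⟩ <;> rw [cut_apply hi hs, cut_apply hi hs]
  · have h1 := hs1 x y hxy
    have h2 := ht1 (x - i) (y - i)
    have h3 := (lt_iff_of_mem_fixAbove hs x).2
    split_ifs <;> omega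
  · have h1 := hs2 x y hxy
    have h2 := ht2 (x - j) (y - j)
    have h3 := (lt_iff_of_mem_fixAbove hs (i + x)).2
    have e1 : p + x - p + i = i + x := by omega
    have e2 : p + y - p + i = i + y := by omega
    rw [e1, e2]
    by_cases hx : x < j
    · split_ifs <;> omega
    · have e3 : p + x - (i + j) = p - i + (x - j) := by omega
      have e4 : p + y - (i + j) = p - i + (y - j) := by omega
      rw [e3, e4]
      split_ifs <;> omega

/-- Take `i` and `j` to count the positions of each block whose value is below `a`. Once the
exchange gathering them is undone, the permutation preserves `{0, …, a - 1}` and splits by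
`exists_mul_shift`. -/
theorem exists_cut_eq {p q a : ℕ} {u : Equiv.Perm ℕ} (hu : u ∈ natShuffles p q)
    (ha : a ≤ p + q) : ∃ i j s t, i ≤ p ∧ j ≤ q ∧ i + j = a ∧ s ∈ natShuffles i j ∧
      t ∈ natShuffles (p - i) (q - j) ∧
      s * shift (i + j) t * shift i (swapBlocks (p - i) j) = u := by
  obtain ⟨hu, h1, h2⟩ := mem_natShuffles.1 hu
  obtain ⟨i, hi, hi'⟩ := exists_cut p a h1
  obtain ⟨j, hj, hj'⟩ := exists_cut (u := fun y => u (p + y)) q a h2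
  set σ := shift i (swapBlocks (p - i) j) with hσ
  have hlt : ∀ x, (u * σ⁻¹) x < a ↔ x < i + j := fun x => by
    obtain ⟨y, rfl⟩ := σ.surjective x
    rw [Equiv.Perm.mul_apply, ← Equiv.Perm.mul_apply σ⁻¹, inv_mul_cancel, Equiv.Perm.one_apply,
      hσ, shift_swapBlocks_apply hi]
    rcases lt_or_ge y p with hy | hy
    · rw [hi' y hy]
      split_ifs <;> omega
    · obtain ⟨z, rfl⟩ := Nat.exists_eq_add_of_le hy
      rcases lt_or_ge z q with hz | hz
      · rw [hj' z hz]
        split_ifs <;> omega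
      · rw [hu _ (by omega)]
        split_ifs <;> omega
  -- Exactly `i + j` positions have a value below `a`, whence `a = i + j`.
  obtain rfl := eq_of_apply_lt_iff hlt
  have hσm : σ ∈ fixAbove (p + q) := fixAbove_mono (by omega) (shift_mem (swapBlocks_mem _ _))
  obtain ⟨s, hs, t, ht, e⟩ := exists_mul_shift (a := i + j) (b := p - i + (q - j))
    (by
      rw [show i + j + (p - i + (q - j)) = p + q by omega]
      exact mul_mem hu (inv_mem hσm)) hlt
  have e' : u = s * shift (i + j) t * σ := by rw [e, inv_mul_cancel_right]
  refine ⟨i, j, s, t, hi, hj, rfl, mem_natShuffles.2 ⟨hs, fun x y hxy hy => ?_,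
    fun x y hxy hy => ?_⟩, mem_natShuffles.2 ⟨ht, fun x y hxy hy => ?_, fun x y hxy hy => ?_⟩,
    e'.symm⟩
  · have := h1 x y hxy (by omega)
    rwa [e', cut_apply hi hs, cut_apply hi hs, if_pos (by omega), if_pos hy] at this
  · have := h2 x y hxy (by omega)
    rwa [e', cut_apply hi hs, cut_apply hi hs, if_neg (by omega), if_neg (by omega),
      if_pos (by omega), if_neg (by omega), if_neg (by omega), if_pos (by omega),
      show p + x - p + i = i + x by omega, show p + y - p + i = i + y by omega] at this
  · have := h1 (i + x) (i + y) (by omega) (by omega)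
    rw [e', cut_apply hi hs, cut_apply hi hs, if_neg (by omega), if_pos (by omega),
      if_neg (by omega), if_pos (by omega), Nat.add_sub_cancel_left,
      Nat.add_sub_cancel_left] at this
    omega
  · have := h2 (j + x) (j + y) (by omega) (by omega)
    rw [e', cut_apply hi hs, cut_apply hi hs, if_neg (by omega), if_neg (by omega),
      if_neg (by omega), if_neg (by omega), if_neg (by omega), if_neg (by omega),
      show p + (j + x) - (i + j) = p - i + x by omega,
      show p + (j + y) - (i + j) = p - i + y by omega] at this
    omega

section Sums

variable {M : Type*} [AddCommGroup M]

/-- The combinatorial core of the compatibility of product and coproduct: a shuffle with a cut level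
is the same as a shuffle below the level and a shuffle above it. -/
theorem sum_natShuffles_cut (p q : ℕ) (v : ℕ → Equiv.Perm ℕ → M) :
    ∑ u ∈ natShuffles p q, ∑ a ∈ Finset.range (p + q + 1), v a u =
      ∑ i ∈ Finset.range (p + 1), ∑ j ∈ Finset.range (q + 1), ∑ s ∈ natShuffles i j,
        ∑ t ∈ natShuffles (p - i) (q - j),
          v (i + j) (s * shift (i + j) t * shift i (swapBlocks (p - i) j)) := by
  simp only [← Finset.sum_product', Finset.sum_sigma']
  symm
  refine Finset.sum_nbij (fun x => (x.2.2.1 * shift (x.1 + x.2.1) x.2.2.2 *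
    shift x.1 (swapBlocks (p - x.1) x.2.1), x.1 + x.2.1)) ?_ ?_ ?_ fun _ _ => rfl
  · rintro ⟨i, j, s, t⟩ h
    simp only [Finset.mem_sigma, Finset.mem_product, Finset.mem_range] at h ⊢
    exact ⟨cut_mem (by omega) (by omega) h.2.2.1 h.2.2.2, by omega⟩
  · rintro ⟨i, j, s, t⟩ h ⟨i', j', s', t'⟩ h' e
    simp only [SetLike.mem_coe, Finset.mem_sigma, Finset.mem_product, Finset.mem_range,
      Prod.mk.injEq] at h h' e
    have hs := mem_fixAbove_of_mem_natShuffles h.2.2.1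
    have hs' := mem_fixAbove_of_mem_natShuffles h'.2.2.1
    have h1 := cut_apply_lt_iff (p := p) (by omega) hs t
    have h2 := cut_apply_lt_iff (p := p) (by omega) hs' t'
    -- `i` is recovered as the length of the initial segment of the first block with values below
    -- the level; if the two candidates differed, the smaller one would be a position where the
    -- descriptions disagree.
    obtain rfl : i = i' := by
      rw [← e.1, ← e.2] at h2
      by_contra hne
      rcases Nat.lt_or_gt_of_ne hne with hlt | hlt
      · have a1 := h1 i (by omega)
        have a2 := h2 i (by omega)
        omega
      · have a1 := h1 i' (by omega)
        have a2 := h2 i' (by omega)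
        omega
    obtain rfl : j = j' := by omega
    obtain ⟨rfl, rfl⟩ := mul_shift_injective hs hs' (mul_right_cancel e.1)
    rfl
  · rintro ⟨u, a⟩ h
    simp only [SetLike.mem_coe, Finset.mem_product, Finset.mem_range] at h
    obtain ⟨i, j, s, t, hi, hj, ha, hs, ht, e⟩ := exists_cut_eq h.1 (Nat.lt_succ_iff.1 h.2)
    refine ⟨⟨i, j, s, t⟩, ?_, ?_⟩
    · simp only [SetLike.mem_coe, Finset.mem_sigma, Finset.mem_product, Finset.mem_range]
      exact ⟨by omega, by omega, hs, ht⟩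
    · simp only [Prod.mk.injEq]
      exact ⟨e, ha⟩

/-! ### Alternating sums of shuffles -/

theorem mem_natShuffles_mul_rev_iff {N p : ℕ} (hp : p ≤ N) {u : Equiv.Perm ℕ} :
    u * rev p ∈ natShuffles p (N - p) ↔ u ∈ fixAbove N ∧ (∀ x y, x < y → y < p → u y < u x) ∧
      ∀ x y, p ≤ x → x < y → y < N → u x < u y := by
  rw [mem_natShuffles, Nat.add_sub_cancel' hp, mul_mem_cancel_right (fixAbove_mono hp (rev_mem p))]
  refine and_congr_right fun _ => and_congr ⟨fun h x y hxy hy => ?_, fun h x y hxy hy => ?_⟩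
    ⟨fun h x y hx hxy hy => ?_, fun h x y hxy hy => ?_⟩
  · have := h (p - 1 - y) (p - 1 - x) (by omega) (by omega)
    rwa [Equiv.Perm.mul_apply, Equiv.Perm.mul_apply, rev_apply, rev_apply, if_pos (by omega),
      if_pos (by omega), show p - 1 - (p - 1 - y) = y by omega,
      show p - 1 - (p - 1 - x) = x by omega] at this
  · rw [Equiv.Perm.mul_apply, Equiv.Perm.mul_apply, rev_apply, rev_apply, if_pos (by omega),
      if_pos hy]
    exact h _ _ (by omega) (by omega)
  · have := h (x - p) (y - p) (by omega) (by omega)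
    rwa [Equiv.Perm.mul_apply, Equiv.Perm.mul_apply, rev_mem _ _ (by omega),
      rev_mem _ _ (by omega), Nat.add_sub_cancel' hx, Nat.add_sub_cancel' (by omega)] at this
  · rw [Equiv.Perm.mul_apply, Equiv.Perm.mul_apply, rev_mem _ _ (by omega),
      rev_mem _ _ (by omega)]
    exact h _ _ (by omega) (by omega) (by omega)

/-- The permutations that decrease on `{0, …, p - 1}` and increase on `{p, …, N - 1}`. -/
noncomputable def valleys (N p : ℕ) : Finset (Equiv.Perm ℕ) :=
  (natShuffles p (N - p)).map (Equiv.mulRight (rev p)).toEmbedding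

theorem mem_valleys {N p : ℕ} (hp : p ≤ N) {u : Equiv.Perm ℕ} :
    u ∈ valleys N p ↔ u ∈ fixAbove N ∧ (∀ x y, x < y → y < p → u y < u x) ∧
      ∀ x y, p ≤ x → x < y → y < N → u x < u y := by
  have e : (rev p)⁻¹ = rev p := inv_eq_of_mul_eq_one_left (rev_mul_rev p)
  rw [← mem_natShuffles_mul_rev_iff hp, valleys, Finset.mem_map_equiv, Equiv.mulRight_symm, e]
  rfl

/-- The left factor reverses the order of values. On the second block the right factor also reverses
the order of positions, so that block still increases while the first one now decreases. -/
theorem rev_mul_mem_valleys_iff {N p : ℕ} (hp : p ≤ N) {s : Equiv.Perm ℕ} :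
    rev N * (s * shift p (rev (N - p))) ∈ valleys N p ↔ s ∈ natShuffles p (N - p) := by
  have hm : shift p (rev (N - p)) ∈ fixAbove N :=
    fixAbove_mono (by omega) (shift_mem (rev_mem (N - p)))
  rw [mem_valleys hp, mem_natShuffles, Nat.add_sub_cancel' hp, mul_mem_cancel_left (rev_mem N),
    mul_mem_cancel_right hm]
  refine and_congr_right fun hs => ?_
  have hlt := fun x => (lt_iff_of_mem_fixAbove hs x).2
  have e1 : ∀ x < p, (rev N * (s * shift p (rev (N - p)))) x = N - 1 - s x := fun x hx => by
    rw [Equiv.Perm.mul_apply, Equiv.Perm.mul_apply, shift_apply_lt _ hx, rev_apply,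
      if_pos (hlt x (by omega))]
  have e2 : ∀ x < N - p, (rev N * (s * shift p (rev (N - p)))) (p + x) =
      N - 1 - s (p + (N - p - 1 - x)) := fun x hx => by
    rw [Equiv.Perm.mul_apply, Equiv.Perm.mul_apply, shift_apply_add, rev_apply (N - p), if_pos hx,
      rev_apply, if_pos (hlt _ (by omega))]
  refine and_congr ⟨fun h x y hxy hy => ?_, fun h x y hxy hy => ?_⟩
    ⟨fun h x y hxy hy => ?_, fun h x y hx hxy hy => ?_⟩
  · have := h x y hxy hy
    rw [e1 x (by omega), e1 y hy] at this
    omega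
  · have h1 := h x y hxy hy
    have h2 := hlt y (by omega)
    rw [e1 x (by omega), e1 y hy]
    omega
  · have := h (p + (N - p - 1 - y)) (p + (N - p - 1 - x)) (by omega) (by omega) (by omega)
    rw [e2 _ (by omega), e2 _ (by omega), show N - p - 1 - (N - p - 1 - y) = y by omega,
      show N - p - 1 - (N - p - 1 - x) = x by omega] at this
    omega
  · obtain ⟨x, rfl⟩ := Nat.exists_eq_add_of_le hx
    obtain ⟨y, rfl⟩ := Nat.exists_eq_add_of_le (hx.trans hxy.le)
    have h1 := h (N - p - 1 - y) (N - p - 1 - x) (by omega) (by omega)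
    have h2 := hlt (p + (N - p - 1 - x)) (by omega)
    rw [e2 _ (by omega), e2 _ (by omega)]
    omega

variable [Module ℂ M]

/-- An element of `valleys N p` takes its least value on `{0, …, N - 1}` at position `p - 1` or `p`.
Moving that position to the other run changes `p` by one and the sign with it: a sign-reversing
involution without fixed points. -/
theorem sum_valleys {N : ℕ} (hN : 0 < N) (v : Equiv.Perm ℕ → M) :
    ∑ p ∈ Finset.range (N + 1), (-1 : ℂ) ^ p • ∑ u ∈ valleys N p, v u = 0 := by
  classical
  simp only [Finset.smul_sum, Finset.sum_sigma']
  -- The condition `c` says that the minimum sits at position `p`, at the start of the increasing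
  -- run, so that it can be appended to the decreasing run.
  let c : (_ : ℕ) × Equiv.Perm ℕ → Prop :=
    fun x => x.1 < N ∧ (x.1 = 0 ∨ x.2 x.1 < x.2 (x.1 - 1))
  have hc1 : ∀ x ∈ (Finset.range (N + 1)).sigma (valleys N), c x →
      (⟨x.1 + 1, x.2⟩ : (_ : ℕ) × Equiv.Perm ℕ) ∈ (Finset.range (N + 1)).sigma (valleys N) ∧
        ¬ c ⟨x.1 + 1, x.2⟩ := by
    rintro ⟨p, u⟩ hx ⟨h1, h2⟩
    simp only [Finset.mem_sigma, Finset.mem_range] at hx h1 h2 ⊢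
    obtain ⟨hx, hu⟩ := hx
    obtain ⟨h3, h4, h5⟩ := (mem_valleys (by omega)).1 hu
    refine ⟨⟨by omega, (mem_valleys (by omega)).2 ⟨h3, fun x y hxy hy => ?_,
      fun x y hpx hxy hy => h5 x y (by omega) hxy hy⟩⟩, ?_⟩
    · rcases Nat.lt_succ_iff_lt_or_eq.1 hy with hy | rfl
      · exact h4 x y hxy hy
      -- The new last position of the decreasing run is compared with earlier ones through its
      -- neighbour, to which `c` applies.
      · rcases (Nat.le_sub_one_of_lt hxy).lt_or_eq with h | rfl
        · have := h4 x (y - 1) h (by omega)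
          omega
        · omega
    · rintro ⟨h6, h7⟩
      simp only [Nat.add_sub_cancel] at h6 h7
      have := h5 p (p + 1) le_rfl (by omega) h6
      omega
  have hc2 : ∀ x ∈ (Finset.range (N + 1)).sigma (valleys N), ¬ c x → 0 < x.1 ∧
      (⟨x.1 - 1, x.2⟩ : (_ : ℕ) × Equiv.Perm ℕ) ∈ (Finset.range (N + 1)).sigma (valleys N) ∧
        c ⟨x.1 - 1, x.2⟩ := by
    rintro ⟨p, u⟩ hx h
    simp only [Finset.mem_sigma, Finset.mem_range] at hx ⊢
    obtain ⟨hx, hu⟩ := hx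
    obtain ⟨h3, h4, h5⟩ := (mem_valleys (by omega)).1 hu
    simp only [c, not_and, not_or, not_lt] at h
    have hp : 0 < p := by
      by_contra h0
      exact (h (by omega)).1 (by omega)
    refine ⟨hp, ⟨by omega, (mem_valleys (by omega)).2 ⟨h3,
      fun x y hxy hy => h4 x y hxy (by omega), fun x y hpx hxy hy => ?_⟩⟩, ?_⟩
    · rcases (show p - 1 = x ∨ p ≤ x by omega) with rfl | hpx
      · have h6 := (h (by omega)).2
        have h7 : u (p - 1) ≠ u p := fun e => by
          have := u.injective e
          omega
        rcases (show p = y ∨ p < y by omega) with rfl | hpy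
        · omega
        · have := h5 p y le_rfl hpy hy
          omega
      · exact h5 x y hpx hxy hy
    · refine ⟨by change p - 1 < N; omega, ?_⟩
      change p - 1 = 0 ∨ u (p - 1) < u (p - 1 - 1)
      rcases (show p - 1 = 0 ∨ 1 < p by omega) with h | h
      · exact .inl h
      · exact .inr (h4 _ _ (by omega) (by omega))
  refine Finset.sum_involution (fun x _ => if c x then ⟨x.1 + 1, x.2⟩ else ⟨x.1 - 1, x.2⟩)
    ?_ ?_ ?_ ?_
  · intro x hx
    by_cases h : c x
    · simp [h, pow_succ]
    · obtain ⟨h0, -, -⟩ := hc2 x hx h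
      obtain ⟨p, u⟩ := x
      obtain ⟨p, rfl⟩ := Nat.exists_eq_succ_of_ne_zero h0.ne'
      simp [h, pow_succ]
  · intro x hx _ e
    by_cases h : c x
    · simp only [if_pos h] at e
      have := congrArg Sigma.fst e
      simp at this
    · obtain ⟨h0, -, -⟩ := hc2 x hx h
      simp only [if_neg h] at e
      have := congrArg Sigma.fst e
      simp only at this
      omega
  · intro x hx
    by_cases h : c x
    · simp only [if_pos h]
      exact (hc1 x hx h).1
    · simp only [if_neg h]
      exact (hc2 x hx h).2.1
  · intro x hx
    by_cases h : c x
    · have := (hc1 x hx h).2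
      simp [h, this]
    · obtain ⟨h0, -, h1⟩ := hc2 x hx h
      simp only [if_neg h, if_pos h1, Nat.sub_add_cancel h0]

theorem sum_natShuffles_mul_rev {N : ℕ} (hN : 0 < N) (v : Equiv.Perm ℕ → M) :
    ∑ p ∈ Finset.range (N + 1), (-1 : ℂ) ^ p • ∑ s ∈ natShuffles p (N - p), v (s * rev p) = 0 := by
  rw [← sum_valleys hN v]
  simp [valleys]

/-- Left multiplication by `rev N` turns these permutations into valleys, at the cost of the global
sign `(-1) ^ N`. -/
theorem sum_natShuffles_mul_shift_rev {N : ℕ} (hN : 0 < N) (v : Equiv.Perm ℕ → M) :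
    ∑ p ∈ Finset.range (N + 1),
      (-1 : ℂ) ^ (N - p) • ∑ s ∈ natShuffles p (N - p), v (s * shift p (rev (N - p))) = 0 := by
  have key : ∀ p ∈ Finset.range (N + 1),
      (-1 : ℂ) ^ (N - p) • ∑ s ∈ natShuffles p (N - p), v (s * shift p (rev (N - p))) =
      (-1 : ℂ) ^ N • (-1 : ℂ) ^ p • ∑ u ∈ valleys N p, v (rev N * u) := by
    intro p hp
    rw [Finset.mem_range, Nat.lt_succ_iff] at hp
    have hinv : shift p (rev (N - p)) * shift p (rev (N - p)) = 1 := by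
      rw [← shift_mul, rev_mul_rev, shift_one]
    rw [smul_smul, ← pow_add]
    congr 1
    -- `N - p` and `N + p` have the same parity.
    · obtain ⟨q, rfl⟩ := Nat.exists_eq_add_of_le hp
      rw [Nat.add_sub_cancel_left, show p + q + p = q + 2 * p by ring, pow_add, pow_mul]
      simp
    · refine Finset.sum_nbij' (fun s => rev N * (s * shift p (rev (N - p))))
        (fun u => rev N * u * shift p (rev (N - p)))
        (fun s hs => (rev_mul_mem_valleys_iff hp).2 hs)
        (fun u hu => (rev_mul_mem_valleys_iff hp).1 ?_) ?_ ?_ ?_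
      · rwa [mul_assoc, hinv, mul_one, ← mul_assoc, rev_mul_rev, one_mul]
      · intro s _
        rw [← mul_assoc, rev_mul_rev, one_mul, mul_assoc, hinv, mul_one]
      · intro u _
        rw [mul_assoc, hinv, mul_one, ← mul_assoc, rev_mul_rev, one_mul]
      · intro s _
        rw [← mul_assoc, rev_mul_rev, one_mul]
  rw [Finset.sum_congr rfl key, ← Finset.smul_sum, sum_valleys hN, smul_zero]

end Sums

noncomputable section

open Bicollection

/-! ### Elementary tensors of forests as cuts -/

namespace Bicollection

variable {P Q R : Bicollection} {m k n : ℕ}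

theorem whiskerLeft_app_tmul (P : Bicollection) (f : Q ⟶ R) (x : P.obj m k) (y : Q.obj k n) :
    (P ◁ f).app m n (tmul x y) = tmul x (f.app k n y) := vtensorHom_tmul (𝟙 P) f x y

theorem whiskerRight_app_tmul (f : Q ⟶ R) (P : Bicollection) (x : Q.obj m k) (y : P.obj k n) :
    (f ▷ P).app m n (tmul x y) = tmul (f.app m k x) y := vtensorHom_tmul f (𝟙 P) x y

theorem tensorHom_app_tmul {P' Q' : Bicollection} (f : P ⟶ P') (g : Q ⟶ Q') (x : P.obj m k)
    (y : Q.obj k n) :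
    (f ⊗ₘ g).app m n (tmul x y) = tmul (f.app m k x) (g.app k n y) := vtensorHom_tmul f g x y

theorem associator_hom_app_tmul {l : ℕ} (x : P.obj m k) (y : Q.obj k l) (z : R.obj l n) :
    (α_ P Q R).hom.app m n (tmul (tmul x y) z) = tmul x (tmul y z) := vassoc_hom_tmul x y z

theorem associator_inv_app_tmul {l : ℕ} (x : P.obj m k) (y : Q.obj k l) (z : R.obj l n) :
    (α_ P Q R).inv.app m n (tmul x (tmul y z)) = tmul (tmul x y) z := vassoc_inv_tmul x y z

theorem leftUnitor_hom_app_tmul (x : P.obj m n) :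
    (λ_ P).hom.app m n (tmul (vone m) x) = x := vleftUnitor_hom_tmul x

theorem rightUnitor_hom_app_tmul (x : P.obj m n) :
    (ρ_ P).hom.app m n (tmul x (vone n)) = x := vrightUnitor_hom_tmul x

theorem comp_app_apply (f : P ⟶ Q) (g : Q ⟶ R) (x : P.obj m n) :
    (f ≫ g).app m n x = g.app m n (f.app m n x) := rfl

theorem tmul_zero (x : P.obj m k) : (tmul x 0 : (vtensor P Q).obj m n) = 0 :=
  (tmulₗ P Q m k n x).map_zero

theorem zero_tmul (y : Q.obj k n) : (tmul 0 y : (vtensor P Q).obj m n) = 0 :=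
  (tmulₗ P Q m k n).map_zero₂ y

theorem tmul_sum {ι : Type*} (s : Finset ι) (x : P.obj m k) (y : ι → Q.obj k n) :
    tmul x (∑ i ∈ s, y i) = ∑ i ∈ s, tmul x (y i) := map_sum (tmulₗ P Q m k n x) y s

theorem sum_tmul {ι : Type*} (s : Finset ι) (x : ι → P.obj m k) (y : Q.obj k n) :
    tmul (∑ i ∈ s, x i) y = ∑ i ∈ s, tmul (x i) y :=
  map_sum ((tmulₗ P Q m k n).flip y) x s

end Bicollection

theorem LF_ext {m n : ℕ} {M : Type} [AddCommGroup M] [Module ℂ M] {f g : LF.obj m n →ₗ[ℂ] M}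
    (h : ∀ x : LevelledForest m n, f (ofForest x) = g (ofForest x)) : f = g :=
  Finsupp.lhom_ext' fun x => LinearMap.ext_ring (h x)

/-- The middle index of a tensor is the number of trees of its right factor, hence is read off the
words. This compares tensors whose middle indices, typically two cut widths, are equal only
propositionally; `F` and `G` are therefore given for all indices. -/
theorem tmul_congr_words {P Q : Bicollection}
    (F : ∀ {m n : ℕ}, LevelledForest m n → P.obj m n)
    (G : ∀ {m n : ℕ}, LevelledForest m n → Q.obj m n) {m k k' n : ℕ} {f : LevelledForest m k}
    {f' : LevelledForest m k'} {g : LevelledForest k n} {g' : LevelledForest k' n}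
    (hf : f.words = f'.words) (hg : g.words = g'.words) :
    (tmul (F f) (G g) : (vtensor P Q).obj m n) = tmul (F f') (G g') := by
  obtain rfl : k = k' := by rw [← g.length_words, hg, g'.length_words]
  rw [LevelledForest.ext_words hf, LevelledForest.ext_words hg]

variable {m n : ℕ}

/-- The horizontal cut of a forest at level `p`, as an element of `𝓛𝓕 ⦶ 𝓛𝓕`. -/
def cut (h : LevelledForest m n) (p : ℕ) : (LF ⊗ LF : Bicollection).obj m n :=
  tmul (ofForest (h.lower p)) (ofForest (h.upper p))

/-- The cut of a forest at the levels `p` and `p + q`, as an element of `(𝓛𝓕 ⦶ 𝓛𝓕) ⦶ 𝓛𝓕`. -/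
def cutLeft (h : LevelledForest m n) (p q : ℕ) : ((LF ⊗ LF) ⊗ LF : Bicollection).obj m n :=
  tmul (cut (h.lower (p + q)) p) (ofForest (h.upper (p + q)))

/-- The cut of a forest at the levels `p` and `p + q`, as an element of `𝓛𝓕 ⦶ (𝓛𝓕 ⦶ 𝓛𝓕)`. -/
def cutRight (h : LevelledForest m n) (p q : ℕ) : (LF ⊗ (LF ⊗ LF) : Bicollection).obj m n :=
  tmul (ofForest (h.lower p)) (cut (h.upper p) q)

theorem tmul_ofForest {k : ℕ} (f : LevelledForest m k) (g : LevelledForest k n) :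
    (tmul (ofForest f) (ofForest g) : (vtensor LF LF).obj m n) = cut (f.glue g) f.norm :=
  tmul_congr_words ofForest ofForest (f.words_lower_glue g).symm (f.words_upper_glue g).symm

/-- Both sides consist of the same three slabs of `h`. The top factor is an arbitrary `G`, so that
it may itself be a cut, as in `tensorMul_cut`. -/
theorem associator_hom_cut {R : Bicollection}
    (G : ∀ {m n : ℕ}, LevelledForest m n → R.obj m n) (h : LevelledForest m n) (p q : ℕ) :
    (α_ LF LF R).hom.app m n (tmul (cut (h.lower (p + q)) p) (G (h.upper (p + q)))) =
      tmul (ofForest (h.lower p))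
        (tmul (ofForest ((h.upper p).lower q)) (G ((h.upper p).upper q))) := by
  refine (associator_hom_app_tmul _ _ _).trans ?_
  have e : ∀ {k k' l l' : ℕ} (f : LevelledForest m k) (g : LevelledForest k l)
      (i : LevelledForest l n) (f' : LevelledForest m k') (g' : LevelledForest k' l')
      (i' : LevelledForest l' n), f.words = f'.words → g.words = g'.words → i.words = i'.words →
      (tmul (ofForest f) (tmul (ofForest g) (G i)) : (vtensor LF (vtensor LF R)).obj m n) =
        tmul (ofForest f') (tmul (ofForest g') (G i')) := by
    intro k k' l l' f g i f' g' i' hf hg hi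
    obtain rfl : k = k' := by rw [← g.length_words, hg, g'.length_words]
    obtain rfl : l = l' := by rw [← i.length_words, hi, i'.length_words]
    rw [LevelledForest.ext_words hf, LevelledForest.ext_words hg, LevelledForest.ext_words hi]
  exact e _ _ _ _ _ _ (h.words_lower_lower p q) (h.words_upper_lower p q)
    (h.words_upper_upper p q).symm

theorem associator_inv_cut {R : Bicollection}
    (G : ∀ {m n : ℕ}, LevelledForest m n → R.obj m n) (h : LevelledForest m n) (p q : ℕ) :
    (α_ LF LF R).inv.app m n (tmul (ofForest (h.lower p))
        (tmul (ofForest ((h.upper p).lower q)) (G ((h.upper p).upper q)))) =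
      tmul (cut (h.lower (p + q)) p) (G (h.upper (p + q))) := by
  rw [← associator_hom_cut, ← comp_app_apply, Iso.hom_inv_id]
  rfl

theorem associator_hom_cutLeft (h : LevelledForest m n) (p q : ℕ) :
    (α_ LF LF LF).hom.app m n (cutLeft h p q) = cutRight h p q :=
  associator_hom_cut ofForest h p q

theorem associator_inv_cutRight (h : LevelledForest m n) (p q : ℕ) :
    (α_ LF LF LF).inv.app m n (cutRight h p q) = cutLeft h p q :=
  associator_inv_cut ofForest h p q

section Ext

variable {M : Type} [AddCommGroup M] [Module ℂ M]

theorem tmul_ofForest_ext {f g : (LF ⊗ LF : Bicollection).obj m n →ₗ[ℂ] M}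
    (h : ∀ k (x : LevelledForest m k) (y : LevelledForest k n),
      f (tmul (ofForest x) (ofForest y)) = g (tmul (ofForest x) (ofForest y))) : f = g := by
  refine vtensor_ext fun k x y => ?_
  refine LinearMap.congr_fun (f := f ∘ₗ (tmulₗ LF LF m k n).flip y)
    (g := g ∘ₗ (tmulₗ LF LF m k n).flip y) (LF_ext fun x => ?_) x
  exact LinearMap.congr_fun (f := f ∘ₗ tmulₗ LF LF m k n (ofForest x))
    (g := g ∘ₗ tmulₗ LF LF m k n (ofForest x)) (LF_ext fun y => h k x y) y

/-- Every pair of forests is a cut of its gluing, so linear maps are determined on cuts; `p` and `q`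
name the sizes of the two blocks of generations. -/
theorem cut_ext {f g : (LF ⊗ LF : Bicollection).obj m n →ₗ[ℂ] M}
    (h : ∀ p q (x : LevelledForest m n), x.norm = p + q → f (cut x p) = g (cut x p)) : f = g := by
  refine tmul_ofForest_ext fun k x y => ?_
  rw [tmul_ofForest]
  exact h _ _ _ (x.norm_glue y)

theorem cutRight_ext {f g : (LF ⊗ (LF ⊗ LF) : Bicollection).obj m n →ₗ[ℂ] M}
    (h : ∀ p q r (x : LevelledForest m n), x.norm = p + q + r →
      f (cutRight x p q) = g (cutRight x p q)) : f = g := by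
  refine vtensor_ext fun k x u => ?_
  refine LinearMap.congr_fun (f := f ∘ₗ (tmulₗ LF (LF ⊗ LF) m k n).flip u)
    (g := g ∘ₗ (tmulₗ LF (LF ⊗ LF) m k n).flip u) (LF_ext fun x => ?_) x
  refine LinearMap.congr_fun (f := f ∘ₗ tmulₗ LF (LF ⊗ LF) m k n (ofForest x))
    (g := g ∘ₗ tmulₗ LF (LF ⊗ LF) m k n (ofForest x)) (cut_ext fun q r y hy => ?_) u
  have e : (tmul (ofForest x) (cut y q) : (vtensor LF (LF ⊗ LF)).obj m n) =
      cutRight (x.glue y) x.norm q :=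
    tmul_congr_words (Q := LF ⊗ LF) ofForest (fun f => cut f q) (x.words_lower_glue y).symm
      (x.words_upper_glue y).symm
  have := h x.norm q r (x.glue y) (by rw [x.norm_glue, hy, add_assoc])
  rw [← e] at this
  exact this

theorem cutLeft_ext {f g : ((LF ⊗ LF) ⊗ LF : Bicollection).obj m n →ₗ[ℂ] M}
    (h : ∀ p q r (x : LevelledForest m n), x.norm = p + q + r →
      f (cutLeft x p q) = g (cutLeft x p q)) : f = g := by
  have key : f ∘ₗ (α_ LF LF LF).inv.app m n = g ∘ₗ (α_ LF LF LF).inv.app m n :=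
    cutRight_ext fun p q r x hx => by
      rw [LinearMap.comp_apply, LinearMap.comp_apply, associator_inv_cutRight]
      exact h p q r x hx
  refine LinearMap.ext fun u => ?_
  have := LinearMap.congr_fun key ((α_ LF LF LF).hom.app m n u)
  rw [LinearMap.comp_apply, LinearMap.comp_apply, ← comp_app_apply, Iso.hom_inv_id] at this
  exact this

end Ext

/-! ### The structure maps on cuts -/

theorem nabla_tmul {k : ℕ} (f : LevelledForest m k) (g : LevelledForest k n) :
    nabla.app m n (tmul (ofForest f) (ofForest g)) =
      ∑ s ∈ natShuffles f.norm g.norm, ofForest (s • f.glue g) := by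
  refine (vlift_tmul _ _ _).trans ?_
  rw [linearExtend_ofForest, linearExtend_ofForest, natShuffles, Finset.sum_map]
  exact Finset.sum_congr rfl fun s _ => by rw [LevelledForest.act_eq_smul]; rfl

theorem braiding_tmul {k : ℕ} (f : LevelledForest m k) (g : LevelledForest k n) :
    braiding.app m n (tmul (ofForest f) (ofForest g)) =
      cut (swapBlocks f.norm g.norm • f.glue g) g.norm := by
  refine (vlift_tmul _ _ _).trans ?_
  rw [linearExtend_ofForest, linearExtend_ofForest, LevelledForest.act_eq_smul,
    extendPerm_blockFlip]
  rfl

theorem nabla_cut {h : LevelledForest m n} {p q : ℕ} (hN : h.norm = p + q) :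
    nabla.app m n (cut h p) = ∑ s ∈ natShuffles p q, ofForest (s • h) := by
  have hp : p ≤ h.norm := by omega
  rw [cut]
  refine (nabla_tmul _ _).trans ?_
  rw [h.norm_lower hp, h.norm_upper hp, h.glue_lower_upper hp, hN, Nat.add_sub_cancel_left]

theorem braiding_cut {h : LevelledForest m n} {p q : ℕ} (hN : h.norm = p + q) :
    braiding.app m n (cut h p) = cut (swapBlocks p q • h) q := by
  have hp : p ≤ h.norm := by omega
  rw [cut]
  refine (braiding_tmul _ _).trans ?_
  rw [h.norm_lower hp, h.norm_upper hp, h.glue_lower_upper hp, hN, Nat.add_sub_cancel_left]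

theorem delta_ofForest (h : LevelledForest m n) :
    delta.app m n (ofForest h) = ∑ p ∈ Finset.range (h.norm + 1), cut h p :=
  linearExtend_ofForest _ _

theorem antipode_ofForest (h : LevelledForest m n) :
    antipode.app m n (ofForest h) = (-1 : ℂ) ^ h.norm • ofForest (rev h.norm • h) := by
  refine (linearExtend_ofForest _ _).trans ?_
  rw [LevelledForest.star, LevelledForest.act_eq_smul, extendPerm_revPerm]

theorem unitMap_vone (n : ℕ) :
    unitMap.app n n (vone n) = ofForest (LevelledForest.trivial rfl) :=
  vunitLift_vone (M := LF.obj n n) fun h => ofForest (LevelledForest.trivial h)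

theorem counitMap_of_norm_pos {h : LevelledForest m n} (hN : 0 < h.norm) :
    counitMap.app m n (ofForest h) = 0 := by
  refine (linearExtend_ofForest _ _).trans (dif_neg fun e => ?_)
  -- A positive norm forces `m < n`, so the condition defining the nonzero case fails.
  have := h.norm_add
  omega

theorem counitMap_trivial (n : ℕ) :
    counitMap.app n n (ofForest (LevelledForest.trivial rfl)) = vone n :=
  (linearExtend_ofForest _ _).trans (dif_pos ⟨rfl, rfl⟩)

theorem cut_zero (h : LevelledForest m n) :
    cut h 0 = tmul (ofForest (LevelledForest.trivial rfl)) (ofForest h) := by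
  refine tmul_congr_words ofForest ofForest ?_ h.words_upper_zero
  rw [LevelledForest.words_of_norm_eq_zero (h.norm_lower (Nat.zero_le _)),
    LevelledForest.words_of_norm_eq_zero (LevelledForest.norm_trivial _)]

theorem cut_norm {h : LevelledForest m n} {p : ℕ} (hp : h.norm = p) :
    cut h p = tmul (ofForest h) (ofForest (LevelledForest.trivial rfl)) := by
  subst hp
  refine tmul_congr_words ofForest ofForest h.words_lower_norm ?_
  rw [LevelledForest.words_of_norm_eq_zero (by rw [h.norm_upper le_rfl, Nat.sub_self]),
    LevelledForest.words_of_norm_eq_zero (LevelledForest.norm_trivial _)]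
  -- Both lists consist of empty words only; their lengths agree because the cut at the top level
  -- has width `n`.
  congr 1
  rw [h.cutWidth_eq le_rfl, h.norm_add]

/-- Shuffling the upper factor means acting on the whole of `h` by shifted shuffles, which leave the
lower factor unchanged. The other whiskering lemmas follow the same principle, without a shift when
the map acts on the lower factor. -/
theorem whiskerLeft_nabla {h : LevelledForest m n} {p q r : ℕ} (hN : h.norm = p + q + r) :
    (LF ◁ nabla).app m n (cutRight h p q) =
      ∑ s ∈ natShuffles q r, cut (shift p s • h) p := by
  refine (whiskerLeft_app_tmul _ _ _ _).trans ?_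
  rw [nabla_cut (q := r) (by rw [h.norm_upper (by omega)]; omega), tmul_sum]
  refine Finset.sum_congr rfl fun s hs => ?_
  have hs := mem_fixAbove_of_mem_natShuffles hs
  exact tmul_congr_words ofForest ofForest
    (LevelledForest.words_lower_shift_smul (by omega) hs).symm
    (LevelledForest.words_upper_shift_smul (by omega) hs).symm

theorem whiskerRight_nabla {h : LevelledForest m n} {p q r : ℕ} (hN : h.norm = p + q + r) :
    (nabla ▷ LF).app m n (cutLeft h p q) =
      ∑ s ∈ natShuffles p q, cut (s • h) (p + q) := by
  refine (whiskerRight_app_tmul _ _ _ _).trans ?_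
  rw [nabla_cut (q := q) (h.norm_lower (by omega)), sum_tmul]
  refine Finset.sum_congr rfl fun s hs => ?_
  have hs := mem_fixAbove_of_mem_natShuffles hs
  exact tmul_congr_words ofForest ofForest
    (LevelledForest.words_lower_smul (by omega) hs).symm
    (LevelledForest.words_upper_smul (by omega) hs).symm

theorem whiskerLeft_braiding {h : LevelledForest m n} {p q r : ℕ} (hN : h.norm = p + q + r) :
    (LF ◁ braiding).app m n (cutRight h p q) =
      cutRight (shift p (swapBlocks q r) • h) p r := by
  refine (whiskerLeft_app_tmul _ _ _ _).trans ?_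
  rw [braiding_cut (q := r) (by rw [h.norm_upper (by omega)]; omega)]
  exact tmul_congr_words (Q := LF ⊗ LF) ofForest (fun f => cut f r)
    (LevelledForest.words_lower_shift_smul (by omega) (swapBlocks_mem q r)).symm
    (LevelledForest.words_upper_shift_smul (by omega) (swapBlocks_mem q r)).symm

theorem whiskerRight_braiding {h : LevelledForest m n} {p q r : ℕ} (hN : h.norm = p + q + r) :
    (braiding ▷ LF).app m n (cutLeft h p q) = cutLeft (swapBlocks p q • h) q p := by
  refine (whiskerRight_app_tmul _ _ _ _).trans ?_
  rw [braiding_cut (q := q) (h.norm_lower (by omega)), cutLeft, add_comm q p]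
  exact tmul_congr_words (P := LF ⊗ LF) (fun f => cut f q) ofForest
    (LevelledForest.words_lower_smul (by omega) (swapBlocks_mem p q)).symm
    (LevelledForest.words_upper_smul (by omega) (swapBlocks_mem p q)).symm

theorem whiskerLeft_delta {h : LevelledForest m n} {p q : ℕ} (hN : h.norm = p + q) :
    (LF ◁ delta).app m n (cut h p) = ∑ i ∈ Finset.range (q + 1), cutRight h p i := by
  refine (whiskerLeft_app_tmul _ _ _ _).trans ?_
  rw [delta_ofForest, tmul_sum, h.norm_upper (by omega), hN, Nat.add_sub_cancel_left]
  rfl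

theorem whiskerRight_delta {h : LevelledForest m n} {p q : ℕ} (hN : h.norm = p + q) :
    (delta ▷ LF).app m n (cut h p) = ∑ i ∈ Finset.range (p + 1), cutLeft h i (p - i) := by
  refine (whiskerRight_app_tmul _ _ _ _).trans ?_
  rw [delta_ofForest, sum_tmul, h.norm_lower (by omega)]
  refine Finset.sum_congr rfl fun i hi => ?_
  rw [Finset.mem_range] at hi
  rw [cutLeft, Nat.add_sub_cancel' (by omega)]

theorem whiskerLeft_antipode {h : LevelledForest m n} {p q : ℕ} (hN : h.norm = p + q) :
    (LF ◁ antipode).app m n (cut h p) = (-1 : ℂ) ^ q • cut (shift p (rev q) • h) p := by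
  refine (whiskerLeft_app_tmul _ _ _ _).trans ?_
  rw [antipode_ofForest, tmul_smul, h.norm_upper (by omega), hN, Nat.add_sub_cancel_left]
  refine congrArg _ (tmul_congr_words ofForest ofForest
    (LevelledForest.words_lower_shift_smul (by omega) (rev_mem q)).symm
    (LevelledForest.words_upper_shift_smul (by omega) (rev_mem q)).symm)

theorem whiskerRight_antipode {h : LevelledForest m n} {p q : ℕ} (hN : h.norm = p + q) :
    (antipode ▷ LF).app m n (cut h p) = (-1 : ℂ) ^ p • cut (rev p • h) p := by
  refine (whiskerRight_app_tmul _ _ _ _).trans ?_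
  rw [antipode_ofForest, smul_tmul, h.norm_lower (by omega)]
  refine congrArg _ (tmul_congr_words ofForest ofForest
    (LevelledForest.words_lower_smul (by omega) (rev_mem p)).symm
    (LevelledForest.words_upper_smul (by omega) (rev_mem p)).symm)

/-! ### Units and counits -/

theorem whiskerRight_unitMap (h : LevelledForest m n) :
    (unitMap ▷ LF).app m n (tmul (vone m) (ofForest h)) = cut h 0 := by
  refine (whiskerRight_app_tmul _ _ _ _).trans ?_
  rw [unitMap_vone, cut_zero]

theorem whiskerLeft_unitMap {h : LevelledForest m n} {p : ℕ} (hp : h.norm = p) :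
    (LF ◁ unitMap).app m n (tmul (ofForest h) (vone n)) = cut h p := by
  refine (whiskerLeft_app_tmul _ _ _ _).trans ?_
  rw [unitMap_vone, cut_norm hp]

theorem whiskerRight_counitMap_zero (h : LevelledForest m n) :
    (counitMap ▷ LF).app m n (cut h 0) = tmul (vone m) (ofForest h) := by
  rw [cut_zero]
  refine (whiskerRight_app_tmul _ _ _ _).trans ?_
  rw [counitMap_trivial]

theorem whiskerRight_counitMap_pos {h : LevelledForest m n} {p : ℕ} (hp : p ≤ h.norm)
    (h0 : 0 < p) : (counitMap ▷ LF).app m n (cut h p) = 0 := by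
  refine (whiskerRight_app_tmul _ _ _ _).trans ?_
  rw [counitMap_of_norm_pos (by rwa [h.norm_lower hp])]
  exact zero_tmul _

theorem whiskerLeft_counitMap_norm {h : LevelledForest m n} {p : ℕ} (hp : h.norm = p) :
    (LF ◁ counitMap).app m n (cut h p) = tmul (ofForest h) (vone n) := by
  rw [cut_norm hp]
  refine (whiskerLeft_app_tmul _ _ _ _).trans ?_
  rw [counitMap_trivial]

theorem whiskerLeft_counitMap_lt {h : LevelledForest m n} {p : ℕ} (hp : p < h.norm) :
    (LF ◁ counitMap).app m n (cut h p) = 0 := by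
  refine (whiskerLeft_app_tmul _ _ _ _).trans ?_
  rw [counitMap_of_norm_pos (by rw [h.norm_upper hp.le]; omega)]
  exact tmul_zero _

section Ext

variable {M : Type} [AddCommGroup M] [Module ℂ M]

theorem unit_tensor_ext {f g : (𝟙_ Bicollection ⊗ LF : Bicollection).obj m n →ₗ[ℂ] M}
    (h : ∀ x : LevelledForest m n, f (tmul (vone m) (ofForest x)) = g (tmul (vone m) (ofForest x))) :
    f = g :=
  vunit_vtensor_ext fun x => LinearMap.congr_fun (f := f ∘ₗ tmulₗ vunit LF m m n (vone m))
    (g := g ∘ₗ tmulₗ vunit LF m m n (vone m)) (LF_ext h) x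

theorem tensor_unit_ext {f g : (LF ⊗ 𝟙_ Bicollection : Bicollection).obj m n →ₗ[ℂ] M}
    (h : ∀ x : LevelledForest m n, f (tmul (ofForest x) (vone n)) = g (tmul (ofForest x) (vone n))) :
    f = g :=
  vtensor_vunit_ext fun x => LinearMap.congr_fun (f := f ∘ₗ (tmulₗ LF vunit m n n).flip (vone n))
    (g := g ∘ₗ (tmulₗ LF vunit m n n).flip (vone n)) (LF_ext h) x

end Ext

/-! ### The monoid and the comonoid -/

theorem nabla_cut_zero (h : LevelledForest m n) : nabla.app m n (cut h 0) = ofForest h := by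
  rw [nabla_cut (zero_add _).symm, natShuffles_zero_left, Finset.sum_singleton, h.one_smul']

theorem nabla_cut_norm {h : LevelledForest m n} {p : ℕ} (hp : h.norm = p) :
    nabla.app m n (cut h p) = ofForest h := by
  rw [nabla_cut (hp.trans (add_zero _).symm), natShuffles_zero_right, Finset.sum_singleton,
    h.one_smul']

theorem unitMap_nabla : unitMap ▷ LF ≫ nabla = (λ_ LF).hom := by
  refine hom_ext fun m n => unit_tensor_ext fun h => ?_
  rw [comp_app_apply, whiskerRight_unitMap, nabla_cut_zero]
  exact (leftUnitor_hom_app_tmul _).symm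

theorem nabla_unitMap : LF ◁ unitMap ≫ nabla = (ρ_ LF).hom := by
  refine hom_ext fun m n => tensor_unit_ext fun h => ?_
  rw [comp_app_apply, whiskerLeft_unitMap rfl, nabla_cut_norm rfl]
  exact (rightUnitor_hom_app_tmul _).symm

theorem nabla_assoc : nabla ▷ LF ≫ nabla = (α_ LF LF LF).hom ≫ LF ◁ nabla ≫ nabla := by
  refine hom_ext fun m n => cutLeft_ext fun p q r h hN => ?_
  simp only [comp_app_apply]
  rw [whiskerRight_nabla hN, associator_hom_cutLeft, whiskerLeft_nabla hN, map_sum, map_sum,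
    Finset.sum_congr rfl fun s _ => nabla_cut (h := s • h) (q := r) (by rwa [h.norm_smul]),
    Finset.sum_congr rfl fun s _ => nabla_cut (h := shift p s • h) (q := q + r)
      (by rw [h.norm_smul]; omega),
    Finset.sum_comm, Finset.sum_comm (s := natShuffles q r)]
  -- Each side is now a double sum of successive actions on the same `h`, with the sum over the
  -- outer shuffles in front.
  refine Eq.trans ?_ ((sum_natShuffles_assoc p q r fun s => ofForest (s • h)).trans ?_)
  · refine Finset.sum_congr rfl fun s hs => Finset.sum_congr rfl fun t ht => ?_
    have hs := fixAbove_mono hN.ge (mem_fixAbove_of_mem_natShuffles hs)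
    have ht : t ∈ fixAbove h.norm := fixAbove_mono (by omega) (mem_fixAbove_of_mem_natShuffles ht)
    rw [LevelledForest.smul_smul' hs ht]
  · refine Finset.sum_congr rfl fun s hs => Finset.sum_congr rfl fun t ht => ?_
    have hs : s ∈ fixAbove h.norm := fixAbove_mono (by omega) (mem_fixAbove_of_mem_natShuffles hs)
    have ht : shift p t ∈ fixAbove h.norm :=
      fixAbove_mono (by omega) (shift_mem (mem_fixAbove_of_mem_natShuffles ht))
    rw [LevelledForest.smul_smul' hs ht]

instance : MonObj LF where
  one := unitMap
  mul := nabla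
  one_mul := unitMap_nabla
  mul_one := nabla_unitMap
  mul_assoc := nabla_assoc

theorem counitMap_delta : delta ≫ counitMap ▷ LF = (λ_ LF).inv := by
  refine hom_ext fun m n => LF_ext fun h => ?_
  rw [comp_app_apply, delta_ofForest, map_sum, Finset.sum_eq_single_of_mem 0 (by simp),
    whiskerRight_counitMap_zero]
  · rfl
  · intro p hp h0
    rw [Finset.mem_range] at hp
    exact whiskerRight_counitMap_pos (by omega) (by omega)

theorem delta_counitMap : delta ≫ LF ◁ counitMap = (ρ_ LF).inv := by
  refine hom_ext fun m n => LF_ext fun h => ?_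
  rw [comp_app_apply, delta_ofForest, map_sum, Finset.sum_eq_single_of_mem h.norm (by simp),
    whiskerLeft_counitMap_norm rfl]
  · rfl
  · intro p hp h0
    rw [Finset.mem_range] at hp
    exact whiskerLeft_counitMap_lt (by omega)

theorem delta_coassoc :
    delta ≫ LF ◁ delta = delta ≫ delta ▷ LF ≫ (α_ LF LF LF).hom := by
  refine hom_ext fun m n => LF_ext fun h => ?_
  simp only [comp_app_apply]
  rw [delta_ofForest, map_sum, map_sum, map_sum]
  have e1 : ∀ p ∈ Finset.range (h.norm + 1), (LF ◁ delta).app m n (cut h p) =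
      ∑ i ∈ Finset.range (h.norm - p + 1), cutRight h p i := fun p hp => by
    rw [Finset.mem_range] at hp
    exact whiskerLeft_delta (by omega)
  have e2 : ∀ p ∈ Finset.range (h.norm + 1),
      (α_ LF LF LF).hom.app m n ((delta ▷ LF).app m n (cut h p)) =
      ∑ i ∈ Finset.range (p + 1), cutRight h i (p - i) := fun p hp => by
    rw [Finset.mem_range] at hp
    rw [whiskerRight_delta (q := h.norm - p) (by omega), map_sum]
    exact Finset.sum_congr rfl fun i _ => associator_hom_cutLeft h i (p - i)
  rw [Finset.sum_congr rfl e1, Finset.sum_congr rfl e2, Finset.sum_sigma', Finset.sum_sigma']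
  -- Both sides run over pairs of levels. On the left the lower level comes first, followed by the
  -- gap; on the right the higher level comes first, followed by the lower one.
  refine Finset.sum_nbij' (fun x => ⟨x.1 + x.2, x.1⟩) (fun x => ⟨x.2, x.1 - x.2⟩) ?_ ?_ ?_ ?_ ?_
  · rintro ⟨p, i⟩ hx
    simp only [Finset.mem_sigma, Finset.mem_range] at hx ⊢
    omega
  · rintro ⟨p, i⟩ hx
    simp only [Finset.mem_sigma, Finset.mem_range] at hx ⊢
    omega
  · rintro ⟨p, i⟩ hx
    simp
  · rintro ⟨p, i⟩ hx
    simp only [Finset.mem_sigma, Finset.mem_range] at hx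
    simp only [Nat.add_sub_cancel' (show i ≤ p by omega)]
  · rintro ⟨p, i⟩ hx
    simp

instance : ComonObj LF where
  counit := counitMap
  comul := delta
  counit_comul := counitMap_delta
  comul_counit := delta_counitMap
  comul_assoc := delta_coassoc

/-! ### The local symmetry -/

theorem braiding_braiding : braiding ≫ braiding = 𝟙 (LF ⊗ LF) := by
  refine hom_ext fun m n => cut_ext fun p q h hN => ?_
  rw [comp_app_apply, braiding_cut hN, braiding_cut (q := p) (by rw [h.norm_smul]; omega),
    LevelledForest.smul_smul' (hN ▸ swapBlocks_mem' q p) (hN ▸ swapBlocks_mem p q),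
    swapBlocks_mul_swapBlocks, h.one_smul']
  rfl

theorem braiding_braid :
    braiding ▷ LF ≫ (α_ LF LF LF).hom ≫ LF ◁ braiding ≫ (α_ LF LF LF).inv ≫ braiding ▷ LF ≫
      (α_ LF LF LF).hom =
    (α_ LF LF LF).hom ≫ LF ◁ braiding ≫ (α_ LF LF LF).inv ≫ braiding ▷ LF ≫
      (α_ LF LF LF).hom ≫ LF ◁ braiding := by
  refine hom_ext fun m n => cutLeft_ext fun p q r h hN => ?_
  have hm : ∀ {N : ℕ} {s : Equiv.Perm ℕ}, s ∈ fixAbove N → N ≤ p + q + r → s ∈ fixAbove h.norm :=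
    fun hs hle => fixAbove_mono (by omega) hs
  simp only [comp_app_apply]
  rw [whiskerRight_braiding hN, associator_hom_cutLeft,
    whiskerLeft_braiding (r := r) (by rw [h.norm_smul]; omega), associator_inv_cutRight,
    whiskerRight_braiding (r := p) (by simp only [LevelledForest.norm_smul]; omega),
    associator_hom_cutLeft, associator_hom_cutLeft, whiskerLeft_braiding hN,
    associator_inv_cutRight, whiskerRight_braiding (r := q) (by rw [h.norm_smul]; omega),
    associator_hom_cutLeft, whiskerLeft_braiding (r := q) (by simp only [LevelledForest.norm_smul]; omega),
    LevelledForest.smul_smul' (hm (shift_mem (swapBlocks_mem p r)) (by omega))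
      (hm (swapBlocks_mem p q) (by omega)),
    LevelledForest.smul_smul' (hm (swapBlocks_mem q r) (by omega))
      (mul_mem (hm (shift_mem (swapBlocks_mem p r)) (by omega))
        (hm (swapBlocks_mem p q) (by omega))),
    LevelledForest.smul_smul' (hm (swapBlocks_mem p r) (by omega))
      (hm (shift_mem (swapBlocks_mem q r)) (by omega)),
    LevelledForest.smul_smul' (hm (shift_mem (swapBlocks_mem p q)) (by omega))
      (mul_mem (hm (swapBlocks_mem p r) (by omega))
        (hm (shift_mem (swapBlocks_mem q r)) (by omega))), swapBlocks_braid]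

/-- Naturality moves the shuffle across the exchange of `p + q` with `r`, and the hexagon splits
that exchange into two. -/
theorem nabla_braiding_left : nabla ▷ LF ≫ braiding =
    (α_ LF LF LF).hom ≫ LF ◁ braiding ≫ (α_ LF LF LF).inv ≫ braiding ▷ LF ≫
      (α_ LF LF LF).hom ≫ LF ◁ nabla := by
  refine hom_ext fun m n => cutLeft_ext fun p q r h hN => ?_
  have hm : ∀ {N : ℕ} {s : Equiv.Perm ℕ}, s ∈ fixAbove N → N ≤ p + q + r → s ∈ fixAbove h.norm :=
    fun hs hle => fixAbove_mono (by omega) hs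
  simp only [comp_app_apply]
  rw [whiskerRight_nabla hN, map_sum, associator_hom_cutLeft, whiskerLeft_braiding hN,
    associator_inv_cutRight, whiskerRight_braiding (r := q) (by rw [h.norm_smul]; omega),
    associator_hom_cutLeft, whiskerLeft_nabla (r := q) (by simp only [LevelledForest.norm_smul]; omega)]
  refine Finset.sum_congr rfl fun s hs => ?_
  have hs := mem_fixAbove_of_mem_natShuffles hs
  rw [braiding_cut (q := r) (by rw [h.norm_smul]; omega),
    LevelledForest.smul_smul' (hm (swapBlocks_mem (p + q) r) (by omega)) (hm hs (by omega)),
    swapBlocks_mul _ hs, swapBlocks_add_left,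
    LevelledForest.smul_smul' (hm (swapBlocks_mem p r) (by omega))
      (hm (shift_mem (swapBlocks_mem q r)) (by omega)),
    LevelledForest.smul_smul' (hm (shift_mem hs) (by omega))
      (mul_mem (hm (swapBlocks_mem p r) (by omega))
        (hm (shift_mem (swapBlocks_mem q r)) (by omega)))]

theorem nabla_braiding_right : LF ◁ nabla ≫ braiding =
    (α_ LF LF LF).inv ≫ braiding ▷ LF ≫ (α_ LF LF LF).hom ≫ LF ◁ braiding ≫
      (α_ LF LF LF).inv ≫ nabla ▷ LF := by
  refine hom_ext fun m n => cutRight_ext fun p q r h hN => ?_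
  have hm : ∀ {N : ℕ} {s : Equiv.Perm ℕ}, s ∈ fixAbove N → N ≤ p + q + r → s ∈ fixAbove h.norm :=
    fun hs hle => fixAbove_mono (by omega) hs
  simp only [comp_app_apply]
  rw [whiskerLeft_nabla hN, map_sum, associator_inv_cutRight, whiskerRight_braiding hN,
    associator_hom_cutLeft, whiskerLeft_braiding (r := r) (by rw [h.norm_smul]; omega),
    associator_inv_cutRight,
    whiskerRight_nabla (r := p) (by simp only [LevelledForest.norm_smul]; omega)]
  refine Finset.sum_congr rfl fun s hs => ?_
  have hs := mem_fixAbove_of_mem_natShuffles hs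
  rw [braiding_cut (q := q + r) (by rw [h.norm_smul]; omega),
    LevelledForest.smul_smul' (hm (swapBlocks_mem p (q + r)) (by omega))
      (hm (shift_mem hs) (by omega)), swapBlocks_mul_shift _ hs, swapBlocks_add_right,
    LevelledForest.smul_smul' (hm (shift_mem (swapBlocks_mem p r)) (by omega))
      (hm (swapBlocks_mem p q) (by omega)),
    LevelledForest.smul_smul' (hm hs (by omega))
      (mul_mem (hm (shift_mem (swapBlocks_mem p r)) (by omega))
        (hm (swapBlocks_mem p q) (by omega)))]

theorem unitMap_braiding_left :
    unitMap ▷ LF ≫ braiding = (λ_ LF).hom ≫ (ρ_ LF).inv ≫ LF ◁ unitMap := by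
  refine hom_ext fun m n => unit_tensor_ext fun h => ?_
  simp only [comp_app_apply]
  rw [whiskerRight_unitMap, braiding_cut (zero_add _).symm, swapBlocks_zero_left, h.one_smul']
  refine (whiskerLeft_unitMap rfl).symm.trans ?_
  exact congrArg (fun x => (LF ◁ unitMap).app m n ((ρ_ LF).inv.app m n x))
    (leftUnitor_hom_app_tmul (ofForest h)).symm

theorem unitMap_braiding_right :
    LF ◁ unitMap ≫ braiding = (ρ_ LF).hom ≫ (λ_ LF).inv ≫ unitMap ▷ LF := by
  refine hom_ext fun m n => tensor_unit_ext fun h => ?_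
  simp only [comp_app_apply]
  rw [whiskerLeft_unitMap rfl, braiding_cut (add_zero _).symm, swapBlocks_zero_right, h.one_smul']
  refine (whiskerRight_unitMap h).symm.trans ?_
  exact congrArg (fun x => (unitMap ▷ LF).app m n ((λ_ LF).inv.app m n x))
    (rightUnitor_hom_app_tmul (ofForest h)).symm

/-- Each level `i` of the lower factor gives one term, and that term is the hexagon for the
decomposition `p = i + j`. -/
theorem braiding_delta_left : braiding ≫ LF ◁ delta =
    delta ▷ LF ≫ (α_ LF LF LF).hom ≫ LF ◁ braiding ≫ (α_ LF LF LF).inv ≫ braiding ▷ LF ≫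
      (α_ LF LF LF).hom := by
  refine hom_ext fun m n => cut_ext fun p r h hN => ?_
  simp only [comp_app_apply]
  rw [braiding_cut hN, whiskerLeft_delta (q := p) (by rw [h.norm_smul]; omega),
    whiskerRight_delta hN, map_sum, map_sum, map_sum, map_sum, map_sum]
  refine Finset.sum_congr rfl fun i hi => ?_
  obtain ⟨j, rfl⟩ := Nat.exists_eq_add_of_le (Nat.lt_succ_iff.1 (Finset.mem_range.1 hi))
  rw [Nat.add_sub_cancel_left, associator_hom_cutLeft, whiskerLeft_braiding hN,
    associator_inv_cutRight, whiskerRight_braiding (r := j) (by rw [h.norm_smul]; omega),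
    associator_hom_cutLeft, swapBlocks_add_left,
    LevelledForest.smul_smul' (fixAbove_mono (by omega) (swapBlocks_mem i r))
      (fixAbove_mono (by omega) (shift_mem (swapBlocks_mem j r)))]

theorem braiding_delta_right : braiding ≫ delta ▷ LF =
    LF ◁ delta ≫ (α_ LF LF LF).inv ≫ braiding ▷ LF ≫ (α_ LF LF LF).hom ≫ LF ◁ braiding ≫
      (α_ LF LF LF).inv := by
  refine hom_ext fun m n => cut_ext fun p r h hN => ?_
  simp only [comp_app_apply]
  rw [braiding_cut hN, whiskerRight_delta (q := p) (by rw [h.norm_smul]; omega),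
    whiskerLeft_delta hN, map_sum, map_sum, map_sum, map_sum, map_sum]
  refine Finset.sum_congr rfl fun i hi => ?_
  obtain ⟨j, rfl⟩ := Nat.exists_eq_add_of_le (Nat.lt_succ_iff.1 (Finset.mem_range.1 hi))
  rw [Nat.add_sub_cancel_left, associator_inv_cutRight,
    whiskerRight_braiding (r := j) (by omega),
    associator_hom_cutLeft, whiskerLeft_braiding (r := j) (by rw [h.norm_smul]; omega),
    associator_inv_cutRight, swapBlocks_add_right,
    LevelledForest.smul_smul' (fixAbove_mono (by omega) (shift_mem (swapBlocks_mem p j)))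
      (fixAbove_mono (by omega) (swapBlocks_mem p i))]

theorem braiding_counitMap_left :
    braiding ≫ LF ◁ counitMap = counitMap ▷ LF ≫ (λ_ LF).hom ≫ (ρ_ LF).inv := by
  refine hom_ext fun m n => cut_ext fun p q h hN => ?_
  simp only [comp_app_apply]
  rw [braiding_cut hN]
  rcases Nat.eq_zero_or_pos p with rfl | hp
  · rw [swapBlocks_zero_left, h.one_smul', whiskerLeft_counitMap_norm (by omega),
      whiskerRight_counitMap_zero]
    exact congrArg ((ρ_ LF).inv.app m n) (leftUnitor_hom_app_tmul _).symm
  · rw [whiskerLeft_counitMap_lt (by rw [h.norm_smul]; omega),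
      whiskerRight_counitMap_pos (by omega) hp, map_zero, map_zero]

theorem braiding_counitMap_right :
    braiding ≫ counitMap ▷ LF = LF ◁ counitMap ≫ (ρ_ LF).hom ≫ (λ_ LF).inv := by
  refine hom_ext fun m n => cut_ext fun p q h hN => ?_
  simp only [comp_app_apply]
  rw [braiding_cut hN]
  rcases Nat.eq_zero_or_pos q with rfl | hq
  · rw [swapBlocks_zero_right, h.one_smul', whiskerLeft_counitMap_norm (by omega),
      whiskerRight_counitMap_zero]
    exact congrArg ((λ_ LF).inv.app m n) (rightUnitor_hom_app_tmul _).symm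
  · rw [whiskerLeft_counitMap_lt (by omega),
      whiskerRight_counitMap_pos (by rw [h.norm_smul]; omega) hq, map_zero, map_zero]

theorem isLocalSymmetry_braiding : IsLocalSymmetry LF braiding where
  symmetry := braiding_braiding
  braid := braiding_braid
  mul_left := nabla_braiding_left
  mul_right := nabla_braiding_right
  one_left := unitMap_braiding_left
  one_right := unitMap_braiding_right
  comul_left := braiding_delta_left
  comul_right := braiding_delta_right
  counit_left := braiding_counitMap_left
  counit_right := braiding_counitMap_right

/-! ### The monoid structure of `𝓛𝓕 ⦶ 𝓛𝓕` -/

theorem tensorMul_app_tmul {k₁ k₂ k₂' k₃ : ℕ} (a : LF.obj m k₁) {b : LF.obj k₁ k₂}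
    {c : LF.obj k₂ k₃} {c' : LF.obj k₁ k₂'} {b' : LF.obj k₂' k₃} (d : LF.obj k₃ n)
    (h : braiding.app k₁ k₃ (tmul b c) = tmul c' b') :
    (tensorMul LF braiding).app m n (tmul (tmul a b) (tmul c d)) =
      tmul (nabla.app m k₂' (tmul a c')) (nabla.app k₂' n (tmul b' d)) := by
  simp only [tensorMul, comp_app_apply]
  -- The six maps composing the twisted product are evaluated innermost first; the nested `congrArg`
  -- stand for the maps still to be applied.
  refine (congrArg _ (congrArg _ (congrArg _ (congrArg _ (congrArg _
    (associator_hom_app_tmul a b (tmul c d))))))).trans ?_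
  refine (congrArg _ (congrArg _ (congrArg _ (congrArg _
    ((whiskerLeft_app_tmul _ _ _ _).trans
      (congrArg (tmul a) (associator_inv_app_tmul b c d))))))).trans ?_
  refine (congrArg _ (congrArg _ (congrArg _ ((whiskerLeft_app_tmul _ _ _ _).trans
    (congrArg (tmul a) ((whiskerRight_app_tmul _ _ _ _).trans
      (congrArg (fun x => tmul x d) h))))))).trans ?_
  refine (congrArg _ (congrArg _ ((whiskerLeft_app_tmul _ _ _ _).trans
    (congrArg (tmul a) (associator_hom_app_tmul c' b' d))))).trans ?_
  refine (congrArg _ (associator_inv_app_tmul a c' (tmul b' d))).trans ?_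
  exact tensorHom_app_tmul _ _ _ _

/-- The braiding of two forests is a single tensor rather than a sum, so the axioms on `LF ⊠ LF` can
be checked by following individual factors. -/
theorem exists_braiding_eq {k : ℕ} (b : LevelledForest m k) (c : LevelledForest k n) :
    ∃ (k' : ℕ) (c' : LevelledForest m k') (b' : LevelledForest k' n),
      braiding.app m n (tmul (ofForest b) (ofForest c)) = tmul (ofForest c') (ofForest b') :=
  ⟨_, _, _, braiding_tmul b c⟩

theorem nabla_assoc_apply {k l : ℕ} (x : LF.obj m k) (y : LF.obj k l) (z : LF.obj l n) :
    nabla.app m n (tmul (nabla.app m l (tmul x y)) z) =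
      nabla.app m n (tmul x (nabla.app k n (tmul y z))) := by
  have := LinearMap.congr_fun (congrArg (fun f => Hom.app f m n) nabla_assoc) (tmul (tmul x y) z)
  refine Eq.trans ?_ (this.trans ?_)
  · exact congrArg _ (whiskerRight_app_tmul _ _ _ _).symm
  · exact congrArg (nabla.app m n) ((congrArg ((LF ◁ nabla).app m n)
      (associator_hom_app_tmul x y z)).trans (whiskerLeft_app_tmul _ _ _ _))

/-- Elementwise naturality of the braiding: `z` crosses `y`, then `x`, and the displaced factors are
multiplied afterwards. -/
theorem braiding_nabla_left_apply {k l i j : ℕ} {x : LF.obj m k} {y : LF.obj k l} {z : LF.obj l n}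
    {z' : LF.obj k i} {y' : LF.obj i n} {z'' : LF.obj m j} {x' : LF.obj j i}
    (hyz : braiding.app k n (tmul y z) = tmul z' y')
    (hxz : braiding.app m i (tmul x z') = tmul z'' x') :
    braiding.app m n (tmul (nabla.app m l (tmul x y)) z) =
      tmul z'' (nabla.app j n (tmul x' y')) := by
  have := LinearMap.congr_fun (congrArg (fun f => Hom.app f m n) nabla_braiding_left)
    (tmul (tmul x y) z)
  refine Eq.trans ?_ (this.trans ?_)
  · exact congrArg _ (whiskerRight_app_tmul _ _ _ _).symm
  simp only [comp_app_apply]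
  refine (congrArg _ (congrArg _ (congrArg _ (congrArg _ (congrArg _
    (associator_hom_app_tmul x y z)))))).trans ?_
  refine (congrArg _ (congrArg _ (congrArg _ (congrArg _ ((whiskerLeft_app_tmul _ _ _ _).trans
    (congrArg (tmul x) hyz)))))).trans ?_
  refine (congrArg _ (congrArg _ (congrArg _ (associator_inv_app_tmul x z' y')))).trans ?_
  refine (congrArg _ (congrArg _ ((whiskerRight_app_tmul _ _ _ _).trans
    (congrArg (fun u => tmul u y') hxz)))).trans ?_
  refine (congrArg _ (associator_hom_app_tmul z'' x' y')).trans ?_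
  exact whiskerLeft_app_tmul _ _ _ _

theorem braiding_nabla_right_apply {k l i j : ℕ} {x : LF.obj m k} {y : LF.obj k l} {z : LF.obj l n}
    {y' : LF.obj m i} {x' : LF.obj i l} {z' : LF.obj i j} {x'' : LF.obj j n}
    (hxy : braiding.app m l (tmul x y) = tmul y' x')
    (hxz : braiding.app i n (tmul x' z) = tmul z' x'') :
    braiding.app m n (tmul x (nabla.app k n (tmul y z))) =
      tmul (nabla.app m j (tmul y' z')) x'' := by
  have := LinearMap.congr_fun (congrArg (fun f => Hom.app f m n) nabla_braiding_right)
    (tmul x (tmul y z))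
  refine Eq.trans ?_ (this.trans ?_)
  · exact congrArg _ (whiskerLeft_app_tmul _ _ _ _).symm
  simp only [comp_app_apply]
  refine (congrArg _ (congrArg _ (congrArg _ (congrArg _ (congrArg _
    (associator_inv_app_tmul x y z)))))).trans ?_
  refine (congrArg _ (congrArg _ (congrArg _ (congrArg _ ((whiskerRight_app_tmul _ _ _ _).trans
    (congrArg (fun u => tmul u z) hxy)))))).trans ?_
  refine (congrArg _ (congrArg _ (congrArg _ (associator_hom_app_tmul y' x' z)))).trans ?_
  refine (congrArg _ (congrArg _ ((whiskerLeft_app_tmul _ _ _ _).trans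
    (congrArg (tmul y') hxz)))).trans ?_
  refine (congrArg _ (associator_inv_app_tmul y' z' x'')).trans ?_
  exact whiskerRight_app_tmul _ _ _ _

section Ext

variable {M : Type} [AddCommGroup M] [Module ℂ M]

theorem tensor_pair_ext {P : Bicollection}
    {f g : (P ⊗ (LF ⊗ LF) : Bicollection).obj m n →ₗ[ℂ] M}
    (h : ∀ k l (u : P.obj m k) (x : LevelledForest k l) (y : LevelledForest l n),
      f (tmul u (tmul (ofForest x) (ofForest y))) = g (tmul u (tmul (ofForest x) (ofForest y)))) :
    f = g := by
  refine vtensor_ext fun k u v => ?_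
  exact LinearMap.congr_fun (f := f ∘ₗ tmulₗ P (LF ⊗ LF) m k n u)
    (g := g ∘ₗ tmulₗ P (LF ⊗ LF) m k n u) (tmul_ofForest_ext fun l x y => h k l u x y) v

theorem pair_pair_pair_ext
    {f g : (((LF ⊗ LF) ⊗ (LF ⊗ LF)) ⊗ (LF ⊗ LF) : Bicollection).obj m n →ₗ[ℂ] M}
    (H : ∀ k₁ k₂ k₃ k₄ k₅ (x₁ : LevelledForest m k₁) (x₂ : LevelledForest k₁ k₂)
      (x₃ : LevelledForest k₂ k₃) (x₄ : LevelledForest k₃ k₄) (x₅ : LevelledForest k₄ k₅)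
      (x₆ : LevelledForest k₅ n),
      f (tmul (tmul (tmul (ofForest x₁) (ofForest x₂)) (tmul (ofForest x₃) (ofForest x₄)))
        (tmul (ofForest x₅) (ofForest x₆))) =
      g (tmul (tmul (tmul (ofForest x₁) (ofForest x₂)) (tmul (ofForest x₃) (ofForest x₄)))
        (tmul (ofForest x₅) (ofForest x₆)))) : f = g := by
  refine tensor_pair_ext fun k₄ k₅ u x₅ x₆ => ?_
  refine LinearMap.congr_fun
    (f := f ∘ₗ (tmulₗ ((LF ⊗ LF) ⊗ (LF ⊗ LF)) (LF ⊗ LF) m k₄ n).flip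
      (tmul (ofForest x₅) (ofForest x₆)))
    (g := g ∘ₗ (tmulₗ ((LF ⊗ LF) ⊗ (LF ⊗ LF)) (LF ⊗ LF) m k₄ n).flip
      (tmul (ofForest x₅) (ofForest x₆))) (tensor_pair_ext fun k₂ k₃ u x₃ x₄ => ?_) u
  refine LinearMap.congr_fun
    (f := (f ∘ₗ (tmulₗ ((LF ⊗ LF) ⊗ (LF ⊗ LF)) (LF ⊗ LF) m k₄ n).flip
      (tmul (ofForest x₅) (ofForest x₆))) ∘ₗ (tmulₗ (LF ⊗ LF) (LF ⊗ LF) m k₂ k₄).flip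
      (tmul (ofForest x₃) (ofForest x₄)))
    (g := (g ∘ₗ (tmulₗ ((LF ⊗ LF) ⊗ (LF ⊗ LF)) (LF ⊗ LF) m k₄ n).flip
      (tmul (ofForest x₅) (ofForest x₆))) ∘ₗ (tmulₗ (LF ⊗ LF) (LF ⊗ LF) m k₂ k₄).flip
      (tmul (ofForest x₃) (ofForest x₄))) (tmul_ofForest_ext fun k₁ x₁ x₂ => ?_) u
  exact H k₁ k₂ k₃ k₄ k₅ x₁ x₂ x₃ x₄ x₅ x₆

end Ext

theorem tensorMul_assoc : tensorMul LF braiding ▷ (LF ⊗ LF) ≫ tensorMul LF braiding =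
    (α_ (LF ⊗ LF) (LF ⊗ LF) (LF ⊗ LF)).hom ≫ (LF ⊗ LF) ◁ tensorMul LF braiding ≫
      tensorMul LF braiding := by
  refine hom_ext fun m n => pair_pair_pair_ext fun k₁ k₂ k₃ k₄ k₅ a b c d e f => ?_
  -- Both bracketings need the crossings of `b` with `c` and of `d` with `e`, followed by the
  -- crossing of the displaced `b'` and `e'`. By naturality these suffice, and associativity in each
  -- of the two factors concludes.
  obtain ⟨i₁, c', b', h1⟩ := exists_braiding_eq b c
  obtain ⟨i₂, e', d', h2⟩ := exists_braiding_eq d e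
  obtain ⟨i₃, e'', b'', h3⟩ := exists_braiding_eq b' e'
  have s1 : (tensorMul LF braiding ▷ (LF ⊗ LF)).app m n
      (tmul (tmul (tmul (ofForest a) (ofForest b)) (tmul (ofForest c) (ofForest d)))
        (tmul (ofForest e) (ofForest f))) =
      tmul (tmul (nabla.app _ _ (tmul (ofForest a) (ofForest c')))
        (nabla.app _ _ (tmul (ofForest b') (ofForest d)))) (tmul (ofForest e) (ofForest f)) :=
    (whiskerRight_app_tmul _ _ _ _).trans
      (congrArg (fun u => tmul u _) (tensorMul_app_tmul (ofForest a) (ofForest d) h1))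
  have s2 : ((LF ⊗ LF) ◁ tensorMul LF braiding).app m n
      (tmul (tmul (ofForest a) (ofForest b)) (tmul (tmul (ofForest c) (ofForest d))
        (tmul (ofForest e) (ofForest f)))) =
      tmul (tmul (ofForest a) (ofForest b)) (tmul (nabla.app _ _ (tmul (ofForest c) (ofForest e')))
        (nabla.app _ _ (tmul (ofForest d') (ofForest f)))) :=
    (whiskerLeft_app_tmul _ _ _ _).trans
      (congrArg (fun u => tmul _ u) (tensorMul_app_tmul (ofForest c) (ofForest f) h2))
  have s3 := associator_hom_app_tmul (P := LF ⊗ LF) (Q := LF ⊗ LF) (R := LF ⊗ LF)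
    (tmul (ofForest a) (ofForest b)) (tmul (ofForest c) (ofForest d))
    (tmul (ofForest e) (ofForest f))
  rw [comp_app_apply, comp_app_apply, comp_app_apply]
  refine (congrArg ((tensorMul LF braiding).app m n) s1).trans ?_
  refine Eq.trans ?_ (congrArg ((tensorMul LF braiding).app m n) ((congrArg
    (((LF ⊗ LF) ◁ tensorMul LF braiding).app m n) s3).trans s2)).symm
  refine (tensorMul_app_tmul _ _ (braiding_nabla_left_apply h2 h3)).trans ?_
  refine Eq.trans ?_ (tensorMul_app_tmul _ _ (braiding_nabla_right_apply h1 h3)).symm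
  rw [nabla_assoc_apply, nabla_assoc_apply]

theorem tensorOne_app (n : ℕ) : (tensorOne LF).app n n (vone n) =
    tmul (ofForest (LevelledForest.trivial rfl)) (ofForest (LevelledForest.trivial rfl)) := by
  simp only [tensorOne, comp_app_apply]
  refine (tensorHom_app_tmul unitMap unitMap (vone n) (vone n)).trans ?_
  rw [unitMap_vone]

theorem nabla_trivial_tmul (h : LevelledForest m n) :
    nabla.app m n (tmul (ofForest (LevelledForest.trivial rfl)) (ofForest h)) = ofForest h :=
  (congrArg (nabla.app m n) (cut_zero h).symm).trans (nabla_cut_zero h)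

theorem nabla_tmul_trivial (h : LevelledForest m n) :
    nabla.app m n (tmul (ofForest h) (ofForest (LevelledForest.trivial rfl))) = ofForest h :=
  (congrArg (nabla.app m n) (cut_norm rfl).symm).trans (nabla_cut_norm rfl)

theorem braiding_trivial_tmul (h : LevelledForest m n) :
    braiding.app m n (tmul (ofForest (LevelledForest.trivial rfl)) (ofForest h)) =
      tmul (ofForest h) (ofForest (LevelledForest.trivial rfl)) := by
  rw [← cut_norm rfl, ← cut_zero, braiding_cut (zero_add _).symm, swapBlocks_zero_left, h.one_smul']

theorem braiding_tmul_trivial (h : LevelledForest m n) :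
    braiding.app m n (tmul (ofForest h) (ofForest (LevelledForest.trivial rfl))) =
      tmul (ofForest (LevelledForest.trivial rfl)) (ofForest h) := by
  rw [← cut_norm rfl, ← cut_zero, braiding_cut (add_zero _).symm, swapBlocks_zero_right,
    h.one_smul']

theorem tensorOne_tensorMul :
    tensorOne LF ▷ (LF ⊗ LF) ≫ tensorMul LF braiding = (λ_ (LF ⊗ LF)).hom := by
  refine hom_ext fun m n => vunit_vtensor_ext fun u => ?_
  refine LinearMap.congr_fun
    (f := (tensorOne LF ▷ (LF ⊗ LF) ≫ tensorMul LF braiding).app m n ∘ₗ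
      tmulₗ vunit (LF ⊗ LF) m m n (vone m))
    (g := (λ_ (LF ⊗ LF)).hom.app m n ∘ₗ tmulₗ vunit (LF ⊗ LF) m m n (vone m))
    (tmul_ofForest_ext fun k c d => ?_) u
  refine Eq.trans ?_ (leftUnitor_hom_app_tmul _).symm
  refine (congrArg ((tensorMul LF braiding).app m n) ((whiskerRight_app_tmul _ _ _ _).trans
    (congrArg (fun u => tmul u (tmul (ofForest c) (ofForest d))) (tensorOne_app m)))).trans ?_
  refine (tensorMul_app_tmul _ _ (braiding_trivial_tmul c)).trans ?_
  rw [nabla_trivial_tmul, nabla_trivial_tmul]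

theorem tensorMul_tensorOne :
    (LF ⊗ LF) ◁ tensorOne LF ≫ tensorMul LF braiding = (ρ_ (LF ⊗ LF)).hom := by
  refine hom_ext fun m n => vtensor_vunit_ext fun u => ?_
  refine LinearMap.congr_fun
    (f := ((LF ⊗ LF) ◁ tensorOne LF ≫ tensorMul LF braiding).app m n ∘ₗ
      (tmulₗ (LF ⊗ LF) vunit m n n).flip (vone n))
    (g := (ρ_ (LF ⊗ LF)).hom.app m n ∘ₗ (tmulₗ (LF ⊗ LF) vunit m n n).flip (vone n))
    (tmul_ofForest_ext fun k c d => ?_) u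
  refine Eq.trans ?_ (rightUnitor_hom_app_tmul _).symm
  refine (congrArg ((tensorMul LF braiding).app m n) ((whiskerLeft_app_tmul _ _ _ _).trans
    (congrArg (tmul (tmul (ofForest c) (ofForest d))) (tensorOne_app n)))).trans ?_
  refine (tensorMul_app_tmul _ _ (braiding_tmul_trivial d)).trans ?_
  rw [nabla_tmul_trivial, nabla_tmul_trivial]

/-! ### The coproduct and the counit are morphisms of monoids -/

theorem unitMap_delta : unitMap ≫ delta = tensorOne LF := by
  refine hom_ext fun m n => vunit_ext fun e => ?_
  subst e
  refine Eq.trans ?_ (tensorOne_app m).symm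
  rw [comp_app_apply, unitMap_vone, delta_ofForest, LevelledForest.norm_trivial, zero_add,
    Finset.sum_range_one, cut_zero]

theorem unitMap_counitMap : unitMap ≫ counitMap = 𝟙 (𝟙_ Bicollection) := by
  refine hom_ext fun m n => vunit_ext fun e => ?_
  subst e
  rw [comp_app_apply, unitMap_vone, counitMap_trivial]
  rfl

theorem nabla_counitMap :
    nabla ≫ counitMap = (counitMap ⊗ₘ counitMap) ≫ (λ_ (𝟙_ Bicollection)).hom := by
  refine hom_ext fun m n => cut_ext fun p q h hN => ?_
  simp only [comp_app_apply]
  rcases Nat.eq_zero_or_pos h.norm with h0 | h0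
  · obtain rfl : p = 0 := by omega
    rw [nabla_cut_zero]
    obtain rfl : m = n := by have := h.norm_add; omega
    rw [LevelledForest.eq_trivial h0, counitMap_trivial, cut_zero]
    refine Eq.trans ?_ (congrArg _ (tensorHom_app_tmul _ _ _ _).symm)
    rw [counitMap_trivial]
    exact (leftUnitor_hom_app_tmul _).symm
  · rw [nabla_cut hN, map_sum,
      Finset.sum_eq_zero fun s _ => counitMap_of_norm_pos (by rwa [h.norm_smul])]
    have e : (counitMap ⊗ₘ counitMap).app m n (cut h p) = 0 := by
      refine (tensorHom_app_tmul _ _ _ _).trans ?_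
      rcases Nat.eq_zero_or_pos p with rfl | hp
      · rw [counitMap_of_norm_pos (h := h.upper 0) (by rw [h.norm_upper (by omega)]; omega)]
        exact tmul_zero _
      · rw [counitMap_of_norm_pos (h := h.lower p) (by rw [h.norm_lower (by omega)]; omega)]
        exact zero_tmul _
    rw [e, map_zero]

/-- The argument is `h` cut at the levels `i`, `p` and `p + j`. The braiding exchanges the two
middle blocks, after which the two products shuffle the generations below and above level `i + j`.
-/
theorem tensorMul_cut {h : LevelledForest m n} {p q i j : ℕ} (hN : h.norm = p + q) (hi : i ≤ p)
    (hj : j ≤ q) :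
    (tensorMul LF braiding).app m n (tmul (cut (h.lower p) i) (cut (h.upper p) j)) =
      ∑ s ∈ natShuffles i j, ∑ t ∈ natShuffles (p - i) (q - j),
        cut ((s * shift (i + j) t * shift i (swapBlocks (p - i) j)) • h) (i + j) := by
  obtain ⟨i', rfl⟩ := Nat.exists_eq_add_of_le hi
  obtain ⟨j', rfl⟩ := Nat.exists_eq_add_of_le hj
  rw [Nat.add_sub_cancel_left, Nat.add_sub_cancel_left]
  have hσ := shift_mem (p := i) (swapBlocks_mem i' j)
  -- `h'` is the forest after the middle exchange; the remaining maps are computed on its cuts.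
  set h' := shift i (swapBlocks i' j) • h with hh'
  have hN' : h'.norm = i + i' + (j + j') := by rw [hh', h.norm_smul, hN]
  simp only [tensorMul, comp_app_apply]
  refine (congrArg _ (congrArg _ (congrArg _ (congrArg _ (congrArg _
    (associator_hom_cut (R := LF ⊗ LF) (fun f => cut f j) h i i')))))).trans ?_
  refine (congrArg _ (congrArg _ (congrArg _ (congrArg _ ((whiskerLeft_app_tmul _ _ _ _).trans
    (congrArg (tmul (ofForest (h.lower i))) (associator_inv_cutRight (h.upper i) i' j))))))).trans ?_
  refine (congrArg _ (congrArg _ (congrArg _ ((whiskerLeft_app_tmul _ _ _ _).trans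
    (congrArg (tmul (ofForest (h.lower i))) (whiskerRight_braiding (h := h.upper i) (p := i')
      (q := j) (r := j') (by rw [h.norm_upper (by omega)]; omega))))))).trans ?_
  refine (congrArg _ (congrArg _ ((whiskerLeft_app_tmul _ _ _ _).trans
    (congrArg (tmul (ofForest (h.lower i))) (associator_hom_cutLeft _ _ _))))).trans ?_
  have e : (tmul (ofForest (h.lower i)) (cutRight (swapBlocks i' j • h.upper i) j i') :
      (vtensor LF (LF ⊗ (LF ⊗ LF))).obj m n) =
      tmul (ofForest (h'.lower i)) (cutRight (h'.upper i) j i') :=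
    tmul_congr_words (Q := LF ⊗ (LF ⊗ LF)) ofForest (fun f => cutRight f j i')
      (LevelledForest.words_lower_shift_smul (by omega) (swapBlocks_mem i' j)).symm
      (LevelledForest.words_upper_shift_smul (by omega) (swapBlocks_mem i' j)).symm
  refine (congrArg _ (congrArg _ e)).trans ?_
  refine (congrArg _ (associator_inv_cut (R := LF ⊗ LF) (fun f => cut f i') h' i j)).trans ?_
  refine (tensorHom_app_tmul nabla nabla _ _).trans ?_
  rw [nabla_cut (q := j) (h'.norm_lower (by omega)),
    nabla_cut (q := j') (by rw [h'.norm_upper (by omega)]; omega), sum_tmul]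
  refine Finset.sum_congr rfl fun s hs => ?_
  rw [tmul_sum]
  refine Finset.sum_congr rfl fun t ht => ?_
  have hs := mem_fixAbove_of_mem_natShuffles hs
  have ht := mem_fixAbove_of_mem_natShuffles ht
  have hs' : s ∈ fixAbove h.norm := fixAbove_mono (by omega) hs
  have ht' : shift (i + j) t ∈ fixAbove h.norm := fixAbove_mono (by omega) (shift_mem ht)
  have hσ' : shift i (swapBlocks i' j) ∈ fixAbove h.norm := fixAbove_mono (by omega) hσ
  -- The product of permutations is undone into successive actions, so that `t` can be absorbed by
  -- the upper factor and `s` by the lower one.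
  rw [← LevelledForest.smul_smul' (mul_mem hs' ht') hσ', ← hh', ← LevelledForest.smul_smul'
    (by rwa [hN', ← hN]) (by rwa [hN', ← hN])]
  refine (tmul_congr_words (fun f => ofForest (s • f)) ofForest
    (LevelledForest.words_lower_shift_smul (f := h') (by omega) ht).symm
    (LevelledForest.words_upper_shift_smul (by omega) ht).symm).trans ?_
  exact tmul_congr_words ofForest ofForest
    (LevelledForest.words_lower_smul (by rw [LevelledForest.norm_smul]; omega) hs).symm
    (LevelledForest.words_upper_smul (by rw [LevelledForest.norm_smul]; omega) hs).symm

theorem nabla_delta : nabla ≫ delta = (delta ⊗ₘ delta) ≫ tensorMul LF braiding := by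
  refine hom_ext fun m n => cut_ext fun p q h hN => ?_
  simp only [comp_app_apply]
  have e : (delta ⊗ₘ delta).app m n (cut h p) = ∑ i ∈ Finset.range (p + 1),
      ∑ j ∈ Finset.range (q + 1), tmul (cut (h.lower p) i) (cut (h.upper p) j) := by
    refine (tensorHom_app_tmul _ _ _ _).trans ?_
    rw [delta_ofForest, delta_ofForest, h.norm_lower (by omega), h.norm_upper (by omega), hN,
      Nat.add_sub_cancel_left, sum_tmul]
    exact Finset.sum_congr rfl fun i _ => tmul_sum _ _ _
  rw [e, nabla_cut hN, map_sum, map_sum]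
  simp only [delta_ofForest, h.norm_smul, hN]
  -- The left side sums over shuffles and levels, the right side over levels in each factor and then
  -- over two shuffles.
  refine (sum_natShuffles_cut p q fun a s => cut (s • h) a).trans ?_
  refine Finset.sum_congr rfl fun i hi => ?_
  rw [map_sum]
  refine Finset.sum_congr rfl fun j hj => ?_
  rw [Finset.mem_range] at hi hj
  exact (tensorMul_cut hN (by omega) (by omega)).symm

/-! ### The antipode -/

theorem counitMap_unitMap_of_norm_pos {h : LevelledForest m n} (hN : 0 < h.norm) :
    (counitMap ≫ unitMap).app m n (ofForest h) = 0 := by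
  rw [comp_app_apply, counitMap_of_norm_pos hN, map_zero]

theorem counitMap_unitMap_of_norm_zero {h : LevelledForest m n} (hN : h.norm = 0) :
    (counitMap ≫ unitMap).app m n (ofForest h) = ofForest h := by
  obtain rfl : m = n := by have := h.norm_add; omega
  rw [LevelledForest.eq_trivial hN, comp_app_apply, counitMap_trivial, unitMap_vone]

theorem rev_zero : rev 0 = 1 := by
  ext x
  simp [rev_apply]

/-- At level `p` the antipode contributes `(-1) ^ p` and `rev p`, and the product contributes the
shuffles: the alternating sum over valleys, which vanishes in positive norm. In norm zero a single
term is left. -/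
theorem antipode_nabla_left : delta ≫ antipode ▷ LF ≫ nabla = counitMap ≫ unitMap := by
  refine hom_ext fun m n => LF_ext fun h => ?_
  have e : (delta ≫ antipode ▷ LF ≫ nabla).app m n (ofForest h) =
      ∑ p ∈ Finset.range (h.norm + 1), (-1 : ℂ) ^ p • ∑ s ∈ natShuffles p (h.norm - p),
        ofForest ((s * rev p) • h) := by
    simp only [comp_app_apply]
    rw [delta_ofForest, map_sum, map_sum]
    refine Finset.sum_congr rfl fun p hp => ?_
    rw [Finset.mem_range] at hp
    rw [whiskerRight_antipode (q := h.norm - p) (by omega), map_smul,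
      nabla_cut (q := h.norm - p) (by rw [h.norm_smul]; omega)]
    congr 1
    refine Finset.sum_congr rfl fun s hs => ?_
    have hs : s ∈ fixAbove h.norm := fixAbove_mono (by omega) (mem_fixAbove_of_mem_natShuffles hs)
    rw [LevelledForest.smul_smul' hs (fixAbove_mono (by omega) (rev_mem p))]
  rw [e]
  rcases Nat.eq_zero_or_pos h.norm with h0 | h0
  · rw [counitMap_unitMap_of_norm_zero h0, h0, zero_add, Finset.sum_range_one, pow_zero, one_smul,
      natShuffles_zero_left, Finset.sum_singleton, rev_zero, one_mul, h.one_smul']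
  · rw [counitMap_unitMap_of_norm_pos h0]
    exact sum_natShuffles_mul_rev h0 fun s => ofForest (s • h)

theorem antipode_nabla_right : delta ≫ LF ◁ antipode ≫ nabla = counitMap ≫ unitMap := by
  refine hom_ext fun m n => LF_ext fun h => ?_
  have e : (delta ≫ LF ◁ antipode ≫ nabla).app m n (ofForest h) =
      ∑ p ∈ Finset.range (h.norm + 1), (-1 : ℂ) ^ (h.norm - p) •
        ∑ s ∈ natShuffles p (h.norm - p), ofForest ((s * shift p (rev (h.norm - p))) • h) := by
    simp only [comp_app_apply]
    rw [delta_ofForest, map_sum, map_sum]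
    refine Finset.sum_congr rfl fun p hp => ?_
    rw [Finset.mem_range] at hp
    rw [whiskerLeft_antipode (q := h.norm - p) (by omega), map_smul,
      nabla_cut (q := h.norm - p) (by rw [h.norm_smul]; omega)]
    congr 1
    refine Finset.sum_congr rfl fun s hs => ?_
    have hs : s ∈ fixAbove h.norm := fixAbove_mono (by omega) (mem_fixAbove_of_mem_natShuffles hs)
    rw [LevelledForest.smul_smul' hs (fixAbove_mono (by omega) (shift_mem (rev_mem _)))]
  rw [e]
  rcases Nat.eq_zero_or_pos h.norm with h0 | h0
  · rw [counitMap_unitMap_of_norm_zero h0, h0, zero_add, Finset.sum_range_one, Nat.sub_zero,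
      pow_zero, one_smul, natShuffles_zero_left, Finset.sum_singleton, rev_zero, shift_one,
      one_mul, h.one_smul']
  · rw [counitMap_unitMap_of_norm_pos h0]
    exact sum_natShuffles_mul_shift_rev h0 fun s => ofForest (s • h)

theorem isHopfMonoid_LF : IsHopfMonoid LF braiding antipode where
  localSymmetry := isLocalSymmetry_braiding
  tensorMon := ⟨
    { one := tensorOne LF
      mul := tensorMul LF braiding
      one_mul := tensorOne_tensorMul
      mul_one := tensorMul_tensorOne
      mul_assoc := tensorMul_assoc }, rfl, rfl⟩
  mul_comul := nabla_delta
  one_comul := unitMap_delta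
  mul_counit := nabla_counitMap
  one_counit := unitMap_counitMap
  antipode_left := antipode_nabla_left
  antipode_right := antipode_nabla_right

/-! ### Conilpotency -/

/-- The subtracted terms are the cuts at the bottom and at the top level; these levels are distinct
because the norm is positive. -/
theorem reducedComul_ofForest {h : LevelledForest m n} (hN : 0 < h.norm) :
    (reducedComul LF).app m n (ofForest h) = ∑ p ∈ Finset.Ico 1 h.norm, cut h p := by
  have e : (reducedComul LF).app m n (ofForest h) =
      delta.app m n (ofForest h) - (unitMap ▷ LF).app m n (tmul (vone m) (ofForest h)) -
        (LF ◁ unitMap).app m n (tmul (ofForest h) (vone n)) := rfl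
  rw [e, whiskerRight_unitMap, whiskerLeft_unitMap rfl, delta_ofForest, Finset.sum_range_succ,
    Finset.range_eq_Ico, Finset.sum_eq_sum_Ico_succ_bot hN]
  abel

/-- An interior cut leaves an upper part of positive and strictly smaller norm, to which the
induction hypothesis applies. -/
theorem iteratedReducedComul_ofForest (j : ℕ) {m n : ℕ} {h : LevelledForest m n}
    (h0 : 0 < h.norm) (hj : h.norm ≤ j) :
    (iteratedReducedComul LF j).app m n (ofForest h) = 0 := by
  induction j generalizing m n with
  | zero => omega
  | succ j ih =>
    have e : (iteratedReducedComul LF (j + 1)).app m n (ofForest h) =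
        (LF ◁ iteratedReducedComul LF j).app m n ((reducedComul LF).app m n (ofForest h)) := rfl
    rw [e, reducedComul_ofForest h0, map_sum]
    refine Finset.sum_eq_zero fun p hp => ?_
    rw [Finset.mem_Ico] at hp
    refine (whiskerLeft_app_tmul _ _ _ _).trans ?_
    rw [ih (by rw [h.norm_upper (by omega)]; omega) (by rw [h.norm_upper (by omega)]; omega)]
    exact tmul_zero _

theorem isConilpotent_LF : IsConilpotent LF := by
  intro m n x hx
  rcases eq_or_ne m n with rfl | hmn
  -- All forests of `LF(m, m)` have norm zero, so unit after counit is the identity there and the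
  -- kernel of the counit is zero.
  · have e : LinearMap.id = unitMap.app m m ∘ₗ counitMap.app m m := LF_ext fun h => by
      have := counitMap_unitMap_of_norm_zero (h := h) (by have := h.norm_add; omega)
      exact this.symm
    have hx0 : x = 0 := by
      have := LinearMap.congr_fun e x
      rw [LinearMap.comp_apply] at this
      exact this.trans ((congrArg _ hx).trans (map_zero _))
    exact ⟨0, fun j _ => by rw [hx0, map_zero]⟩
  -- For `m ≠ n` every forest has norm `n - m`, which is positive and at most `n`, so `n` serves as
  -- a uniform bound.
  · refine ⟨n, fun j hj => ?_⟩
    have e : (iteratedReducedComul LF j).app m n = 0 := LF_ext fun h => by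
      have := h.norm_add
      exact iteratedReducedComul_ofForest j (by omega) (by omega)
    rw [e, LinearMap.zero_apply]

end

end LevelledForests

theorem mainTheorem2 :
    ∃ (M : MonObj LF) (N : ComonObj LF),
      (M.mul = nabla ∧ M.one = unitMap ∧ N.comul = delta ∧ N.counit = counitMap) ∧
      IsHopfMonoid LF braiding antipode ∧ IsConilpotent LF :=
  ⟨inferInstance, inferInstance, ⟨rfl, rfl, rfl, rfl⟩, isHopfMonoid_LF, isConilpotent_LF⟩
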